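/- **Lemma 5.1 (global inf-sup stability).** Let $d\in\{2,3\}$ and let $\Omega_f,\Omega_s\subset\mathbb R^d$ be disjoint bounded polygonal/polyhedral domains with Lipschitz boundary, with $\partial\Omega_f=\Sigma\cup\Gamma_0$ and $\partial\Omega_s=\Sigma\cup\Gamma_D\cup\Gamma_N$, where the parts are closed and overlap only in sets of zero surface measure and $\Sigma$ has positive surface measure; $\boldsymbol n$ is the unit normal, outward to $\Omega_f$ on $\partial\Omega_f$. Let $$V=\{\boldsymbol v\in H^1(\Omega_s)^d:\boldsymbol v=\boldsymbol 0\text{ on }\Gamma_D\},\quad W=\{\boldsymbol\tau\in H(\mathrm{div},\Omega_f):\boldsymbol\tau\cdot\boldsymbol n\in L^2(\Gamma_0)\},\quad Q=L^2(\Omega_s),$$ $$Y=\{(\boldsymbol v,\boldsymbol\tau)\in V\times W:\boldsymbol v\cdot\boldsymbol n=\boldsymbol\tau\cdot\boldsymbol n\text{ on }\Sigma\text{ in the sense of }H^{-1/2}\}.$$ Let $\rho_s,\rho_f,c,g>0$ be constants. Let $E,\nu$ be measurable on $\Omega_s$ with $0<E_0\le E\le E_1$ and $0<\nu_0\le\nu\le\frac12$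 almost everywhere, for some constants $E_0,E_1,\nu_0$, and put $\mu=\frac{E}{2(1+\nu)}$, $\frac1\lambda=\frac{(1+\nu)(1-2\nu)}{E\nu}$ (so $\frac1\lambda=0$ where $\nu=\frac12$). With $\boldsymbol\varepsilon(\boldsymbol u)=\frac12(\nabla\boldsymbol u+\nabla\boldsymbol u^{\mathtt t})$ define on $Y\times Q$ $$\begin{aligned}A(((\boldsymbol u,\boldsymbol w),p),((\boldsymbol v,\boldsymbol\tau),q))={}&\int_{\Omega_s}2\mu\,\boldsymbol\varepsilon(\boldsymbol u):\boldsymbol\varepsilon(\boldsymbol v)-\int_{\Omega_s}p\,\mathrm{div}\,\boldsymbol v+\int_{\Omega_f}c^2\rho_f\,\mathrm{div}\,\boldsymbol w\,\mathrm{div}\,\boldsymbol\tau+\int_{\Gamma_0}g\rho_f(\boldsymbol w\cdot\boldsymbol n)(\boldsymbol\tau\cdot\boldsymbol n)\\&-\int_{\Omega_s}q\,\mathrm{div}\,\boldsymbol u-\int_{\Omega_s}\tfrac1\lambda\,p\,q+\int_{\Omega_s}\rho_s\boldsymbol u\cdot\boldsymbol v+\int_{\Omega_f}\rho_f\boldsymbol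 w\cdot\boldsymbol\tau,\end{aligned}$$ $$\begin{aligned}|||((\boldsymbol v,\boldsymbol\tau),q)|||_H^2={}&\|\mu^{1/2}\nabla\boldsymbol v\|_{0,\Omega_s}^2+\|\mu^{-1/2}q\|_{0,\Omega_s}^2+\|\lambda^{-1/2}q\|_{0,\Omega_s}^2+\|\rho_s^{1/2}\boldsymbol v\|_{0,\Omega_s}^2\\&+\|(c^2\rho_f)^{1/2}\mathrm{div}\,\boldsymbol\tau\|_{0,\Omega_f}^2+\|\rho_f^{1/2}\boldsymbol\tau\|_{0,\Omega_f}^2+\|(g\rho_f)^{1/2}\boldsymbol\tau\cdot\boldsymbol n\|_{0,\Gamma_0}^2.\end{aligned}$$ Then there is a constant $C>0$ such that for every $((\boldsymbol u,\boldsymbol w),p)\in Y\times Q$ there exists $((\boldsymbol v,\boldsymbol\tau),q)\in Y\times Q$ with $$|||((\boldsymbol v,\boldsymbol\tau),q)|||_H\le C\,|||((\boldsymbol u,\boldsymbol w),p)|||_H\quad\text{and}\quad|||((\boldsymbol u,\boldsymbol w),p)|||_H^2\le C\,A(((\boldsymbol u,\boldsymbol w),p),((\boldsymbol v,\boldsymbol\tau),q)).$$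 The constant $C$ depends only on the geometry $(\Omega_f,\Omega_s,\Sigma,\Gamma_0,\Gamma_D,\Gamma_N)$, on $E_0,E_1$ and on $\rho_s,\rho_f,c,g$; in particular it is independent of $\lambda$, $\nu$ and $\nu_0$. If $\Gamma_N$ has positive surface measure, then $C$ can also be chosen independent of $\rho_f$, $c$ and $g$. -/

import Mathlib

open MeasureTheory Set Filter Topology
open scoped ContDiff RealInnerProductSpace

noncomputable section

namespace Elastoacoustic

/-- The Euclidean space `ℝᵈ`. -/
abbrev Sp (d : ℕ) : Type := EuclideanSpace ℝ (Fin d)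

/-- The surface measure: the `(d - 1)`-dimensional Hausdorff measure, with the normalization that
gives Lebesgue measure on hyperplanes. -/
def surf (d : ℕ) : Measure (Sp d) := Measure.euclideanHausdorffMeasure (d - 1)

/-- The classical partial derivative `∂ⱼ φ (x)`. -/
def pd {d : ℕ} (j : Fin d) (φ : Sp d → ℝ) (x : Sp d) : ℝ :=
  fderiv ℝ φ x (EuclideanSpace.single j 1)

/-- Test functions on the whole space: smooth with compact support. -/
def IsTest {d : ℕ} (φ : Sp d → ℝ) : Prop :=
  ContDiff ℝ ∞ φ ∧ HasCompactSupport φ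

/-! ### Domains -/

/-- Near each of its boundary points `Ω` is the strict epigraph of a Lipschitz function, with
respect to some unit direction `e`; the graph function is evaluated at the orthogonal projection
of the point to the hyperplane `e⊥`. -/
def HasLipschitzBoundary {d : ℕ} (Ω : Set (Sp d)) : Prop :=
  ∀ x ∈ frontier Ω, ∃ (e : Sp d) (r : ℝ) (K : NNReal) (γ : Sp d → ℝ),
    ‖e‖ = 1 ∧ 0 < r ∧ LipschitzWith K γ ∧
      ∀ y ∈ Metric.ball x r, y ∈ Ω ↔ γ (y - ⟪e, y⟫ • e) < ⟪e, y⟫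

/-- The boundary is contained in finitely many hyperplanes: a bounded open set with this property
is polygonal for `d = 2` and polyhedral for `d = 3`. -/
def HasPolyhedralBoundary {d : ℕ} (Ω : Set (Sp d)) : Prop :=
  ∃ S : Finset (Sp d × ℝ), (∀ h ∈ S, h.1 ≠ 0) ∧
    ∀ x ∈ frontier Ω, ∃ h ∈ S, ⟪h.1, x⟫ = h.2

/-- Bounded polygonal/polyhedral domains with Lipschitz boundary. -/
structure IsPolyhedralLipschitzDomain {d : ℕ} (Ω : Set (Sp d)) : Prop where
  isOpen : IsOpen Ω
  isConnected : IsConnected Ω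
  isBounded : Bornology.IsBounded Ω
  polyhedral : HasPolyhedralBoundary Ω
  lipschitz : HasLipschitzBoundary Ω

/-- The fluid domain `Ωf` and the solid domain `Ωs`, with the decompositions
`∂Ωf = Sig ∪ Γ0` and `∂Ωs = Sig ∪ ΓD ∪ ΓN` of their boundaries into closed parts that overlap in
sets of surface measure zero only. `Sig` is the interface, which is not negligible. -/
structure Geometry (d : ℕ) where
  Ωf : Set (Sp d)
  Ωs : Set (Sp d)
  Sig : Set (Sp d)
  Γ0 : Set (Sp d)
  ΓD : Set (Sp d)
  ΓN : Set (Sp d)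
  fluid : IsPolyhedralLipschitzDomain Ωf
  solid : IsPolyhedralLipschitzDomain Ωs
  disjoint : Disjoint Ωf Ωs
  closed_Sig : IsClosed Sig
  closed_Γ0 : IsClosed Γ0
  closed_ΓD : IsClosed ΓD
  closed_ΓN : IsClosed ΓN
  frontier_fluid : frontier Ωf = Sig ∪ Γ0
  frontier_solid : frontier Ωs = Sig ∪ ΓD ∪ ΓN
  null_Sig_Γ0 : surf d (Sig ∩ Γ0) = 0
  null_Sig_ΓD : surf d (Sig ∩ ΓD) = 0
  null_Sig_ΓN : surf d (Sig ∩ ΓN) = 0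
  null_ΓD_ΓN : surf d (ΓD ∩ ΓN) = 0
  interface_pos : 0 < surf d Sig

/-! ### Function spaces -/

/-- `g` is the weak derivative `∂ⱼ f` in the open set `Ω`. -/
def HasWeakPartial {d : ℕ} (Ω : Set (Sp d)) (j : Fin d) (f g : Sp d → ℝ) : Prop :=
  ∀ φ, IsTest φ → tsupport φ ⊆ Ω →
    ∫ x in Ω, f x * pd j φ x = - ∫ x in Ω, g x * φ x

/-- `v ∈ H¹(Ω)ᵈ` with weak gradient `(Dv)ᵢⱼ = ∂ⱼ vᵢ`. -/
def MemH1 {d : ℕ} (Ω : Set (Sp d)) (v : Sp d → Sp d)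
    (Dv : Sp d → Matrix (Fin d) (Fin d) ℝ) : Prop :=
  MemLp v 2 (volume.restrict Ω) ∧
  (∀ i j, MemLp (fun x => Dv x i j) 2 (volume.restrict Ω)) ∧
  ∀ i j, HasWeakPartial Ω j (fun x => v x i) (fun x => Dv x i j)

/-- `τ ∈ H(div, Ω)` with weak divergence `dτ`. -/
def MemHdiv {d : ℕ} (Ω : Set (Sp d)) (τ : Sp d → Sp d) (dτ : Sp d → ℝ) : Prop :=
  MemLp τ 2 (volume.restrict Ω) ∧ MemLp dτ 2 (volume.restrict Ω) ∧
  ∀ φ, IsTest φ → tsupport φ ⊆ Ω →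
    ∫ x in Ω, ∑ j, τ x j * pd j φ x = - ∫ x in Ω, dτ x * φ x

/-- `t` is the trace on `∂Ω` of the field `v ∈ H¹(Ω)ᵈ` with weak gradient `Dv`: the trace operator
is the continuous extension of the restriction to `∂Ω` of functions that are smooth up to the
boundary, so `t` is the limit in `L²(∂Ω)` of the restrictions of smooth functions that
converge to `v` in `H¹(Ω)` (componentwise). -/
def IsTrace {d : ℕ} (Ω : Set (Sp d)) (v : Sp d → Sp d)
    (Dv : Sp d → Matrix (Fin d) (Fin d) ℝ) (t : Sp d → Sp d) : Prop :=
  MemLp t 2 ((surf d).restrict (frontier Ω)) ∧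
  ∀ i, ∃ φ : ℕ → Sp d → ℝ, (∀ k, ContDiff ℝ ∞ (φ k)) ∧
    Tendsto (fun k => eLpNorm (fun x => φ k x - v x i) 2 (volume.restrict Ω)) atTop (𝓝 0) ∧
    (∀ j, Tendsto (fun k => eLpNorm (fun x => pd j (φ k) x - Dv x i j) 2 (volume.restrict Ω))
      atTop (𝓝 0)) ∧
    Tendsto (fun k => eLpNorm (fun x => φ k x - t x i) 2 ((surf d).restrict (frontier Ω)))
      atTop (𝓝 0)

/-- `v = 0` on the part `Γ` of `∂Ω`, in the sense of traces. -/
def VanishesOn {d : ℕ} (Ω Γ : Set (Sp d)) (v : Sp d → Sp d)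
    (Dv : Sp d → Matrix (Fin d) (Fin d) ℝ) : Prop :=
  ∃ t, IsTrace Ω v Dv t ∧ ∀ᵐ x ∂((surf d).restrict Γ), t x = 0

/-- The pairing `⟨τ·n, φ⟩` on `∂Ω` of the normal trace of `τ ∈ H(div, Ω)` (`n` outward to `Ω`) with
the trace of `φ`, as defined by Green's formula: `∫_Ω (τ·∇φ + (div τ) φ)`. -/
def normalPairing {d : ℕ} (Ω : Set (Sp d)) (τ : Sp d → Sp d) (dτ φ : Sp d → ℝ) : ℝ :=
  ∫ x in Ω, ((∑ j, τ x j * pd j φ x) + dτ x * φ x)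

/-- `τ·n ∈ L²(Γ)`, with density `t`, where `Γ` is a part of `∂Ω` and `Γc` is the rest of `∂Ω`:
the normal trace agrees with `t` against all test functions that vanish near `Γc`. -/
def HasNormalTraceL2 {d : ℕ} (Ω Γ Γc : Set (Sp d)) (τ : Sp d → Sp d) (dτ t : Sp d → ℝ) : Prop :=
  MemLp t 2 ((surf d).restrict Γ) ∧
  ∀ φ, IsTest φ → Disjoint (tsupport φ) Γc →
    normalPairing Ω τ dτ φ = ∫ x in Γ, t x * φ x ∂(surf d)

/-- `v·n = τ·n` on the interface, in the sense of `H^{-1/2}`: equality of both sides against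
test functions that vanish near the rest of the two boundaries. Here `n` is outward to `Ωf`, so
that it is the inward normal of `Ωs` there and `⟨v·n, φ⟩ = -normalPairing Ωs v (div v) φ`. -/
def NormalMatch {d : ℕ} (G : Geometry d) (v : Sp d → Sp d)
    (Dv : Sp d → Matrix (Fin d) (Fin d) ℝ) (τ : Sp d → Sp d) (dτ : Sp d → ℝ) : Prop :=
  ∀ φ, IsTest φ → Disjoint (tsupport φ) (G.Γ0 ∪ G.ΓD ∪ G.ΓN) →
    normalPairing G.Ωf τ dτ φ = - normalPairing G.Ωs v (fun x => (Dv x).trace) φ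

/-- The elements `((u, w), p)` of `H = Y × Q`, where
`V = {v ∈ H¹(Ωs)ᵈ : v = 0 on ΓD}`, `W = {τ ∈ H(div, Ωf) : τ·n ∈ L²(Γ0)}`,
`Y = {(v, τ) ∈ V × W : v·n = τ·n on Sig}` and `Q = L²(Ωs)`.
An element is given by representatives `u`, `w`, `p` together with its weak gradient `Du`, its weak
divergence `dw` and its normal trace `wn` on `Γ0`, all of them determined almost everywhere. -/
structure HSpace {d : ℕ} (G : Geometry d) where
  u : Sp d → Sp d
  Du : Sp d → Matrix (Fin d) (Fin d) ℝ
  w : Sp d → Sp d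
  dw : Sp d → ℝ
  wn : Sp d → ℝ
  p : Sp d → ℝ
  u_mem : MemH1 G.Ωs u Du
  u_clamped : VanishesOn G.Ωs G.ΓD u Du
  w_mem : MemHdiv G.Ωf w dw
  w_normal : HasNormalTraceL2 G.Ωf G.Γ0 G.Sig w dw wn
  matching : NormalMatch G u Du w dw
  p_mem : MemLp p 2 (volume.restrict G.Ωs)

/-! ### Coefficients -/

/-- The Lamé parameter `μ = E / (2 (1 + ν))`. -/
def lameMu {d : ℕ} (E ν : Sp d → ℝ) (x : Sp d) : ℝ := E x / (2 * (1 + ν x))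

/-- The Lamé parameter `λ = E ν / ((1 + ν) (1 - 2 ν))` (infinite for `ν = 1/2`). -/
def lameLambda {d : ℕ} (E ν : Sp d → ℝ) (x : Sp d) : ℝ :=
  E x * ν x / ((1 + ν x) * (1 - 2 * ν x))

/-- The reciprocal `1 / λ`, which is `0` in the incompressible case `ν = 1/2`. -/
def invLambda {d : ℕ} (E ν : Sp d → ℝ) (x : Sp d) : ℝ :=
  (1 + ν x) * (1 - 2 * ν x) / (E x * ν x)

theorem invLambda_eq {d : ℕ} (E ν : Sp d → ℝ) (x : Sp d) :
    invLambda E ν x = (lameLambda E ν x)⁻¹ := by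
  simp [invLambda, lameLambda]

/-- Young modulus `E` and Poisson ratio `ν`: measurable, `E₀ ≤ E ≤ E₁`, and `ν` is bounded away from
zero and at most `1/2`. -/
structure AdmissibleModuli {d : ℕ} (Ωs : Set (Sp d)) (E₀ E₁ : ℝ) (E ν : Sp d → ℝ) : Prop where
  measurable_E : AEMeasurable E (volume.restrict Ωs)
  measurable_ν : AEMeasurable ν (volume.restrict Ωs)
  bounds_E : ∀ᵐ x ∂(volume.restrict Ωs), E₀ ≤ E x ∧ E x ≤ E₁
  bounds_ν : ∃ ν₀ : ℝ, 0 < ν₀ ∧ ∀ᵐ x ∂(volume.restrict Ωs), ν₀ ≤ ν x ∧ ν x ≤ 1 / 2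

/-! ### Bilinear form and norm -/

/-- The strain tensor `ε = (∇u + ∇uᵗ) / 2`. -/
def strain {d : ℕ} (M : Matrix (Fin d) (Fin d) ℝ) : Matrix (Fin d) (Fin d) ℝ :=
  (1 / 2 : ℝ) • (M + M.transpose)

/-- The Frobenius product `M : N`. -/
def frob {d : ℕ} (M N : Matrix (Fin d) (Fin d) ℝ) : ℝ := ∑ i, ∑ j, M i j * N i j

/-- `B(((u,w),p), ((v,τ),q))`. -/
def formB {d : ℕ} (G : Geometry d) (ρs ρf : ℝ) (X Z : HSpace G) : ℝ :=
  (∫ x in G.Ωs, ρs * ⟪X.u x, Z.u x⟫) + ∫ x in G.Ωf, ρf * ⟪X.w x, Z.w x⟫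

/-- `A(((u,w),p), ((v,τ),q))`. -/
def formA {d : ℕ} (G : Geometry d) (ρs ρf c g : ℝ) (E ν : Sp d → ℝ) (X Z : HSpace G) : ℝ :=
  (∫ x in G.Ωs, 2 * lameMu E ν x * frob (strain (X.Du x)) (strain (Z.Du x)))
  - (∫ x in G.Ωs, X.p x * (Z.Du x).trace)
  + (∫ x in G.Ωf, c ^ 2 * ρf * (X.dw x * Z.dw x))
  + (∫ x in G.Γ0, g * ρf * (X.wn x * Z.wn x) ∂(surf d))
  - (∫ x in G.Ωs, Z.p x * (X.Du x).trace)
  - (∫ x in G.Ωs, invLambda E ν x * (X.p x * Z.p x))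
  + formB G ρs ρf X Z

/-- The square of the parameter-weighted norm `|||((v,τ),q)|||`. -/
def normHSq {d : ℕ} (G : Geometry d) (ρs ρf c g : ℝ) (E ν : Sp d → ℝ) (Z : HSpace G) : ℝ :=
  (∫ x in G.Ωs, lameMu E ν x * frob (Z.Du x) (Z.Du x))
  + (∫ x in G.Ωs, (lameMu E ν x)⁻¹ * Z.p x ^ 2)
  + (∫ x in G.Ωs, invLambda E ν x * Z.p x ^ 2)
  + (∫ x in G.Ωs, ρs * ‖Z.u x‖ ^ 2)
  + (∫ x in G.Ωf, c ^ 2 * ρf * Z.dw x ^ 2)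
  + (∫ x in G.Ωf, ρf * ‖Z.w x‖ ^ 2)
  + (∫ x in G.Γ0, g * ρf * Z.wn x ^ 2 ∂(surf d))

/-- The parameter-weighted norm `|||((v,τ),q)|||`. -/
def normH {d : ℕ} (G : Geometry d) (ρs ρf c g : ℝ) (E ν : Sp d → ℝ) (Z : HSpace G) : ℝ :=
  Real.sqrt (normHSq G ρs ρf c g E ν Z)

/-- Global stability with constant `C`: every `X ∈ H` has a test function `Z ∈ H` with
`|||Z||| ≤ C |||X|||` and `|||X|||² ≤ C A(X, Z)`. -/
def InfSupStable {d : ℕ} (G : Geometry d) (ρs ρf c g : ℝ) (E ν : Sp d → ℝ) (C : ℝ) : Prop :=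
  ∀ X : HSpace G, ∃ Z : HSpace G,
    normH G ρs ρf c g E ν Z ≤ C * normH G ρs ρf c g E ν X ∧
    normH G ρs ρf c g E ν X ^ 2 ≤ C * formA G ρs ρf c g E ν X Z

end Elastoacoustic

end

/-!
Every `X = ((u, w), p)` is tested with `((u, w) + δ (v, τ), -p)`. The mixed terms of `A(X, X)`
then cancel except for `-δ ∫ p div v`, and Young's inequality gives half of the elastic, fluid and
inertial energies of `X`, the term `∫ p² / λ`, and `-δ ∫ p div v` minus `δ²` times the energy of
`(v, τ)` (`formA_addSmul_ge`). Two facts remain to be shown, both with constants that see the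
moduli through `E₀ / 3 ≤ μ ≤ E₁ / 2` only: Korn's inequality, which bounds `∇u` by the strain and
by `u` itself, and the inf-sup condition, which provides for every `p ∈ L²(Ωs)` some `(v, τ) ∈ Y`
with `-∫ p div v ≥ β ‖p‖²` and energy at most `C₁ ‖p‖²`. A small `δ`, namely `β / (2 C₁)`, then
makes the pressure term win (`exists_infSupStable`).

Both facts follow from the Nečas inequality on bounded connected Lipschitz domains: the distance
in `L²` of a function to the constants is controlled by the `H⁻¹` norm of its gradient
(`oscBound_of_lipschitz`). On a domain that is star-shaped with respect to an open set it is dual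
to a right inverse of the divergence, the Bogovskii operator, which moves the mass of a function
of mean value zero along segments into that open set. Its components are differences of functions
with Fourier transform `∫₀¹ ĥ((1 - s)ξ) φ̂(sξ) ds`, where `(φ, h)` is `(zᵢ χ, g)` or `(χ, yᵢ g)`,
and their gradients are estimated in `L²` by an elementary weighted inequality
(`exists_lintegral_ft_le`) instead of the theory of singular integrals. All kernels are mollified,
so that only smooth functions occur. A Lipschitz domain is covered by balls and thin cylinders
around boundary points, in which it is star-shaped, and the inequality is glued along overlaps
(`OscBound.union`, `of_finite_cover`).

Korn's inequality (`korn`) follows since `∂ⱼ∂ₖuᵢ` is a combination of first derivatives of the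
strain. For the inf-sup condition, the Nečas inequality yields fields with compact support in `Ωs`
that control `p` up to its mean value; the mean value is controlled by one fixed `Ψ ∈ Y` with a
nonzero flux through `∂Ωs` (`exists_div_test`). Such a `Ψ` is a smooth field near a point of the
interface that crosses it (`exists_field_flux`); for this the fluid has to lie on the other side
of the interface (`GraphChart.below_subset_fluid`). If `ΓN` is not negligible, `Ψ` can be
supported near a point of `ΓN` instead (`exists_solidField_flux`), and then it vanishes in the
fluid, which makes the constants independent of `ρf`, `c` and `g`.
-/

noncomputable section

namespace Elastoacoustic

variable {d : ℕ}

/-! ### Test functions -/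

theorem IsTest.continuous {φ : Sp d → ℝ} (h : IsTest φ) : Continuous φ := h.1.continuous

theorem IsTest.differentiable {φ : Sp d → ℝ} (h : IsTest φ) : Differentiable ℝ φ :=
  h.1.differentiable (by simp)

theorem isTest_zero : IsTest (fun _ : Sp d => (0 : ℝ)) :=
  ⟨contDiff_const, HasCompactSupport.zero⟩

theorem IsTest.add {φ ψ : Sp d → ℝ} (hφ : IsTest φ) (hψ : IsTest ψ) :
    IsTest (fun x => φ x + ψ x) :=
  ⟨hφ.1.add hψ.1, hφ.2.add hψ.2⟩

theorem IsTest.mul_left {φ ψ : Sp d → ℝ} (hφ : ContDiff ℝ ∞ φ) (hψ : IsTest ψ) :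
    IsTest (fun x => φ x * ψ x) :=
  ⟨hφ.mul hψ.1, hψ.2.mul_left⟩

theorem IsTest.mul {φ ψ : Sp d → ℝ} (hφ : IsTest φ) (hψ : IsTest ψ) :
    IsTest (fun x => φ x * ψ x) := hψ.mul_left hφ.1

theorem IsTest.const_mul {φ : Sp d → ℝ} (c : ℝ) (hφ : IsTest φ) :
    IsTest (fun x => c * φ x) := IsTest.mul_left contDiff_const hφ

theorem IsTest.sub {φ ψ : Sp d → ℝ} (hφ : IsTest φ) (hψ : IsTest ψ) :
    IsTest (fun x => φ x - ψ x) := by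
  simpa [sub_eq_add_neg] using hφ.add (hψ.const_mul (-1))

theorem contDiff_pd {φ : Sp d → ℝ} (h : ContDiff ℝ ∞ φ) (j : Fin d) : ContDiff ℝ ∞ (pd j φ) := by
  unfold pd
  exact (h.fderiv_right (m := ∞) (by simp)).clm_apply contDiff_const

theorem tsupport_pd_subset (φ : Sp d → ℝ) (j : Fin d) : tsupport (pd j φ) ⊆ tsupport φ :=
  tsupport_fderiv_apply_subset ℝ _

theorem IsTest.pd {φ : Sp d → ℝ} (h : IsTest φ) (j : Fin d) : IsTest (pd j φ) :=
  ⟨contDiff_pd h.1 j, h.2.of_isClosed_subset (isClosed_tsupport _) (tsupport_pd_subset φ j)⟩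

theorem IsTest.memLp {φ : Sp d → ℝ} (h : IsTest φ) {p : ENNReal} (μ : Measure (Sp d))
    [IsFiniteMeasureOnCompacts μ] : MemLp φ p μ :=
  h.continuous.memLp_of_hasCompactSupport h.2

theorem IsTest.integrable {φ : Sp d → ℝ} (h : IsTest φ) (μ : Measure (Sp d))
    [IsFiniteMeasureOnCompacts μ] : Integrable φ μ :=
  h.continuous.integrable_of_hasCompactSupport h.2

theorem pd_mul {φ ψ : Sp d → ℝ} (hφ : Differentiable ℝ φ) (hψ : Differentiable ℝ ψ) (j : Fin d)
    (x : Sp d) : pd j (fun x => φ x * ψ x) x = φ x * pd j ψ x + pd j φ x * ψ x := by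
  simp only [pd]
  rw [fderiv_fun_mul (hφ x) (hψ x)]
  simp [mul_comm]

theorem pd_add {φ ψ : Sp d → ℝ} (hφ : Differentiable ℝ φ) (hψ : Differentiable ℝ ψ) (j : Fin d)
    (x : Sp d) : pd j (fun x => φ x + ψ x) x = pd j φ x + pd j ψ x := by
  simp only [pd]
  rw [fderiv_fun_add (hφ x) (hψ x)]
  simp

theorem pd_sub {φ ψ : Sp d → ℝ} (hφ : Differentiable ℝ φ) (hψ : Differentiable ℝ ψ) (j : Fin d)
    (x : Sp d) : pd j (fun x => φ x - ψ x) x = pd j φ x - pd j ψ x := by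
  simp only [pd]
  rw [fderiv_fun_sub (hφ x) (hψ x)]
  simp

theorem pd_const_mul {φ : Sp d → ℝ} (hφ : Differentiable ℝ φ) (c : ℝ) (j : Fin d)
    (x : Sp d) : pd j (fun x => c * φ x) x = c * pd j φ x := by
  simp only [pd]
  rw [fderiv_const_mul (hφ x)]
  simp

theorem pd_zero (j : Fin d) (x : Sp d) : pd j (fun _ => (0 : ℝ)) x = 0 := by
  simp [pd]

theorem pd_coord (i j : Fin d) (x : Sp d) :
    pd j (fun x : Sp d => x i) x = if i = j then 1 else 0 := by
  have : (fun x : Sp d => x i) = (EuclideanSpace.proj i : Sp d →L[ℝ] ℝ) := by ext; simp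
  rw [pd, this, ContinuousLinearMap.fderiv]
  simp

theorem pd_comm {φ : Sp d → ℝ} (hφ : ContDiff ℝ ∞ φ) (i j : Fin d) (x : Sp d) :
    pd i (pd j φ) x = pd j (pd i φ) x := by
  have hd : Differentiable ℝ (fderiv ℝ φ) :=
    (hφ.fderiv_right (m := 1) (by norm_cast)).differentiable (by simp)
  have h : ∀ (i j : Fin d), pd i (pd j φ) x =
      fderiv ℝ (fderiv ℝ φ) x (EuclideanSpace.single i 1) (EuclideanSpace.single j 1) := by
    intro i j
    have h1 : pd j φ = fun y => fderiv ℝ φ y (EuclideanSpace.single j 1) := rfl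
    rw [h1, pd, fderiv_clm_apply (hd x) (differentiableAt_const _)]
    simp
  rw [h, h]
  have h2 : ContDiff ℝ 2 φ := by exact_mod_cast contDiff_infty.1 hφ 2
  exact (h2.contDiffAt (x := x)).isSymmSndFDerivAt (by simp) _ _

theorem integral_mul_pd {φ ψ : Sp d → ℝ} (hφ : ContDiff ℝ ∞ φ) (hψ : IsTest ψ) (j : Fin d) :
    ∫ x, φ x * pd j ψ x = - ∫ x, pd j φ x * ψ x :=
  integral_mul_fderiv_eq_neg_fderiv_mul_of_integrable
    ((IsTest.mul_left (contDiff_pd hφ j) hψ).integrable volume)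
    ((IsTest.mul_left hφ (hψ.pd j)).integrable volume)
    ((IsTest.mul_left hφ hψ).integrable volume)
    (fun x _ => (hφ.differentiable (by simp)) x) (fun x _ => hψ.differentiable x)

theorem integral_pd {ψ : Sp d → ℝ} (hψ : IsTest ψ) (j : Fin d) : ∫ x, pd j ψ x = 0 := by
  have := integral_mul_pd (φ := fun _ => 1) contDiff_const hψ j
  simpa [pd] using this

/-- The integral over `Ω` of a function supported in `Ω` is the integral over the whole space. -/
theorem setIntegral_eq_of_tsupport_subset {Ω : Set (Sp d)} {φ : Sp d → ℝ} {f : Sp d → ℝ}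
    (h : tsupport φ ⊆ Ω) (hf : ∀ x, φ x = 0 → f x = 0) : ∫ x in Ω, f x = ∫ x, f x :=
  setIntegral_eq_integral_of_forall_compl_eq_zero fun x hx =>
    hf x (image_eq_zero_of_notMem_tsupport fun hx' => hx (h hx'))

theorem pd_eq_zero_of_notMem {φ : Sp d → ℝ} {x : Sp d} (hx : x ∉ tsupport φ) (j : Fin d) :
    pd j φ x = 0 :=
  image_eq_zero_of_notMem_tsupport fun h => hx (tsupport_pd_subset φ j h)

theorem pd_congr {φ ψ : Sp d → ℝ} {x : Sp d} (h : φ =ᶠ[𝓝 x] ψ) (j : Fin d) :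
    pd j φ x = pd j ψ x := by
  rw [pd, pd, h.fderiv_eq]

/-- The divergence theorem for a field that vanishes near the boundary: cutting it off outside of
`Ω` leaves it smooth. -/
theorem setIntegral_pd_eq_zero {Ω : Set (Sp d)} (hΩ : IsOpen Ω) {θ : Sp d → ℝ} (hθ : IsTest θ)
    (hd : Disjoint (tsupport θ) (frontier Ω)) (j : Fin d) : ∫ x in Ω, pd j θ x = 0 := by
  have key : ∀ x, (Ω.indicator θ =ᶠ[𝓝 x] θ ∧ (x ∈ Ω ∨ x ∉ tsupport θ)) ∨
      (Ω.indicator θ =ᶠ[𝓝 x] (fun _ => 0) ∧ x ∉ Ω) := by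
    intro x
    by_cases hx : x ∈ Ω
    · left
      refine ⟨?_, Or.inl hx⟩
      filter_upwards [hΩ.mem_nhds hx] with y hy
      simp [hy]
    · by_cases hx' : x ∈ closure Ω
      · left
        have hxf : x ∈ frontier Ω := by
          rw [hΩ.frontier_eq]; exact ⟨hx', hx⟩
        have hxt : x ∉ tsupport θ := fun h => Set.disjoint_left.1 hd h hxf
        refine ⟨?_, Or.inr hxt⟩
        filter_upwards [(isClosed_tsupport θ).isOpen_compl.mem_nhds hxt] with y hy
        have : θ y = 0 := image_eq_zero_of_notMem_tsupport hy
        by_cases hyΩ : y ∈ Ω <;> simp [hyΩ, this]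
      · right
        refine ⟨?_, hx⟩
        filter_upwards [isClosed_closure.isOpen_compl.mem_nhds hx'] with y hy
        have : y ∉ Ω := fun h => hy (subset_closure h)
        simp [this]
  have ht : IsTest (Ω.indicator θ) := by
    refine ⟨contDiff_iff_contDiffAt.2 fun x => ?_, ?_⟩
    · rcases key x with ⟨h, -⟩ | ⟨h, -⟩
      · exact hθ.1.contDiffAt.congr_of_eventuallyEq h
      · exact contDiffAt_const.congr_of_eventuallyEq h
    · refine hθ.2.mono fun x hx => ?_
      by_contra h
      apply hx
      by_cases hx : x ∈ Ω
      · simpa [hx] using h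
      · simp [hx]
  rw [← integral_indicator hΩ.measurableSet, ← integral_pd ht j]
  congr 1
  ext x
  rcases key x with ⟨h, hx⟩ | ⟨h, hx⟩
  · rw [pd_congr h]
    rcases hx with hx | hx
    · simp [hx]
    · rw [pd_eq_zero_of_notMem hx]
      by_cases hx' : x ∈ Ω <;> simp [hx', pd_eq_zero_of_notMem hx]
  · rw [pd_congr h]
    simp [hx, pd]

/-- In every open set there is a nonnegative test function with integral one. -/
theorem exists_isTest_integral_eq_one {U : Set (Sp d)} (hU : IsOpen U) (hne : U.Nonempty) :
    ∃ χ : Sp d → ℝ, IsTest χ ∧ tsupport χ ⊆ U ∧ (∀ x, 0 ≤ χ x) ∧ ∫ x, χ x = 1 := by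
  obtain ⟨c, hc⟩ := hne
  obtain ⟨r, hr, hrU⟩ := Metric.isOpen_iff.1 hU c hc
  let b : ContDiffBump c := ⟨r / 4, r / 2, by positivity, by linarith⟩
  refine ⟨b.normed volume, ⟨b.contDiff_normed, b.hasCompactSupport_normed⟩, ?_,
    fun x => b.nonneg_normed x, b.integral_normed⟩
  rw [b.tsupport_normed_eq]
  refine (Metric.closedBall_subset_ball ?_).trans hrU
  show r / 2 < r
  linarith

/-! ### Superpositions of translates -/

/-- The superposition `∑ a(θ) η(· - X(θ))` of translates of `η`, i.e. the convolution of `η` with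
the image under `X` of the signed measure `a • m`. -/
def superpose {Θ : Type*} [MeasurableSpace Θ] (m : Measure Θ) (a : Θ → ℝ) (X : Θ → Sp d)
    {F : Type*} [NormedAddCommGroup F] [NormedSpace ℝ F] (η : Sp d → F) (x : Sp d) : F :=
  ∫ θ, a θ • η (x - X θ) ∂m

section superpose

variable {Θ : Type*} [MeasurableSpace Θ] {m : Measure Θ} {a : Θ → ℝ} {X : Θ → Sp d}

theorem integrable_superpose {F : Type*} [NormedAddCommGroup F] [NormedSpace ℝ F]
    (ha : Integrable a m) (hX : Measurable X) {η : Sp d → F} (hη : Continuous η)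
    (hc : HasCompactSupport η) (x : Sp d) : Integrable (fun θ => a θ • η (x - X θ)) m := by
  obtain ⟨C, hC⟩ := hη.bounded_above_of_compact_support hc
  have hm : StronglyMeasurable fun θ => η (x - X θ) :=
    hη.stronglyMeasurable.comp_measurable (measurable_const.sub hX)
  refine (ha.norm.mul_const C).mono' (ha.aestronglyMeasurable.smul hm.aestronglyMeasurable) ?_
  filter_upwards with θ
  rw [norm_smul]
  gcongr
  exact hC _

theorem hasFDerivAt_superpose {F : Type*} [NormedAddCommGroup F] [NormedSpace ℝ F]
    (ha : Integrable a m) (hX : Measurable X) {η : Sp d → F} (hη : ContDiff ℝ 1 η)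
    (hc : HasCompactSupport η) (x : Sp d) :
    HasFDerivAt (superpose m a X η) (superpose m a X (fderiv ℝ η) x) x := by
  have hη' : Continuous (fderiv ℝ η) := hη.continuous_fderiv one_ne_zero
  obtain ⟨C, hC⟩ := hη'.bounded_above_of_compact_support (hc.fderiv (𝕜 := ℝ))
  refine hasFDerivAt_integral_of_dominated_of_fderiv_le (s := univ)
    (bound := fun θ => ‖a θ‖ * C) (F' := fun x θ => a θ • fderiv ℝ η (x - X θ)) univ_mem
    (Eventually.of_forall fun y =>
      (integrable_superpose ha hX hη.continuous hc y).aestronglyMeasurable)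
    (integrable_superpose ha hX hη.continuous hc x)
    (integrable_superpose ha hX hη' (hc.fderiv (𝕜 := ℝ)) x).aestronglyMeasurable
    (Eventually.of_forall fun θ y _ => ?_) (ha.norm.mul_const C)
    (Eventually.of_forall fun θ y _ => ?_)
  · rw [norm_smul]
    gcongr
    exact hC _
  · have h1 : HasFDerivAt η (fderiv ℝ η (y - X θ)) (y - X θ) :=
      (hη.differentiable one_ne_zero _).hasFDerivAt
    have h2 := h1.comp y ((hasFDerivAt_id y).sub_const (X θ))
    simpa using! h2.const_smul (a θ)

theorem contDiff_superpose_nat (ha : Integrable a m) (hX : Measurable X) (n : ℕ) :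
    ∀ {F : Type} [NormedAddCommGroup F] [NormedSpace ℝ F] {η : Sp d → F}, ContDiff ℝ ∞ η →
      HasCompactSupport η → ContDiff ℝ n (superpose m a X η) := by
  induction n with
  | zero =>
    intro F _ _ η hη hc
    have h1 : ContDiff ℝ 1 η := by exact_mod_cast contDiff_infty.1 hη 1
    refine contDiff_zero.2 (continuous_iff_continuousAt.2 fun x => ?_)
    exact (hasFDerivAt_superpose ha hX h1 hc x).continuousAt
  | succ n ih =>
    intro F _ _ η hη hc
    have h1 : ContDiff ℝ 1 η := by exact_mod_cast contDiff_infty.1 hη 1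
    push_cast
    refine contDiff_succ_iff_fderiv.2 ⟨fun x =>
      (hasFDerivAt_superpose ha hX h1 hc x).differentiableAt, by simp, ?_⟩
    have : fderiv ℝ (superpose m a X η) = superpose m a X (fderiv ℝ η) :=
      funext fun x => (hasFDerivAt_superpose ha hX h1 hc x).fderiv
    rw [this]
    exact ih (hη.fderiv_right (by simp)) (hc.fderiv (𝕜 := ℝ))

theorem contDiff_superpose (ha : Integrable a m) (hX : Measurable X) {η : Sp d → ℝ}
    (hη : IsTest η) : ContDiff ℝ ∞ (superpose m a X η) :=
  contDiff_infty.2 fun n => contDiff_superpose_nat ha hX n hη.1 hη.2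

theorem pd_superpose (ha : Integrable a m) (hX : Measurable X) {η : Sp d → ℝ}
    (hη : IsTest η) (j : Fin d) (x : Sp d) :
    pd j (superpose m a X η) x = superpose m a X (pd j η) x := by
  have h1 : ContDiff ℝ 1 η := by exact_mod_cast contDiff_infty.1 hη.1 1
  rw [pd, (hasFDerivAt_superpose ha hX h1 hη.2 x).fderiv, superpose,
    ContinuousLinearMap.integral_apply]
  · simp [superpose, pd]
  · exact integrable_superpose ha hX (h1.continuous_fderiv one_ne_zero) (hη.2.fderiv (𝕜 := ℝ)) x

theorem support_superpose_subset {K : Set (Sp d)} (hK : ∀ θ, a θ ≠ 0 → X θ ∈ K) {η : Sp d → ℝ}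
    {ε : ℝ} (hη : tsupport η ⊆ Metric.closedBall 0 ε) :
    Function.support (superpose m a X η) ⊆ Metric.cthickening ε K := by
  intro x hx
  by_contra hcon
  apply hx
  refine integral_eq_zero_of_ae (Eventually.of_forall fun θ => ?_)
  by_cases haθ : a θ = 0
  · simp [haθ]
  · have : x - X θ ∉ tsupport η := by
      intro h
      have h2 := hη h
      rw [mem_closedBall_zero_iff, ← dist_eq_norm] at h2
      exact hcon (Metric.mem_cthickening_of_dist_le x (X θ) ε K (hK θ haθ) h2)
    simp [image_eq_zero_of_notMem_tsupport this]

theorem isTest_superpose (ha : Integrable a m) (hX : Measurable X) {K : Set (Sp d)}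
    (hKc : IsCompact K) (hK : ∀ θ, a θ ≠ 0 → X θ ∈ K) {η : Sp d → ℝ} (hη : IsTest η) {ε : ℝ}
    (hηε : tsupport η ⊆ Metric.closedBall 0 ε) :
    IsTest (superpose m a X η) ∧ tsupport (superpose m a X η) ⊆ Metric.cthickening ε K := by
  have h := support_superpose_subset (m := m) hK hηε
  refine ⟨⟨contDiff_superpose ha hX hη, ?_⟩, closure_minimal h Metric.isClosed_cthickening⟩
  exact HasCompactSupport.of_support_subset_isCompact hKc.cthickening h

end superpose

/-! ### Fourier transform of test functions -/

open FourierTransform Complex in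
/-- The Fourier transform of a real function. -/
def ft (f : Sp d → ℝ) (ξ : Sp d) : ℂ := 𝓕 (fun x => (f x : ℂ)) ξ

theorem IsTest.hasCompactSupport_ofReal {f : Sp d → ℝ} (hf : IsTest f) :
    HasCompactSupport (fun x => (f x : ℂ)) := hf.2.comp_left (g := fun t : ℝ => (t : ℂ)) (by simp)

theorem IsTest.contDiff_ofReal {f : Sp d → ℝ} (hf : IsTest f) :
    ContDiff ℝ ∞ (fun x => (f x : ℂ)) := Complex.ofRealCLM.contDiff.comp hf.1

/-- A test function as a complex-valued Schwartz function. -/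
def IsTest.schwartz {f : Sp d → ℝ} (hf : IsTest f) : SchwartzMap (Sp d) ℂ :=
  hf.hasCompactSupport_ofReal.toSchwartzMap hf.contDiff_ofReal

open FourierTransform in
theorem ft_eq_schwartz {f : Sp d → ℝ} (hf : IsTest f) (ξ : Sp d) :
    ft f ξ = 𝓕 hf.schwartz ξ := by
  rw [SchwartzMap.fourier_coe]; rfl

theorem continuous_ft {f : Sp d → ℝ} (hf : IsTest f) : Continuous (ft f) := by
  have : ft f = fun ξ => FourierTransform.fourier hf.schwartz ξ := funext (ft_eq_schwartz hf)
  rw [this]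
  exact SchwartzMap.continuous _

theorem integral_norm_ft_sq {f : Sp d → ℝ} (hf : IsTest f) :
    ∫ ξ, ‖ft f ξ‖ ^ 2 = ∫ x, f x ^ 2 := by
  have h := SchwartzMap.integral_norm_sq_fourier hf.schwartz
  simp_rw [← ft_eq_schwartz hf] at h
  rw [h]
  refine integral_congr_ae (Eventually.of_forall fun x => ?_)
  show ‖((f x : ℝ) : ℂ)‖ ^ 2 = f x ^ 2
  simp

theorem lintegral_norm_ft_sq {f : Sp d → ℝ} (hf : IsTest f) :
    ∫⁻ ξ, ‖ft f ξ‖ₑ ^ 2 = ENNReal.ofReal (∫ x, f x ^ 2) := by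
  have hi : Integrable (fun ξ => ‖ft f ξ‖ ^ 2) := by
    have := (SchwartzMap.memLp (FourierTransform.fourier hf.schwartz) 2 volume).integrable_norm_pow
      (by simp)
    simpa [← ft_eq_schwartz hf] using this
  rw [← integral_norm_ft_sq hf, ofReal_integral_eq_lintegral_ofReal hi
    (Eventually.of_forall fun _ => by positivity)]
  refine lintegral_congr fun ξ => ?_
  rw [ENNReal.ofReal_pow (norm_nonneg _), ofReal_norm]

theorem ft_pd {f : Sp d → ℝ} (hf : IsTest f) (j : Fin d) (ξ : Sp d) :
    ft (pd j f) ξ = (2 * Real.pi * Complex.I) * (ξ j * ft f ξ) := by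
  have h := SchwartzMap.fourier_lineDerivOp_eq hf.schwartz (EuclideanSpace.single j (1 : ℝ))
  have h1 : LineDeriv.lineDerivOp (EuclideanSpace.single j (1 : ℝ)) hf.schwartz
      = (hf.pd j).schwartz := by
    ext x
    rw [SchwartzMap.lineDerivOp_apply_eq_fderiv]
    have h2 : HasFDerivAt (fun x => (f x : ℂ)) (Complex.ofRealCLM ∘L fderiv ℝ f x) x :=
      Complex.ofRealCLM.hasFDerivAt.comp x (hf.differentiable x).hasFDerivAt
    have h3 : (⇑hf.schwartz) = fun x => (f x : ℂ) := rfl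
    rw [h3, h2.fderiv]
    rfl
  rw [h1] at h
  rw [ft_eq_schwartz (hf.pd j), h, ft_eq_schwartz hf]
  have : (fun x : Sp d => inner ℝ x (EuclideanSpace.single j (1:ℝ))).HasTemperateGrowth := by
    fun_prop
  simp [this]
  left
  simp [EuclideanSpace.inner_single_right]

theorem norm_ft_le {f : Sp d → ℝ} (ξ : Sp d) : ‖ft f ξ‖ ≤ ∫ x, ‖f x‖ := by
  rw [ft, Real.fourier_eq]
  refine (norm_integral_le_integral_norm _).trans (le_of_eq ?_)
  simp [Circle.norm_smul]

theorem exists_ft_decay {f : Sp d → ℝ} (hf : IsTest f) (N : ℕ) :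
    ∃ C, 0 ≤ C ∧ ∀ ξ, ‖ft f ξ‖ ≤ C / (1 + ‖ξ‖) ^ N := by
  refine ⟨2 ^ N * ((Finset.Iic (N, 0)).sup fun m => SchwartzMap.seminorm ℝ m.1 m.2)
    (FourierTransform.fourier hf.schwartz), by positivity, fun ξ => ?_⟩
  have := SchwartzMap.one_add_le_sup_seminorm_apply (𝕜 := ℝ) (m := (N, 0)) le_rfl le_rfl
    (FourierTransform.fourier hf.schwartz) ξ
  rw [norm_iteratedFDeriv_zero, ← ft_eq_schwartz hf] at this
  rw [le_div_iff₀ (by positivity), mul_comm]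
  exact this

theorem ft_superpose {Θ : Type*} [MeasurableSpace Θ] {m : Measure Θ} [SFinite m] {a : Θ → ℝ}
    {X : Θ → Sp d} (ha : Integrable a m) (hX : Measurable X) {η : Sp d → ℝ} (hη : IsTest η)
    (ξ : Sp d) :
    ft (superpose m a X η) ξ =
      (∫ θ, (Real.fourierChar (-⟪X θ, ξ⟫) : ℂ) * a θ ∂m) * ft η ξ := by
  have hmeas : AEStronglyMeasurable
      (Function.uncurry fun (x : Sp d) (θ : Θ) =>
        Real.fourierChar (-⟪x, ξ⟫) • ((a θ * η (x - X θ) : ℝ) : ℂ)) (volume.prod m) := by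
    have h1 : AEStronglyMeasurable (fun p : Sp d × Θ => a p.2) (volume.prod m) :=
      ha.aestronglyMeasurable.comp_snd
    have h2 : StronglyMeasurable (fun p : Sp d × Θ => η (p.1 - X p.2)) :=
      hη.continuous.stronglyMeasurable.comp_measurable
        (measurable_fst.sub (hX.comp measurable_snd))
    have h3 : Continuous fun x : Sp d => (Real.fourierChar (-⟪x, ξ⟫) : ℂ) := by fun_prop
    have h4 : AEStronglyMeasurable (fun p : Sp d × Θ => (Real.fourierChar (-⟪p.1, ξ⟫) : ℂ))
        (volume.prod m) := (h3.measurable.comp measurable_fst).aestronglyMeasurable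
    exact h4.mul (Complex.continuous_ofReal.comp_aestronglyMeasurable
      (h1.mul h2.aestronglyMeasurable))
  have hint : Integrable (Function.uncurry fun (x : Sp d) (θ : Θ) =>
      Real.fourierChar (-⟪x, ξ⟫) • ((a θ * η (x - X θ) : ℝ) : ℂ)) (volume.prod m) := by
    rw [integrable_prod_iff' hmeas]
    constructor
    · refine Eventually.of_forall fun θ => ?_
      have h0 : Integrable (fun x : Sp d => (η (x - X θ))) :=
        (hη.integrable volume).comp_sub_right (X θ)
      have := (h0.const_mul (a θ)).ofReal (𝕜 := ℂ)
      simpa using (Real.fourierIntegral_convergent_iff ξ).2 this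
    · have : (fun θ => ∫ x : Sp d, ‖Function.uncurry (fun (x : Sp d) (θ : Θ) =>
          Real.fourierChar (-⟪x, ξ⟫) • ((a θ * η (x - X θ) : ℝ) : ℂ)) (x, θ)‖)
          = fun θ => ‖a θ‖ * ∫ x, ‖η x‖ := by
        ext θ
        simp only [Function.uncurry, Circle.norm_smul, Complex.norm_real, norm_mul]
        rw [integral_const_mul, integral_sub_right_eq_self (fun x => ‖η x‖)]
      rw [this]
      exact ha.norm.mul_const _
  rw [ft, Real.fourier_eq]
  have h1 : ∀ x, Real.fourierChar (-⟪x, ξ⟫) • ((superpose m a X η x : ℝ) : ℂ) =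
      ∫ θ, Real.fourierChar (-⟪x, ξ⟫) • ((a θ * η (x - X θ) : ℝ) : ℂ) ∂m := by
    intro x
    simp only [Circle.smul_def, smul_eq_mul]
    rw [integral_const_mul]
    exact congrArg _ (integral_ofReal (𝕜 := ℂ) (f := fun θ => a θ * η (x - X θ))).symm
  simp_rw [h1]
  rw [integral_integral_swap hint, ← integral_mul_const]
  refine integral_congr_ae (Eventually.of_forall fun θ => ?_)
  simp only
  rw [ft, Real.fourier_eq, ← integral_sub_right_eq_self
    (fun x => Real.fourierChar (-⟪x, ξ⟫) • (η x : ℂ)) (X θ), ← integral_const_mul]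
  refine integral_congr_ae (Eventually.of_forall fun x => ?_)
  simp only [Circle.smul_def, smul_eq_mul]
  have : -⟪x, ξ⟫ = -⟪X θ, ξ⟫ + -⟪x - X θ, ξ⟫ := by
    rw [inner_sub_left]; ring
  rw [this, AddChar.map_add_eq_mul]
  push_cast
  ring

/-! ### The weighted Fourier estimate -/

theorem sq_lintegral_mul_le {α : Type*} [MeasurableSpace α] (μ : Measure α) {f g : α → ENNReal}
    (hf : AEMeasurable f μ) (hg : AEMeasurable g μ) :
    (∫⁻ a, f a * g a ∂μ) ^ 2 ≤ (∫⁻ a, f a ^ 2 ∂μ) * ∫⁻ a, g a ^ 2 ∂μ := by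
  have h := ENNReal.lintegral_mul_le_Lp_mul_Lq μ Real.HolderConjugate.two_two hf hg
  have h2 : ∀ t : ENNReal, (t ^ (1 / (2 : ℝ))) ^ 2 = t := by
    intro t
    rw [← ENNReal.rpow_natCast, ← ENNReal.rpow_mul]
    norm_num
  calc (∫⁻ a, f a * g a ∂μ) ^ 2 ≤ _ := pow_le_pow_left₀ (zero_le) h 2
    _ = _ := by
      rw [mul_pow, h2, h2]
      simp only [ENNReal.rpow_two]

theorem lintegral_comp_smul_le {c : ℝ} (hc : 1 / 2 ≤ c) {G : Sp d → ENNReal}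
    (hG : Measurable G) : ∫⁻ ξ, G (c • ξ) ≤ 2 ^ d * ∫⁻ ξ, G ξ := by
  have hc0 : c ≠ 0 := by positivity
  rw [← lintegral_map (μ := volume) (g := fun ξ : Sp d => c • ξ) hG (by fun_prop),
    Measure.map_addHaar_smul volume hc0, lintegral_smul_measure, smul_eq_mul]
  gcongr
  rw [finrank_euclideanSpace_fin]
  have : ((2 : ENNReal)) ^ d = ENNReal.ofReal (2 ^ d) := by
    rw [ENNReal.ofReal_pow (by norm_num)]; simp
  rw [this]
  refine ENNReal.ofReal_le_ofReal ?_
  rw [abs_of_pos (by positivity), ← inv_pow]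
  gcongr
  rw [inv_le_comm₀ (by positivity) (by norm_num)]
  linarith

theorem integral_weight_le {r : ℝ} (hr : 0 ≤ r) :
    ENNReal.ofReal r * ∫⁻ s in Icc (0 : ℝ) (1 / 2), ENNReal.ofReal (1 / (1 + s * r)) ^ 2 ≤ 1 := by
  have hcont : ContinuousOn (fun s : ℝ => r * (1 / (1 + s * r)) ^ 2) (Icc 0 (1 / 2)) := by
    refine continuousOn_const.mul (ContinuousOn.pow (continuousOn_const.div (by fun_prop) ?_) 2)
    intro s hs
    have := mul_nonneg hs.1 hr
    positivity
  rw [← lintegral_const_mul' _ _ (by simp)]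
  have h1 : ∫⁻ s in Icc (0 : ℝ) (1 / 2),
      ENNReal.ofReal r * ENNReal.ofReal (1 / (1 + s * r)) ^ 2 =
      ∫⁻ s in Icc (0 : ℝ) (1 / 2), ENNReal.ofReal (r * (1 / (1 + s * r)) ^ 2) := by
    refine setLIntegral_congr_fun measurableSet_Icc fun s hs => ?_
    have := mul_nonneg hs.1 hr
    rw [ENNReal.ofReal_mul hr, ENNReal.ofReal_pow (by positivity)]
  rw [h1, ← ofReal_integral_eq_lintegral_ofReal hcont.integrableOn_Icc
    (Eventually.of_forall fun s => by positivity), ENNReal.ofReal_le_one,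
    integral_Icc_eq_integral_Ioc, ← intervalIntegral.integral_of_le (by norm_num)]
  have h2 : ∀ s ∈ uIcc (0 : ℝ) (1 / 2),
      HasDerivAt (fun s : ℝ => -(1 + s * r)⁻¹) (r * (1 / (1 + s * r)) ^ 2) s := by
    intro s hs
    rw [uIcc_of_le (by norm_num)] at hs
    have h0 := mul_nonneg hs.1 hr
    have hne : 1 + s * r ≠ 0 := by positivity
    have := ((((hasDerivAt_id s).mul_const r).const_add 1).inv hne).neg
    refine this.congr_deriv ?_
    simp only [id]
    field_simp
  rw [intervalIntegral.integral_eq_sub_of_hasDerivAt h2]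
  · have : 0 ≤ (1 + 1 / 2 * r)⁻¹ := by positivity
    simp only [zero_mul, add_zero, inv_one]
    linarith
  · rw [← uIcc_of_le (by norm_num : (0:ℝ) ≤ 1/2)] at hcont
    exact hcont.intervalIntegrable

/-- The weight `1 / (1 + s |ξ|)`. -/
def decayWeight (s : ℝ) (ξ : Sp d) : ENNReal := ENNReal.ofReal (1 / (1 + s * ‖ξ‖))

theorem measurable_decayWeight : Measurable (Function.uncurry (decayWeight (d := d))) := by
  unfold Function.uncurry decayWeight
  fun_prop

theorem measurable_decayWeight_right (ξ : Sp d) : Measurable fun s => decayWeight s ξ := by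
  unfold decayWeight
  fun_prop

theorem enorm_mul_lintegral_decayWeight_le (ξ : Sp d) :
    ‖ξ‖ₑ * ∫⁻ s in Icc (0 : ℝ) (1 / 2), decayWeight s ξ ^ 2 ≤ 1 := by
  have hw := integral_weight_le (norm_nonneg ξ)
  rw [ofReal_norm] at hw
  exact hw

theorem enorm_mul_decayWeight_le {s : ℝ} (hs : s ∈ Icc (0 : ℝ) (1 / 2)) (ξ : Sp d) (h : ENNReal) :
    ‖ξ‖ₑ * (h * decayWeight s ξ) ^ 2 ≤
      2 * (‖(1 - s) • ξ‖ₑ * decayWeight s ((1 - s) • ξ) ^ 2 * h ^ 2) := by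
  have hs2 : (1 : ℝ) / 2 ≤ 1 - s := by linarith [hs.2]
  have e1 : ‖ξ‖ₑ ≤ 2 * ‖(1 - s) • ξ‖ₑ := by
    have h2 : ENNReal.ofReal (2 * ((1 - s) * ‖ξ‖)) = 2 * ENNReal.ofReal ((1 - s) * ‖ξ‖) := by
      rw [ENNReal.ofReal_mul (by norm_num), ENNReal.ofReal_ofNat]
    rw [← ofReal_norm, ← ofReal_norm, norm_smul, Real.norm_of_nonneg (by linarith), ← h2]
    refine ENNReal.ofReal_le_ofReal ?_
    nlinarith [norm_nonneg ξ]
  have e2 : decayWeight s ξ ≤ decayWeight s ((1 - s) • ξ) := by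
    refine ENNReal.ofReal_le_ofReal ?_
    have h0 : 0 ≤ s * ‖(1 - s) • ξ‖ := mul_nonneg hs.1 (norm_nonneg _)
    refine one_div_le_one_div_of_le (by positivity) ?_
    have : ‖(1 - s) • ξ‖ ≤ ‖ξ‖ := by
      rw [norm_smul, Real.norm_of_nonneg (by linarith)]
      nlinarith [norm_nonneg ξ, hs.1]
    gcongr
    exact hs.1
  calc ‖ξ‖ₑ * (h * decayWeight s ξ) ^ 2
      ≤ (2 * ‖(1 - s) • ξ‖ₑ) * (h * decayWeight s ((1 - s) • ξ)) ^ 2 := by gcongr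
    _ = _ := by ring

theorem sq_lintegral_decayWeight_le {H : Sp d → ENNReal} (hH : Measurable H) (ξ : Sp d) :
    (‖ξ‖ₑ * ∫⁻ s in Icc (0 : ℝ) (1 / 2), H ((1 - s) • ξ) * decayWeight s ξ ^ 2) ^ 2 ≤
      ∫⁻ s in Icc (0 : ℝ) (1 / 2),
        2 * (‖(1 - s) • ξ‖ₑ * decayWeight s ((1 - s) • ξ) ^ 2 * H ((1 - s) • ξ) ^ 2) := by
  have hHs : Measurable fun s : ℝ => H ((1 - s) • ξ) := hH.comp (by fun_prop)
  have hcs := sq_lintegral_mul_le (volume.restrict (Icc (0 : ℝ) (1 / 2)))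
    (f := fun s => H ((1 - s) • ξ) * decayWeight s ξ) (g := fun s => decayWeight s ξ)
    (hHs.mul (measurable_decayWeight_right ξ)).aemeasurable
    (measurable_decayWeight_right ξ).aemeasurable
  calc (‖ξ‖ₑ * ∫⁻ s in Icc (0 : ℝ) (1 / 2), H ((1 - s) • ξ) * decayWeight s ξ ^ 2) ^ 2
      = ‖ξ‖ₑ * ‖ξ‖ₑ * (∫⁻ s in Icc (0 : ℝ) (1 / 2),
          H ((1 - s) • ξ) * decayWeight s ξ * decayWeight s ξ) ^ 2 := by
        rw [mul_pow, sq ‖ξ‖ₑ]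
        simp_rw [sq (decayWeight _ _), mul_assoc]
    _ ≤ ‖ξ‖ₑ * ‖ξ‖ₑ * ((∫⁻ s in Icc (0 : ℝ) (1 / 2), (H ((1 - s) • ξ) * decayWeight s ξ) ^ 2) *
        ∫⁻ s in Icc (0 : ℝ) (1 / 2), decayWeight s ξ ^ 2) := mul_le_mul_right hcs _
    _ = (‖ξ‖ₑ * ∫⁻ s in Icc (0 : ℝ) (1 / 2), (H ((1 - s) • ξ) * decayWeight s ξ) ^ 2) *
        (‖ξ‖ₑ * ∫⁻ s in Icc (0 : ℝ) (1 / 2), decayWeight s ξ ^ 2) := by ring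
    _ ≤ (‖ξ‖ₑ * ∫⁻ s in Icc (0 : ℝ) (1 / 2), (H ((1 - s) • ξ) * decayWeight s ξ) ^ 2) * 1 :=
        mul_le_mul_right (enorm_mul_lintegral_decayWeight_le ξ) _
    _ = ∫⁻ s in Icc (0 : ℝ) (1 / 2), ‖ξ‖ₑ * (H ((1 - s) • ξ) * decayWeight s ξ) ^ 2 := by
        rw [mul_one, lintegral_const_mul' _ _ (by simp)]
    _ ≤ _ := setLIntegral_mono' measurableSet_Icc fun s hs => enorm_mul_decayWeight_le hs ξ _

/-- The part of the weighted estimate near the singular end `s = 0`: by the Cauchy-Schwarz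
inequality with the weight `|ξ| / (1 + s |ξ|)²`, whose integral in `s` is at most one. -/
theorem lintegral_low_le {H : Sp d → ENNReal} (hH : Measurable H) :
    ∫⁻ ξ, (‖ξ‖ₑ * ∫⁻ s in Icc (0 : ℝ) (1 / 2), H ((1 - s) • ξ) * decayWeight s ξ ^ 2) ^ 2 ≤
      2 ^ (d + 1) * ∫⁻ ξ, H ξ ^ 2 := by
  have hjoint : ∀ F : ℝ → Sp d → ENNReal, Measurable (Function.uncurry F) →
      AEMeasurable (Function.uncurry fun (ξ : Sp d) (s : ℝ) => F s ξ)
        ((volume : Measure (Sp d)).prod (volume.restrict (Icc (0 : ℝ) (1 / 2)))) := by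
    intro F hF
    exact (hF.comp measurable_swap).aemeasurable
  set W : ℝ → Sp d → ENNReal := fun s ξ => ‖ξ‖ₑ * decayWeight s ξ ^ 2 * H ξ ^ 2 with hW
  have hGm : Measurable (Function.uncurry W) :=
    ((measurable_snd.enorm).mul (measurable_decayWeight.pow_const 2)).mul
      ((hH.comp measurable_snd).pow_const 2)
  have hGm2 : Measurable (Function.uncurry fun (s : ℝ) (ξ : Sp d) => 2 * W s ((1 - s) • ξ)) := by
    have : Measurable fun p : ℝ × Sp d => (p.1, (1 - p.1) • p.2) := by fun_prop
    exact (hGm.comp this).const_mul 2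
  have hWm : ∀ s, Measurable (W s) := fun s => hGm.of_uncurry_left
  have h2 : (2 : ENNReal) ^ (d + 1) ≠ ⊤ := ENNReal.pow_ne_top (by simp)
  calc _ ≤ ∫⁻ ξ, ∫⁻ s in Icc (0 : ℝ) (1 / 2), 2 * W s ((1 - s) • ξ) :=
        lintegral_mono (sq_lintegral_decayWeight_le hH)
    _ = ∫⁻ s in Icc (0 : ℝ) (1 / 2), ∫⁻ ξ, 2 * W s ((1 - s) • ξ) :=
        lintegral_lintegral_swap (hjoint _ hGm2)
    _ ≤ ∫⁻ s in Icc (0 : ℝ) (1 / 2), 2 ^ (d + 1) * ∫⁻ ξ, W s ξ := by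
        refine setLIntegral_mono' measurableSet_Icc fun s hs => ?_
        have := lintegral_comp_smul_le (c := 1 - s) (by linarith [hs.2]) (hWm s)
        rw [lintegral_const_mul' _ _ (by simp), pow_succ', mul_assoc]
        exact mul_le_mul_right this _
    _ = 2 ^ (d + 1) * ∫⁻ s in Icc (0 : ℝ) (1 / 2), ∫⁻ ξ, W s ξ :=
        lintegral_const_mul' _ _ h2
    _ = 2 ^ (d + 1) * ∫⁻ ξ, ∫⁻ s in Icc (0 : ℝ) (1 / 2), W s ξ := by
        rw [lintegral_lintegral_swap (hjoint _ hGm)]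
    _ ≤ _ := by
        refine mul_le_mul_right (lintegral_mono fun ξ => ?_) _
        simp only [hW]
        rw [lintegral_mul_const _ (((measurable_decayWeight_right ξ).pow_const 2).const_mul _),
          lintegral_const_mul' _ _ (by simp)]
        calc _ ≤ 1 * H ξ ^ 2 := mul_le_mul_left (enorm_mul_lintegral_decayWeight_le ξ) _
          _ = _ := one_mul _

/-- The part of the weighted estimate away from `s = 0`, where the decay of the Fourier transform
of a fixed function makes up for the factor `|ξ|`. -/
theorem lintegral_high_le (C : ℝ) (hC : 0 ≤ C) : ∃ C' : ENNReal, C' ≠ ⊤ ∧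
    ∀ (H P : Sp d → ENNReal) (L : ENNReal),
      (∀ ξ, P ξ ≤ ENNReal.ofReal (C / (1 + ‖ξ‖) ^ (d + 2))) → (∀ ξ, H ξ ≤ L) →
      ∫⁻ ξ, (‖ξ‖ₑ * ∫⁻ s in Icc (1 / 2 : ℝ) 1, H ((1 - s) • ξ) * P (s • ξ)) ^ 2 ≤ C' * L ^ 2 := by
  refine ⟨ENNReal.ofReal (2 ^ (d + 2) * C) ^ 2 *
    ∫⁻ ξ : Sp d, ENNReal.ofReal ((1 + ‖ξ‖) ^ (-((d + 1 : ℕ) : ℝ))), ?_, ?_⟩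
  · refine ENNReal.mul_ne_top (ENNReal.pow_ne_top ENNReal.ofReal_ne_top)
      (finite_integral_one_add_norm ?_).ne
    rw [finrank_euclideanSpace_fin]
    push_cast; linarith
  intro H P L hP hH
  rw [mul_assoc, mul_comm _ (L ^ 2), ← mul_assoc, ← lintegral_const_mul _ (by fun_prop)]
  refine lintegral_mono fun ξ => ?_
  have h1 : ∀ s ∈ Icc (1 / 2 : ℝ) 1, H ((1 - s) • ξ) * P (s • ξ) ≤
      L * ENNReal.ofReal (2 ^ (d + 2) * C / (1 + ‖ξ‖) ^ (d + 2)) := by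
    intro s hs
    refine mul_le_mul' (hH _) ((hP _).trans (ENNReal.ofReal_le_ofReal ?_))
    have h2 : (1 + ‖ξ‖) / 2 ≤ 1 + ‖s • ξ‖ := by
      rw [norm_smul, Real.norm_of_nonneg (by linarith [hs.1])]
      nlinarith [norm_nonneg ξ, hs.1]
    calc C / (1 + ‖s • ξ‖) ^ (d + 2) ≤ C / ((1 + ‖ξ‖) / 2) ^ (d + 2) := by gcongr
      _ = _ := by
        rw [div_pow]; field_simp
  have h2 : ‖ξ‖ₑ * ∫⁻ s in Icc (1 / 2 : ℝ) 1, H ((1 - s) • ξ) * P (s • ξ) ≤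
      L * (ENNReal.ofReal (2 ^ (d + 2) * C) * ENNReal.ofReal (1 / (1 + ‖ξ‖) ^ (d + 1))) := by
    calc _ ≤ ‖ξ‖ₑ * ∫⁻ s in Icc (1 / 2 : ℝ) 1,
          L * ENNReal.ofReal (2 ^ (d + 2) * C / (1 + ‖ξ‖) ^ (d + 2)) := by
          gcongr ‖ξ‖ₑ * ?_
          exact setLIntegral_mono' measurableSet_Icc h1
      _ ≤ ‖ξ‖ₑ * (L * ENNReal.ofReal (2 ^ (d + 2) * C / (1 + ‖ξ‖) ^ (d + 2))) := by
          gcongr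
          rw [setLIntegral_const, Real.volume_Icc]
          calc _ ≤ L * ENNReal.ofReal (2 ^ (d + 2) * C / (1 + ‖ξ‖) ^ (d + 2)) * 1 := by
                gcongr
                rw [ENNReal.ofReal_le_one]; norm_num
            _ = _ := mul_one _
      _ = L * (‖ξ‖ₑ * ENNReal.ofReal (2 ^ (d + 2) * C / (1 + ‖ξ‖) ^ (d + 2))) := by ring
      _ ≤ _ := by
          gcongr L * ?_
          rw [← ofReal_norm, ← ENNReal.ofReal_mul (norm_nonneg _),
            ← ENNReal.ofReal_mul (by positivity)]
          refine ENNReal.ofReal_le_ofReal ?_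
          rw [pow_succ (1 + ‖ξ‖) (d + 1)]
          have h0 := norm_nonneg ξ
          rw [mul_one_div, mul_div_assoc', div_le_div_iff₀ (by positivity) (by positivity)]
          have : 0 ≤ 2 ^ (d + 2) * C * (1 + ‖ξ‖) ^ (d + 1) := by positivity
          nlinarith
  calc _ ≤ (L * (ENNReal.ofReal (2 ^ (d + 2) * C) *
        ENNReal.ofReal (1 / (1 + ‖ξ‖) ^ (d + 1)))) ^ 2 := by gcongr
    _ = ENNReal.ofReal (2 ^ (d + 2) * C) ^ 2 * L ^ 2 *
        ENNReal.ofReal (1 / (1 + ‖ξ‖) ^ (d + 1)) ^ 2 := by ring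
    _ ≤ _ := by
        gcongr
        rw [← ENNReal.ofReal_pow (by positivity)]
        refine ENNReal.ofReal_le_ofReal ?_
        rw [Real.rpow_neg (by positivity), Real.rpow_natCast, ← one_div]
        have h3 : 1 / (1 + ‖ξ‖) ^ (d + 1) ≤ 1 := by
          rw [div_le_one (by positivity)]
          exact one_le_pow₀ (by linarith [norm_nonneg ξ])
        have h4 : 0 ≤ 1 / (1 + ‖ξ‖) ^ (d + 1) := by positivity
        nlinarith

/-- The estimate behind the gradient bound of the Bogovskii operator: `H` stands for the modulus of
the Fourier transform of a function, `L` for a bound by its `L¹` norm. -/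
theorem exists_lintegral_ft_le {φ : Sp d → ℝ} (hφ : IsTest φ) : ∃ C : ENNReal, C ≠ ⊤ ∧
    ∀ (H : Sp d → ENNReal) (L : ENNReal), Measurable H → (∀ ξ, H ξ ≤ L) →
      ∫⁻ ξ, (‖ξ‖ₑ * ∫⁻ s in Icc (0 : ℝ) 1, H ((1 - s) • ξ) * ‖ft φ (s • ξ)‖ₑ) ^ 2 ≤
        C * (∫⁻ ξ, H ξ ^ 2) + C * L ^ 2 := by
  obtain ⟨A, hA, hφA⟩ := exists_ft_decay hφ (d + 2)
  obtain ⟨C', hC', hhigh⟩ := lintegral_high_le (d := d) A hA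
  have hφm : Measurable fun ξ => ‖ft φ ξ‖ₑ := (continuous_ft hφ).measurable.enorm
  have hP : ∀ ξ, ‖ft φ ξ‖ₑ ≤ ENNReal.ofReal (A / (1 + ‖ξ‖) ^ (d + 2)) := fun ξ => by
    rw [← ofReal_norm]; exact ENNReal.ofReal_le_ofReal (hφA ξ)
  refine ⟨2 * (ENNReal.ofReal A ^ 2 * 2 ^ (d + 1)) + 2 * C', ?_, fun H L hH hL => ?_⟩
  · exact ENNReal.add_ne_top.2 ⟨ENNReal.mul_ne_top (by simp)
      (ENNReal.mul_ne_top (by simp) (by simp)),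
      ENNReal.mul_ne_top (by simp) hC'⟩
  have hsplit : ∀ ξ : Sp d,
      (‖ξ‖ₑ * ∫⁻ s in Icc (0 : ℝ) 1, H ((1 - s) • ξ) * ‖ft φ (s • ξ)‖ₑ) ^ 2 ≤
      2 * (ENNReal.ofReal A ^ 2 * (‖ξ‖ₑ * ∫⁻ s in Icc (0 : ℝ) (1 / 2), H ((1 - s) • ξ) *
        decayWeight s ξ ^ 2) ^ 2) +
      2 * (‖ξ‖ₑ * ∫⁻ s in Icc (1 / 2 : ℝ) 1, H ((1 - s) • ξ) * ‖ft φ (s • ξ)‖ₑ) ^ 2 := by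
    intro ξ
    have h1 : ∫⁻ s in Icc (0 : ℝ) 1, H ((1 - s) • ξ) * ‖ft φ (s • ξ)‖ₑ ≤
        (∫⁻ s in Icc (0 : ℝ) (1 / 2), H ((1 - s) • ξ) * ‖ft φ (s • ξ)‖ₑ) +
        ∫⁻ s in Icc (1 / 2 : ℝ) 1, H ((1 - s) • ξ) * ‖ft φ (s • ξ)‖ₑ := by
      rw [← Icc_union_Icc_eq_Icc (b := (1 / 2 : ℝ)) (by norm_num) (by norm_num)]
      exact lintegral_union_le _ _ _
    have h2 : ∫⁻ s in Icc (0 : ℝ) (1 / 2), H ((1 - s) • ξ) * ‖ft φ (s • ξ)‖ₑ ≤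
        ENNReal.ofReal A * ∫⁻ s in Icc (0 : ℝ) (1 / 2), H ((1 - s) • ξ) *
          decayWeight s ξ ^ 2 := by
      rw [← lintegral_const_mul' _ _ (by simp)]
      refine setLIntegral_mono' measurableSet_Icc fun s hs => ?_
      rw [mul_left_comm]
      gcongr
      refine (hP _).trans ?_
      have h0 := mul_nonneg hs.1 (norm_nonneg ξ)
      rw [decayWeight, ← ENNReal.ofReal_pow (by positivity), ← ENNReal.ofReal_mul hA]
      refine ENNReal.ofReal_le_ofReal ?_
      rw [norm_smul, Real.norm_of_nonneg hs.1, one_div, inv_pow, ← div_eq_mul_inv]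
      gcongr
      · linarith
      · omega
    have hyoung : ∀ a b : ENNReal, (a + b) ^ 2 ≤ 2 * a ^ 2 + 2 * b ^ 2 := by
      intro a b
      have h := ENNReal.rpow_add_le_mul_rpow_add_rpow a b (p := 2) (by norm_num)
      rw [show (2 : ℝ) - 1 = 1 by norm_num, ENNReal.rpow_one] at h
      simpa only [ENNReal.rpow_two, mul_add] using h
    calc _ ≤ (‖ξ‖ₑ * ((ENNReal.ofReal A * ∫⁻ s in Icc (0 : ℝ) (1 / 2), H ((1 - s) • ξ) *
          decayWeight s ξ ^ 2) +
          ∫⁻ s in Icc (1 / 2 : ℝ) 1, H ((1 - s) • ξ) * ‖ft φ (s • ξ)‖ₑ)) ^ 2 := by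
          gcongr
          exact h1.trans (by gcongr)
      _ = (ENNReal.ofReal A * (‖ξ‖ₑ * ∫⁻ s in Icc (0 : ℝ) (1 / 2), H ((1 - s) • ξ) *
          decayWeight s ξ ^ 2) +
          ‖ξ‖ₑ * ∫⁻ s in Icc (1 / 2 : ℝ) 1, H ((1 - s) • ξ) * ‖ft φ (s • ξ)‖ₑ) ^ 2 := by ring
      _ ≤ _ := by
          refine (hyoung _ _).trans (le_of_eq ?_)
          rw [mul_pow]
  have hlm : Measurable fun ξ : Sp d => (‖ξ‖ₑ * ∫⁻ s in Icc (0 : ℝ) (1 / 2), H ((1 - s) • ξ) *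
        decayWeight s ξ ^ 2) ^ 2 := by
    refine (measurable_enorm.mul (Measurable.lintegral_prod_right' (f := fun p : Sp d × ℝ =>
      H ((1 - p.2) • p.1) * decayWeight p.2 p.1 ^ 2) ?_)).pow_const 2
    exact (hH.comp (by fun_prop)).mul ((measurable_decayWeight.comp measurable_swap).pow_const 2)
  calc _ ≤ ∫⁻ ξ : Sp d, (2 * (ENNReal.ofReal A ^ 2 *
        (‖ξ‖ₑ * ∫⁻ s in Icc (0 : ℝ) (1 / 2), H ((1 - s) • ξ) *
        decayWeight s ξ ^ 2) ^ 2) +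
      2 * (‖ξ‖ₑ * ∫⁻ s in Icc (1 / 2 : ℝ) 1, H ((1 - s) • ξ) * ‖ft φ (s • ξ)‖ₑ) ^ 2) :=
        lintegral_mono hsplit
    _ = 2 * (ENNReal.ofReal A ^ 2 * ∫⁻ ξ : Sp d,
        (‖ξ‖ₑ * ∫⁻ s in Icc (0 : ℝ) (1 / 2), H ((1 - s) • ξ) *
        decayWeight s ξ ^ 2) ^ 2) +
      2 * ∫⁻ ξ : Sp d,
        (‖ξ‖ₑ * ∫⁻ s in Icc (1 / 2 : ℝ) 1, H ((1 - s) • ξ) * ‖ft φ (s • ξ)‖ₑ) ^ 2 := by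
        rw [lintegral_add_left ((hlm.const_mul _).const_mul _), lintegral_const_mul' _ _ (by simp),
          lintegral_const_mul' _ _ (by simp), lintegral_const_mul' _ _ (by simp)]
    _ ≤ 2 * (ENNReal.ofReal A ^ 2 * (2 ^ (d + 1) * ∫⁻ ξ, H ξ ^ 2)) + 2 * (C' * L ^ 2) := by
        gcongr
        · exact lintegral_low_le hH
        · exact hhigh H (fun ξ => ‖ft φ ξ‖ₑ) L hP hL
    _ = (2 * (ENNReal.ofReal A ^ 2 * 2 ^ (d + 1))) * (∫⁻ ξ, H ξ ^ 2) + (2 * C') * L ^ 2 := by ring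
    _ ≤ _ := by
        gcongr
        · exact le_self_add
        · exact le_add_self

/-! ### The regularized Bogovskii operator -/

theorem sq_integral_mul_le {α : Type*} [MeasurableSpace α] {μ : Measure α} {f g : α → ℝ}
    (hf : MemLp f 2 μ) (hg : MemLp g 2 μ) :
    (∫ x, f x * g x ∂μ) ^ 2 ≤ (∫ x, f x ^ 2 ∂μ) * ∫ x, g x ^ 2 ∂μ := by
  have h1 : Integrable (fun x => f x * g x) μ := hf.integrable_mul hg
  have h2 := hf.integrable_sq
  have h3 := hg.integrable_sq
  have h := discrim_le_zero (a := ∫ x, g x ^ 2 ∂μ) (b := -2 * ∫ x, f x * g x ∂μ)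
    (c := ∫ x, f x ^ 2 ∂μ) fun t => by
      have h4 : (∫ x, g x ^ 2 ∂μ) * (t * t) + -2 * (∫ x, f x * g x ∂μ) * t + ∫ x, f x ^ 2 ∂μ =
          ∫ x, (f x - t * g x) ^ 2 ∂μ := by
        have h5 : Integrable (fun x => g x ^ 2 * (t * t) + -2 * (f x * g x) * t) μ :=
          (h3.mul_const _).add ((h1.const_mul _).mul_const _)
        rw [← integral_mul_const, ← integral_const_mul, ← integral_mul_const,
          ← integral_add (h3.mul_const _) ((h1.const_mul _).mul_const _), ← integral_add h5 h2]
        congr 1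
        ext x
        ring
      rw [h4]
      exact integral_nonneg fun x => sq_nonneg _
  rw [discrim] at h
  linarith

theorem sq_integral_abs_le {f : Sp d → ℝ} (hf : IsTest f) {R : ℝ}
    (hR : tsupport f ⊆ Metric.closedBall 0 R) :
    (∫ x, ‖f x‖) ^ 2 ≤ volume.real (Metric.closedBall (0 : Sp d) R) * ∫ x, f x ^ 2 := by
  have h1 : ∫ x, ‖f x‖ = ∫ x in Metric.closedBall (0 : Sp d) R, 1 * ‖f x‖ := by
    simp only [one_mul]
    exact (setIntegral_eq_of_tsupport_subset hR fun x hx => by simp [hx]).symm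
  have h2 : ∫ x, f x ^ 2 = ∫ x in Metric.closedBall (0 : Sp d) R, ‖f x‖ ^ 2 := by
    simp only [Real.norm_eq_abs, sq_abs]
    exact (setIntegral_eq_of_tsupport_subset hR fun x hx => by simp [hx]).symm
  rw [h1, h2]
  have : IsFiniteMeasure (volume.restrict (Metric.closedBall (0 : Sp d) R)) :=
    ⟨by simpa using measure_closedBall_lt_top⟩
  refine (sq_integral_mul_le (memLp_const 1) (hf.memLp _).norm).trans (le_of_eq ?_)
  simp

/-- The parameter space of the Bogovskii operator: `(s, y, z)` stands for the point
`(1 - s) y + s z` of the segment from `y` to `z`. -/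
def segMeasure (d : ℕ) : Measure (ℝ × Sp d × Sp d) :=
  (volume.restrict (Icc (0 : ℝ) 1)).prod (volume.prod volume)

instance : SFinite (segMeasure d) := by unfold segMeasure; infer_instance

/-- The point with parameters `(s, y, z)`. -/
def segPoint (θ : ℝ × Sp d × Sp d) : Sp d := (1 - θ.1) • θ.2.1 + θ.1 • θ.2.2

theorem continuous_segPoint : Continuous (segPoint (d := d)) := by
  unfold segPoint; fun_prop

/-- The mass `h(y) φ(z)`, spread uniformly over the segment from `y` to `z` and mollified
with `η`. -/
def bog (φ h η : Sp d → ℝ) : Sp d → ℝ :=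
  superpose (segMeasure d) (fun θ => h θ.2.1 * φ θ.2.2) segPoint η

theorem integrable_bog {φ h : Sp d → ℝ} (hφ : IsTest φ) (hh : IsTest h) :
    Integrable (fun θ : ℝ × Sp d × Sp d => h θ.2.1 * φ θ.2.2) (segMeasure d) := by
  have h1 := (hh.integrable volume).mul_prod (hφ.integrable volume)
  have : IsFiniteMeasure (volume.restrict (Icc (0 : ℝ) 1)) := ⟨by simp⟩
  exact h1.comp_snd _

/-- Transport along segments decouples under the Fourier transform for every fixed `s`. -/
theorem ft_bog {φ h η : Sp d → ℝ} (hφ : IsTest φ) (hh : IsTest h) (hη : IsTest η) (ξ : Sp d) :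
    ft (bog φ h η) ξ =
      (∫ s in Icc (0 : ℝ) 1, ft h ((1 - s) • ξ) * ft φ (s • ξ)) * ft η ξ := by
  rw [bog, ft_superpose (integrable_bog hφ hh) continuous_segPoint.measurable hη]
  congr 1
  have hint : Integrable (fun θ : ℝ × Sp d × Sp d =>
      (Real.fourierChar (-⟪segPoint θ, ξ⟫) : ℂ) * ((h θ.2.1 * φ θ.2.2 : ℝ) : ℂ))
      (segMeasure d) := by
    refine ((integrable_bog hφ hh).ofReal (𝕜 := ℂ)).bdd_mul (c := 1) ?_ ?_
    · have : Continuous fun θ : ℝ × Sp d × Sp d => (Real.fourierChar (-⟪segPoint θ, ξ⟫) : ℂ) := by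
        have := continuous_segPoint (d := d)
        fun_prop
      exact this.aestronglyMeasurable
    · exact Eventually.of_forall fun θ => (Circle.norm_coe _).le
  rw [segMeasure, integral_prod _ hint]
  refine integral_congr_ae (Eventually.of_forall fun s => ?_)
  show _ = ft h ((1 - s) • ξ) * ft φ (s • ξ)
  rw [ft, ft, Real.fourier_eq, Real.fourier_eq, ← integral_prod_mul]
  refine integral_congr_ae (Eventually.of_forall fun p => ?_)
  simp only [Circle.smul_def, smul_eq_mul, segPoint]
  have : -⟪(1 - s) • p.1 + s • p.2, ξ⟫ = -⟪p.1, (1 - s) • ξ⟫ + -⟪p.2, s • ξ⟫ := by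
    rw [inner_add_left, inner_smul_left, inner_smul_left, inner_smul_right, inner_smul_right]
    simp; ring
  rw [this, AddChar.map_add_eq_mul]
  push_cast
  ring

/-- Star-shapedness keeps the transported mass in a compact subset of the domain. -/
theorem exists_bog_support {φ h : Sp d → ℝ} (hφ : IsTest φ) (hh : IsTest h) {B D : Set (Sp d)}
    (hφB : tsupport φ ⊆ B) (hhD : tsupport h ⊆ D)
    (hstar : ∀ y ∈ D, ∀ z ∈ B, segment ℝ y z ⊆ D) :
    ∃ K ⊆ D, IsCompact K ∧ ∀ θ ∈ Icc (0 : ℝ) 1 ×ˢ (univ : Set (Sp d × Sp d)),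
      h θ.2.1 * φ θ.2.2 ≠ 0 → segPoint θ ∈ K := by
  refine ⟨segPoint '' (Icc (0 : ℝ) 1 ×ˢ tsupport h ×ˢ tsupport φ), ?_, ?_, ?_⟩
  · rintro _ ⟨⟨s, y, z⟩, ⟨hs, hy, hz⟩, rfl⟩
    refine hstar y (hhD hy) z (hφB hz) ⟨1 - s, s, by linarith [hs.2], hs.1, by ring, rfl⟩
  · exact ((isCompact_Icc.prod (hh.2.isCompact.prod hφ.2.isCompact)).image continuous_segPoint)
  · rintro ⟨s, y, z⟩ ⟨hs, -⟩ hne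
    refine ⟨(s, y, z), ⟨hs, subset_tsupport _ (left_ne_zero_of_mul hne),
      subset_tsupport _ (right_ne_zero_of_mul hne)⟩, rfl⟩

theorem bog_eq_superpose_indicator (φ h η : Sp d → ℝ) : bog φ h η =
    superpose (segMeasure d) ((Icc (0 : ℝ) 1 ×ˢ (univ : Set (Sp d × Sp d))).indicator
      fun θ => h θ.2.1 * φ θ.2.2) segPoint η := by
  ext x
  have : ∀ᵐ θ ∂(segMeasure d), θ ∈ Icc (0 : ℝ) 1 ×ˢ (univ : Set (Sp d × Sp d)) := by
    have h1 : ∀ᵐ s ∂(volume.restrict (Icc (0 : ℝ) 1)), s ∈ Icc (0 : ℝ) 1 :=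
      ae_restrict_mem measurableSet_Icc
    filter_upwards [Measure.quasiMeasurePreserving_fst.ae h1] with θ hθ
    exact ⟨hθ, mem_univ _⟩
  refine integral_congr_ae ?_
  filter_upwards [this] with θ hθ
  simp [hθ]

theorem isTest_bog {φ h η : Sp d → ℝ} (hφ : IsTest φ) (hh : IsTest h) (hη : IsTest η)
    {K : Set (Sp d)} (hK : IsCompact K)
    (hmem : ∀ θ ∈ Icc (0 : ℝ) 1 ×ˢ (univ : Set (Sp d × Sp d)),
      h θ.2.1 * φ θ.2.2 ≠ 0 → segPoint θ ∈ K) {ε : ℝ}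
    (hηε : tsupport η ⊆ Metric.closedBall 0 ε) :
    IsTest (bog φ h η) ∧ tsupport (bog φ h η) ⊆ Metric.cthickening ε K := by
  rw [bog_eq_superpose_indicator]
  refine isTest_superpose ((integrable_bog hφ hh).indicator (measurableSet_Icc.prod .univ))
    continuous_segPoint.measurable hK (fun θ hθ => ?_) hη hηε
  have h1 := mem_of_indicator_ne_zero hθ
  rw [indicator_of_mem h1] at hθ
  exact hmem θ h1 hθ

/-- The gradient of `bog φ h η` is bounded by `h` in `L²`, uniformly with respect to the
mollifier `η`. -/
theorem exists_integral_pd_bog_sq_le {φ : Sp d → ℝ} (hφ : IsTest φ) (R : ℝ) :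
    ∃ C : ℝ, 0 ≤ C ∧ ∀ h η : Sp d → ℝ, IsTest h → tsupport h ⊆ Metric.closedBall 0 R →
      IsTest η → (∀ x, 0 ≤ η x) → ∫ x, η x = 1 → IsTest (bog φ h η) → ∀ j,
        ∫ x, pd j (bog φ h η) x ^ 2 ≤ C * ∫ x, h x ^ 2 := by
  obtain ⟨C, hC, hbound⟩ := exists_lintegral_ft_le hφ
  set P : ENNReal := ENNReal.ofReal (2 * Real.pi) ^ 2 * C with hP
  have hPt : P ≠ ⊤ := ENNReal.mul_ne_top (ENNReal.pow_ne_top ENNReal.ofReal_ne_top) hC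
  set V := volume.real (Metric.closedBall (0 : Sp d) R)
  have hV : 0 ≤ V := measureReal_nonneg
  refine ⟨P.toReal * (1 + V), by positivity, fun h η hh hhR hη hη0 hη1 hS j => ?_⟩
  have hnonneg : 0 ≤ ∫ x, h x ^ 2 := integral_nonneg fun x => sq_nonneg _
  have hL : ∀ ξ, ‖ft h ξ‖ₑ ≤ ENNReal.ofReal (∫ x, ‖h x‖) := fun ξ => by
    rw [← ofReal_norm]
    exact ENNReal.ofReal_le_ofReal (norm_ft_le ξ)
  have hη' : ∀ ξ, ‖ft η ξ‖ₑ ≤ 1 := fun ξ => by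
    rw [← ofReal_norm, ENNReal.ofReal_le_one]
    refine (norm_ft_le ξ).trans (le_of_eq ?_)
    rw [← hη1]
    exact integral_congr_ae (Eventually.of_forall fun x => Real.norm_of_nonneg (hη0 x))
  have hpt : ∀ ξ, ‖ft (pd j (bog φ h η)) ξ‖ₑ ^ 2 ≤ ENNReal.ofReal (2 * Real.pi) ^ 2 *
      (‖ξ‖ₑ * ∫⁻ s in Icc (0 : ℝ) 1, ‖ft h ((1 - s) • ξ)‖ₑ * ‖ft φ (s • ξ)‖ₑ) ^ 2 := by
    intro ξ
    rw [← mul_pow]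
    gcongr
    rw [ft_pd hS, ft_bog hφ hh hη, enorm_mul]
    have e1 : ‖(2 * Real.pi * Complex.I : ℂ)‖ₑ = ENNReal.ofReal (2 * Real.pi) := by
      rw [← ofReal_norm]
      congr 1
      simp [abs_of_pos Real.pi_pos]
    have e2 : ‖((ξ j : ℝ) : ℂ)‖ₑ ≤ ‖ξ‖ₑ := by
      rw [← ofReal_norm, ← ofReal_norm, Complex.norm_real]
      exact ENNReal.ofReal_le_ofReal (PiLp.norm_apply_le ξ j)
    rw [e1, enorm_mul, enorm_mul _ (ft η ξ)]
    refine mul_le_mul_right (mul_le_mul' e2 ?_) _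
    calc _ ≤ (∫⁻ s in Icc (0 : ℝ) 1, ‖ft h ((1 - s) • ξ) * ft φ (s • ξ)‖ₑ) * 1 :=
          mul_le_mul' (enorm_integral_le_lintegral_enorm _) (hη' ξ)
      _ = _ := by simp [enorm_mul]
  have hmain : ENNReal.ofReal (∫ x, pd j (bog φ h η) x ^ 2) ≤
      ENNReal.ofReal (P.toReal * (1 + V) * ∫ x, h x ^ 2) := by
    rw [← lintegral_norm_ft_sq (hS.pd j)]
    calc _ ≤ ∫⁻ ξ, ENNReal.ofReal (2 * Real.pi) ^ 2 * (‖ξ‖ₑ *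
          ∫⁻ s in Icc (0 : ℝ) 1, ‖ft h ((1 - s) • ξ)‖ₑ * ‖ft φ (s • ξ)‖ₑ) ^ 2 :=
          lintegral_mono hpt
      _ = ENNReal.ofReal (2 * Real.pi) ^ 2 * ∫⁻ ξ, (‖ξ‖ₑ *
          ∫⁻ s in Icc (0 : ℝ) 1, ‖ft h ((1 - s) • ξ)‖ₑ * ‖ft φ (s • ξ)‖ₑ) ^ 2 :=
          lintegral_const_mul' _ _ (ENNReal.pow_ne_top ENNReal.ofReal_ne_top)
      _ ≤ ENNReal.ofReal (2 * Real.pi) ^ 2 * (C * (∫⁻ ξ, ‖ft h ξ‖ₑ ^ 2) +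
          C * ENNReal.ofReal (∫ x, ‖h x‖) ^ 2) :=
          mul_le_mul_right (hbound (fun ξ => ‖ft h ξ‖ₑ) _
            (continuous_ft hh).measurable.enorm hL) _
      _ = P * (ENNReal.ofReal (∫ x, h x ^ 2) + ENNReal.ofReal ((∫ x, ‖h x‖) ^ 2)) := by
          rw [lintegral_norm_ft_sq hh, ENNReal.ofReal_pow (integral_nonneg fun x => norm_nonneg _)]
          ring
      _ ≤ P * (ENNReal.ofReal (∫ x, h x ^ 2) + ENNReal.ofReal (V * ∫ x, h x ^ 2)) :=
          mul_le_mul_right (add_le_add le_rfl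
            (ENNReal.ofReal_le_ofReal (sq_integral_abs_le hh hhR))) _
      _ = _ := by
          rw [← ENNReal.ofReal_add hnonneg (by positivity), mul_assoc P.toReal,
            ENNReal.ofReal_mul ENNReal.toReal_nonneg, ENNReal.ofReal_toReal hPt]
          congr 2
          ring
  exact (ENNReal.ofReal_le_ofReal_iff (by positivity)).1 hmain

theorem fderiv_apply_eq_sum (η : Sp d → ℝ) (x v : Sp d) :
    fderiv ℝ η x v = ∑ i, v i * pd i η x := by
  conv_lhs => rw [← (EuclideanSpace.basisFun (Fin d) ℝ).sum_repr v]
  simp [pd]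

/-- The transport identity behind the Bogovskii operator: the field that moves the mass `g(y) χ(z)`
along the segment from `y` to `z` has divergence `g - (∫ g) χ`, here in mollified form. -/
theorem sum_pd_bog {χ g η : Sp d → ℝ} (hχ : IsTest χ) (hg : IsTest g) (hη : IsTest η)
    (hχ1 : ∫ x, χ x = 1) (x : Sp d) :
    ∑ i, (pd i (bog (fun z => z i * χ z) g η) x - pd i (bog χ (fun y => y i * g y) η) x) =
      (∫ y, g y * η (x - y)) - (∫ y, g y) * ∫ z, χ z * η (x - z) := by
  have hco : ∀ i, ContDiff ℝ ∞ fun z : Sp d => z i := fun i =>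
    (EuclideanSpace.proj i : Sp d →L[ℝ] ℝ).contDiff
  have hA : ∀ i, IsTest fun z => z i * χ z := fun i => .mul_left (hco i) hχ
  have hB : ∀ i, IsTest fun y => y i * g y := fun i => .mul_left (hco i) hg
  have hm := (continuous_segPoint (d := d)).measurable
  have hi1 := fun i => integrable_superpose (integrable_bog (hA i) hg) hm (hη.pd i).continuous
    (hη.pd i).2 x
  have hi2 := fun i => integrable_superpose (integrable_bog hχ (hB i)) hm (hη.pd i).continuous
    (hη.pd i).2 x
  have h1 : ∀ i, pd i (bog (fun z => z i * χ z) g η) x - pd i (bog χ (fun y => y i * g y) η) x =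
      ∫ θ, ((g θ.2.1 * (θ.2.2 i * χ θ.2.2)) • pd i η (x - segPoint θ) -
        (θ.2.1 i * g θ.2.1 * χ θ.2.2) • pd i η (x - segPoint θ)) ∂(segMeasure d) := by
    intro i
    rw [bog, bog, pd_superpose (integrable_bog (hA i) hg) hm hη,
      pd_superpose (integrable_bog hχ (hB i)) hm hη, superpose, superpose,
      integral_sub (hi1 i) (hi2 i)]
  simp_rw [h1]
  have hi : ∀ i, Integrable (fun θ : ℝ × Sp d × Sp d => (g θ.2.1 * (θ.2.2 i * χ θ.2.2)) •
      pd i η (x - segPoint θ) - (θ.2.1 i * g θ.2.1 * χ θ.2.2) • pd i η (x - segPoint θ))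
      (segMeasure d) := fun i => (hi1 i).sub (hi2 i)
  rw [← integral_finsetSum _ fun i _ => hi i]
  have h2 : (fun θ : ℝ × Sp d × Sp d => ∑ i, ((g θ.2.1 * (θ.2.2 i * χ θ.2.2)) •
      pd i η (x - segPoint θ) - (θ.2.1 i * g θ.2.1 * χ θ.2.2) • pd i η (x - segPoint θ))) =
      fun θ => (g θ.2.1 * χ θ.2.2) * fderiv ℝ η (x - segPoint θ) (θ.2.2 - θ.2.1) := by
    ext θ
    rw [fderiv_apply_eq_sum, Finset.mul_sum]
    refine Finset.sum_congr rfl fun i _ => ?_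
    simp only [smul_eq_mul, PiLp.sub_apply]
    ring
  have h3 : Integrable (fun θ : ℝ × Sp d × Sp d =>
      (g θ.2.1 * χ θ.2.2) * fderiv ℝ η (x - segPoint θ) (θ.2.2 - θ.2.1)) (segMeasure d) := by
    rw [← h2]
    exact integrable_finsetSum _ fun i _ => hi i
  rw [h2]
  rw [segMeasure] at h3 ⊢
  rw [integral_prod_symm _ h3]
  have h4 : ∀ p : Sp d × Sp d, ∫ s in Icc (0 : ℝ) 1,
      (g p.1 * χ p.2) * fderiv ℝ η (x - segPoint (s, p)) (p.2 - p.1) =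
      (g p.1 * η (x - p.1)) * χ p.2 - g p.1 * (χ p.2 * η (x - p.2)) := by
    intro p
    have hd : ∀ s : ℝ, HasDerivAt (fun s : ℝ => -η (x - segPoint (s, p)))
        (fderiv ℝ η (x - segPoint (s, p)) (p.2 - p.1)) s := by
      intro s
      have e1 : HasDerivAt (fun s : ℝ => x - segPoint (s, p)) (-(p.2 - p.1)) s := by
        have : (fun s : ℝ => x - segPoint (s, p)) = fun s : ℝ => x - p.1 - s • (p.2 - p.1) := by
          ext1 s
          simp only [segPoint]
          module
        rw [this]
        simpa using ((hasDerivAt_id s).smul_const (p.2 - p.1)).const_sub (x - p.1)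
      have e2 := ((hη.differentiable _).hasFDerivAt.comp_hasDerivAt s e1).neg
      simpa using! e2
    have hcont : Continuous fun s : ℝ => fderiv ℝ η (x - segPoint (s, p)) (p.2 - p.1) := by
      have e1 : Continuous (fderiv ℝ η) := hη.1.continuous_fderiv (by simp)
      have e2 := continuous_segPoint (d := d)
      fun_prop
    rw [integral_const_mul, integral_Icc_eq_integral_Ioc,
      ← intervalIntegral.integral_of_le (by norm_num),
      intervalIntegral.integral_eq_sub_of_hasDerivAt (fun s _ => hd s)
        (hcont.intervalIntegrable _ _)]
    simp only [segPoint, sub_self, zero_smul, one_smul, zero_add, sub_zero, add_zero]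
    ring
  simp_rw [h4]
  have hη1 : ∀ f : Sp d → ℝ, IsTest f → Integrable fun y => f y * η (x - y) := by
    intro f hf
    have : Continuous fun y => f y * η (x - y) := hf.continuous.mul
      (hη.continuous.comp (by fun_prop))
    exact this.integrable_of_hasCompactSupport hf.2.mul_right
  rw [integral_sub ((hη1 g hg).mul_prod (hχ.integrable volume))
    ((hg.integrable volume).mul_prod (hη1 χ hχ)),
    integral_prod_mul (fun y => g y * η (x - y)) χ, integral_prod_mul g fun z => χ z * η (x - z),
    hχ1, mul_one]

/-- The right inverse of the divergence on a domain that is star-shaped with respect to an open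
set, up to a mollification with `η`. -/
theorem exists_bogovskii {B D : Set (Sp d)} (hD : IsOpen D) (hDb : Bornology.IsBounded D)
    (hstar : ∀ y ∈ D, ∀ z ∈ B, segment ℝ y z ⊆ D) {χ : Sp d → ℝ} (hχ : IsTest χ)
    (hχB : tsupport χ ⊆ B) (hχ1 : ∫ x, χ x = 1) :
    ∃ C : ℝ, 0 ≤ C ∧ ∀ g : Sp d → ℝ, IsTest g → tsupport g ⊆ D → ∃ ε₀ > 0, ∀ η : Sp d → ℝ,
      IsTest η → (∀ x, 0 ≤ η x) → ∫ x, η x = 1 → tsupport η ⊆ Metric.closedBall 0 ε₀ →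
      ∃ V : Fin d → Sp d → ℝ, (∀ i, IsTest (V i) ∧ tsupport (V i) ⊆ D) ∧
        (∀ i j, ∫ x, pd j (V i) x ^ 2 ≤ C * ∫ x, g x ^ 2) ∧
        ∀ x, ∑ i, pd i (V i) x =
          (∫ y, g y * η (x - y)) - (∫ y, g y) * ∫ z, χ z * η (x - z) := by
  obtain ⟨R, hR⟩ := hDb.subset_closedBall (0 : Sp d)
  have hco : ∀ i, ContDiff ℝ ∞ fun z : Sp d => z i := fun i =>
    (EuclideanSpace.proj i : Sp d →L[ℝ] ℝ).contDiff
  have hA : ∀ i, IsTest fun z => z i * χ z := fun i => .mul_left (hco i) hχ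
  choose C1 hC1 hb1 using fun i => exists_integral_pd_bog_sq_le (hA i) R
  obtain ⟨C2, hC2, hb2⟩ := exists_integral_pd_bog_sq_le hχ R
  have hsum : ∀ i, C1 i ≤ ∑ k, C1 k := fun i =>
    Finset.single_le_sum (fun k _ => hC1 k) (Finset.mem_univ i)
  refine ⟨2 * ∑ k, C1 k + 2 * (C2 * R ^ 2), ?_, fun g hg hgD => ?_⟩
  · have := Finset.sum_nonneg fun k (_ : k ∈ Finset.univ) => hC1 k
    positivity
  have hB : ∀ i, IsTest fun y => y i * g y := fun i => .mul_left (hco i) hg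
  obtain ⟨K, hKD, hK, hmem⟩ := exists_bog_support hχ hg hχB hgD hstar
  obtain ⟨ε₀, hε₀, hthick⟩ := hK.exists_cthickening_subset_open hD hKD
  refine ⟨ε₀, hε₀, fun η hη hη0 hη1 hηε => ?_⟩
  have t1 : ∀ i, IsTest (bog (fun z => z i * χ z) g η) ∧
      tsupport (bog (fun z => z i * χ z) g η) ⊆ Metric.cthickening ε₀ K := fun i =>
    isTest_bog (hA i) hg hη hK (fun θ hθ hne => hmem θ hθ fun h => hne (by
      rw [mul_left_comm, h, mul_zero])) hηε
  have t2 : ∀ i, IsTest (bog χ (fun y => y i * g y) η) ∧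
      tsupport (bog χ (fun y => y i * g y) η) ⊆ Metric.cthickening ε₀ K := fun i =>
    isTest_bog hχ (hB i) hη hK (fun θ hθ hne => hmem θ hθ fun h => hne (by
      rw [mul_assoc, h, mul_zero])) hηε
  have hgR : tsupport g ⊆ Metric.closedBall 0 R := hgD.trans hR
  refine ⟨fun i x => bog (fun z => z i * χ z) g η x - bog χ (fun y => y i * g y) η x,
    fun i => ⟨(t1 i).1.sub (t2 i).1, ?_⟩, fun i j => ?_, fun x => ?_⟩
  · refine (tsupport_sub _ _).trans (union_subset ?_ ?_)
    · exact (t1 i).2.trans hthick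
    · exact (t2 i).2.trans hthick
  · have e1 := hb1 i g η hg hgR hη hη0 hη1 (t1 i).1 j
    have e2 := hb2 (fun y => y i * g y) η (hB i) ((tsupport_mul_subset_right).trans hgR) hη hη0 hη1
      (t2 i).1 j
    have hgi := (hg.memLp (p := 2) volume).integrable_sq
    have e3 : ∫ y, (y i * g y) ^ 2 ≤ R ^ 2 * ∫ y, g y ^ 2 := by
      rw [← integral_const_mul]
      refine integral_mono (((hB i).memLp (p := 2) volume).integrable_sq) (hgi.const_mul _)
        fun y => ?_
      simp only [mul_pow]
      by_cases hy : y ∈ tsupport g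
      · have h1 := hgR hy
        rw [mem_closedBall_zero_iff] at h1
        have h2 := (PiLp.norm_apply_le y i).trans h1
        rw [Real.norm_eq_abs] at h2
        gcongr ?_ * _
        exact sq_le_sq' (by linarith [neg_abs_le (y i)]) ((le_abs_self _).trans h2)
      · simp [image_eq_zero_of_notMem_tsupport hy]
    have i1 := (((t1 i).1.pd j).memLp (p := 2) volume).integrable_sq
    have i2 := (((t2 i).1.pd j).memLp (p := 2) volume).integrable_sq
    have hg0 : 0 ≤ ∫ y, g y ^ 2 := integral_nonneg fun _ => sq_nonneg _
    calc _ ≤ ∫ x, (2 * pd j (bog (fun z => z i * χ z) g η) x ^ 2 +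
          2 * pd j (bog χ (fun y => y i * g y) η) x ^ 2) := by
          refine integral_mono ?_ ((i1.const_mul _).add (i2.const_mul _)) fun x => ?_
          · exact ((((t1 i).1.sub (t2 i).1).pd j).memLp (p := 2) volume).integrable_sq
          · simp only
            rw [pd_sub (t1 i).1.differentiable (t2 i).1.differentiable]
            nlinarith [sq_nonneg (pd j (bog (fun z => z i * χ z) g η) x +
              pd j (bog χ (fun y => y i * g y) η) x)]
      _ = 2 * (∫ x, pd j (bog (fun z => z i * χ z) g η) x ^ 2) +
          2 * ∫ x, pd j (bog χ (fun y => y i * g y) η) x ^ 2 := by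
          rw [integral_add (i1.const_mul _) (i2.const_mul _), integral_const_mul,
            integral_const_mul]
      _ ≤ 2 * ((∑ k, C1 k) * ∫ y, g y ^ 2) + 2 * (C2 * (R ^ 2 * ∫ y, g y ^ 2)) := by
          gcongr
          · exact e1.trans (by gcongr; exact hsum i)
          · exact e2.trans (by gcongr)
      _ = _ := by ring
  · rw [← sum_pd_bog hχ hg hη hχ1 x]
    exact Finset.sum_congr rfl fun i _ =>
      pd_sub (t1 i).1.differentiable (t2 i).1.differentiable i x

/-! ### Functions with gradient in `H⁻¹` -/

/-- The gradient of `f` is bounded in `H⁻¹(Ω)`, with squared norm at most `M` in every component. -/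
def NegBound (Ω : Set (Sp d)) (f : Sp d → ℝ) (M : ℝ) : Prop :=
  ∀ φ, IsTest φ → tsupport φ ⊆ Ω → ∀ j,
    (∫ x in Ω, f x * pd j φ x) ^ 2 ≤ M * ∫ x, ∑ k, pd k φ x ^ 2

/-- The squared distance in `L²(D)` from `f` to the constants is controlled by the squared norm of
`∇f` in `H⁻¹(Ω)`. For `D = Ω` this is the Nečas inequality on `Ω`. -/
def OscBound (Ω D : Set (Sp d)) : Prop :=
  ∃ C : ℝ, 0 ≤ C ∧ ∀ f : Sp d → ℝ, MemLp f 2 (volume.restrict Ω) → ∀ M : ℝ, 0 ≤ M →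
    NegBound Ω f M → ∃ a : ℝ, ∫ x in D, (f x - a) ^ 2 ≤ C * M

theorem NegBound.mono {Ω D : Set (Sp d)} (hD : D ⊆ Ω) {f : Sp d → ℝ} {M : ℝ}
    (h : NegBound Ω f M) : NegBound D f M := by
  intro φ hφ hsub j
  have h1 := h φ hφ (hsub.trans hD) j
  have hsub' := (tsupport_pd_subset φ j).trans hsub
  rw [setIntegral_eq_of_tsupport_subset (hsub'.trans hD) fun x hx => by rw [hx, mul_zero]] at h1
  rwa [setIntegral_eq_of_tsupport_subset hsub' fun x hx => by rw [hx, mul_zero]]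

theorem OscBound.mono {Ω D : Set (Sp d)} (hD : D ⊆ Ω) (h : OscBound D D) : OscBound Ω D := by
  obtain ⟨C, hC, hb⟩ := h
  exact ⟨C, hC, fun f hf M hM hneg =>
    hb f (hf.mono_measure (Measure.restrict_mono hD le_rfl)) M hM (hneg.mono hD)⟩

/-- Test functions supported in an open set are dense in `L²`, in the form of a duality
principle. -/
theorem integral_sq_le_of_forall_isTest {D : Set (Sp d)} (hD : IsOpen D) {f : Sp d → ℝ}
    (hf : MemLp f 2 (volume.restrict D)) {K : ℝ} (hK : 0 ≤ K)
    (h : ∀ g, IsTest g → tsupport g ⊆ D → (∫ x in D, f x * g x) ^ 2 ≤ K * ∫ x, g x ^ 2) :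
    ∫ x in D, f x ^ 2 ≤ K := by
  let μ := volume.restrict D
  let S : Submodule ℝ (Lp ℝ 2 μ) :=
    { carrier := {F | ∃ g, IsTest g ∧ tsupport g ⊆ D ∧ F =ᵐ[μ] g}
      zero_mem' := ⟨fun _ => 0, isTest_zero, by simp [tsupport], Lp.coeFn_zero _ _ _⟩
      add_mem' := by
        rintro F G ⟨f, hf, hf', hFf⟩ ⟨g, hg, hg', hGg⟩
        refine ⟨fun x => f x + g x, hf.add hg, (tsupport_add f g).trans (union_subset hf' hg'), ?_⟩
        filter_upwards [hFf, hGg, Lp.coeFn_add F G] with x h1 h2 h3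
        rw [h3, Pi.add_apply, h1, h2]
      smul_mem' := by
        rintro c F ⟨f, hf, hf', hFf⟩
        refine ⟨fun x => c * f x, hf.const_mul c,
          (tsupport_mul_subset_right (f := fun _ => c)).trans hf', ?_⟩
        filter_upwards [hFf, Lp.coeFn_smul c F] with x h1 h2
        rw [h2, Pi.smul_apply, h1, smul_eq_mul] }
  have hdense : Dense (S : Set (Lp ℝ 2 μ)) := by
    rw [Submodule.dense_iff_topologicalClosure_eq_top, Submodule.topologicalClosure_eq_top_iff,
      Submodule.eq_bot_iff]
    intro F hF
    have hloc : LocallyIntegrableOn F D volume :=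
      locallyIntegrableOn_of_locallyIntegrable_restrict
        ((Lp.memLp F).locallyIntegrable (by norm_num))
    have h0 := hD.ae_eq_zero_of_integral_contDiff_smul_eq_zero hloc fun g hg hgc hgD => by
      have hgL : MemLp g 2 μ := (show IsTest g from ⟨hg, hgc⟩).memLp _
      have h1 := (Submodule.mem_orthogonal _ _).1 hF hgL.toLp
        ⟨g, ⟨hg, hgc⟩, hgD, hgL.coeFn_toLp⟩
      rw [L2.inner_def] at h1
      rw [← setIntegral_eq_of_tsupport_subset hgD fun x hx => by rw [hx, zero_smul], ← h1]
      refine integral_congr_ae ?_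
      filter_upwards [hgL.coeFn_toLp] with x hx
      rw [hx]
      simp [mul_comm]
    rw [Lp.eq_zero_iff_ae_eq_zero]
    exact (ae_restrict_iff' hD.measurableSet).2 h0
  let F := hf.toLp
  have hF : F =ᵐ[μ] f := hf.coeFn_toLp
  have hclosed : IsClosed {G : Lp ℝ 2 μ | (inner ℝ F G) ^ 2 ≤ K * ‖G‖ ^ 2} :=
    isClosed_le (by fun_prop) (by fun_prop)
  have hsq : ∀ G : Lp ℝ 2 μ, ∀ g : Sp d → ℝ, G =ᵐ[μ] g → ‖G‖ ^ 2 = ∫ x in D, g x ^ 2 := by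
    intro G g hG
    rw [← real_inner_self_eq_norm_sq, L2.inner_def]
    refine integral_congr_ae ?_
    filter_upwards [hG] with x hx
    rw [hx]
    simp [sq]
  have hall : {G : Lp ℝ 2 μ | (inner ℝ F G) ^ 2 ≤ K * ‖G‖ ^ 2} = univ := by
    refine univ_subset_iff.1 ?_
    rw [← hdense.closure_eq]
    refine closure_minimal ?_ hclosed
    rintro G ⟨g, hg, hgD, hG⟩
    have h1 := h g hg hgD
    rw [mem_ofPred_eq, hsq G g hG, L2.inner_def,
      setIntegral_eq_of_tsupport_subset (φ := g) (f := fun x => g x ^ 2) hgD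
        fun x hx => by simp [hx]]
    convert h1 using 2
    refine integral_congr_ae ?_
    filter_upwards [hG, hF] with x hx hx'
    rw [hx, hx']
    simp [mul_comm]
  have hFF : F ∈ {G : Lp ℝ 2 μ | (inner ℝ F G) ^ 2 ≤ K * ‖G‖ ^ 2} := hall ▸ mem_univ F
  rw [mem_ofPred_eq, real_inner_self_eq_norm_sq] at hFF
  rw [← hsq F f hF]
  rcases (sq_nonneg ‖F‖).eq_or_lt with h0 | h0
  · rwa [← h0]
  · nlinarith

/-- Mollification converges uniformly. -/
theorem exists_mollify_sub_le {g : Sp d → ℝ} (hg : IsTest g) {δ : ℝ} (hδ : 0 < δ) :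
    ∃ ε > 0, ∀ η : Sp d → ℝ, IsTest η → (∀ x, 0 ≤ η x) → ∫ x, η x = 1 →
      tsupport η ⊆ Metric.closedBall 0 ε → ∀ x, |(∫ y, g y * η (x - y)) - g x| ≤ δ := by
  obtain ⟨ε, hε, hunif⟩ := Metric.uniformContinuous_iff.1
    (hg.2.uniformContinuous_of_continuous hg.continuous) δ hδ
  refine ⟨ε / 2, by positivity, fun η hη hη0 hη1 hηε x => ?_⟩
  have hshift : Continuous fun y : Sp d => η (x - y) := hη.continuous.comp (by fun_prop)
  have i0 : Integrable fun y => η (x - y) := (hη.integrable volume).comp_sub_left x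
  have i1 : Integrable fun y => g y * η (x - y) :=
    (hg.continuous.mul hshift).integrable_of_hasCompactSupport hg.2.mul_right
  have h1 : ∫ y, η (x - y) = 1 := by
    rw [← hη1]; exact integral_sub_left_eq_self η volume x
  have h2 : g x = ∫ y, g x * η (x - y) := by rw [integral_const_mul, h1, mul_one]
  rw [h2, ← integral_sub i1 (i0.const_mul _), ← mul_one δ, ← h1, ← integral_const_mul]
  rw [← Real.norm_eq_abs]
  refine norm_integral_le_of_norm_le (i0.const_mul _) (Eventually.of_forall fun y => ?_)
  rw [← sub_mul, norm_mul, Real.norm_of_nonneg (hη0 _)]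
  by_cases hy : x - y ∈ tsupport η
  · gcongr
    · exact hη0 _
    · have := hηε hy
      rw [mem_closedBall_zero_iff] at this
      have h3 : dist y x < ε := by
        rw [dist_comm, dist_eq_norm]; linarith
      exact (hunif h3).le
  · simp [image_eq_zero_of_notMem_tsupport hy]

/-- The Nečas inequality on a domain that is star-shaped with respect to an open set. -/
theorem oscBound_of_starShaped {B D : Set (Sp d)} (hD : IsOpen D) (hDb : Bornology.IsBounded D)
    (hB : IsOpen B) (hBne : B.Nonempty) (hBD : B ⊆ D)
    (hstar : ∀ y ∈ D, ∀ z ∈ B, segment ℝ y z ⊆ D) : OscBound D D := by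
  obtain ⟨χ, hχ, hχB, -, hχ1⟩ := exists_isTest_integral_eq_one hB hBne
  obtain ⟨C, hC, hbog⟩ := exists_bogovskii hD hDb hstar hχ hχB hχ1
  have hfin : IsFiniteMeasure (volume.restrict D) := ⟨by simpa using hDb.measure_lt_top⟩
  refine ⟨(d : ℝ) ^ 3 * C, by positivity, fun f hf M hM hneg => ?_⟩
  set a := ∫ x in D, f x * χ x with ha
  refine ⟨a, ?_⟩
  have hf0 : MemLp (fun x => f x - a) 2 (volume.restrict D) := hf.sub (memLp_const a)
  have hf0i : Integrable (fun x => f x - a) (volume.restrict D) := hf0.integrable (by norm_num)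
  have hDint : ∀ g : Sp d → ℝ, IsTest g → Integrable (fun x => (f x - a) * g x)
      (volume.restrict D) := fun g hg => hf0.integrable_mul (hg.memLp (p := 2) _)
  have hχ0 : ∫ x in D, (f x - a) * χ x = 0 := by
    have e1 : Integrable (fun x => f x * χ x) (volume.restrict D) :=
      hf.integrable_mul (hχ.memLp (p := 2) _)
    have e2 : ∫ x in D, χ x = 1 := by
      rw [← hχ1]; exact setIntegral_eq_of_tsupport_subset (hχB.trans hBD) fun x hx => hx
    simp only [sub_mul]
    rw [integral_sub e1 ((hχ.integrable _).const_mul a), integral_const_mul, e2, ← ha]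
    ring
  refine integral_sq_le_of_forall_isTest hD hf0 (by positivity) fun g hg hgD => ?_
  obtain ⟨ε₀, hε₀, hV⟩ := hbog g hg hgD
  set Q := (d : ℝ) ^ 3 * C * M * ∫ x, g x ^ 2 with hQ
  have hg0 : 0 ≤ ∫ x, g x ^ 2 := integral_nonneg fun _ => sq_nonneg _
  have hQ0 : 0 ≤ Q := by positivity
  set L := ∫ x in D, ‖f x - a‖ with hL
  have hL0 : 0 ≤ L := integral_nonneg fun _ => norm_nonneg _
  set c := L * (1 + |∫ y, g y|) with hc
  have hc0 : 0 ≤ c := by positivity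
  suffices h : |∫ x in D, (f x - a) * g x| ≤ √Q by
    rw [← sq_abs]
    calc _ ≤ √Q ^ 2 := by gcongr
      _ = Q := Real.sq_sqrt hQ0
  refine le_of_forall_pos_le_add fun t ht => ?_
  have hδ : 0 < t / (c + 1) := by positivity
  obtain ⟨ε₁, hε₁, hm1⟩ := exists_mollify_sub_le hg hδ
  obtain ⟨ε₂, hε₂, hm2⟩ := exists_mollify_sub_le hχ hδ
  have hεpos : 0 < min ε₀ (min ε₁ ε₂) := lt_min hε₀ (lt_min hε₁ hε₂)
  obtain ⟨η, hη, hηB, hη0, hη1⟩ := exists_isTest_integral_eq_one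
    (Metric.isOpen_ball (x := (0 : Sp d)) (ε := min ε₀ (min ε₁ ε₂))) ⟨0, by simpa using hεpos⟩
  have hηs : ∀ ε, min ε₀ (min ε₁ ε₂) ≤ ε → tsupport η ⊆ Metric.closedBall 0 ε := fun ε h =>
    hηB.trans (Metric.ball_subset_closedBall.trans (Metric.closedBall_subset_closedBall h))
  obtain ⟨V, hVt, hVb, hVd⟩ := hV η hη hη0 hη1 (hηs _ (min_le_left _ _))
  have hg1 := hm1 η hη hη0 hη1 (hηs _ ((min_le_right _ _).trans (min_le_left _ _)))
  have hχ1' := hm2 η hη hη0 hη1 (hηs _ ((min_le_right _ _).trans (min_le_right _ _)))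
  -- the pairing of `f` with the divergence of the approximate Bogovskii field
  have hpair : (∫ x in D, (f x - a) * ∑ i, pd i (V i) x) ^ 2 ≤ Q := by
    have e1 : ∫ x in D, (f x - a) * ∑ i, pd i (V i) x =
        ∑ i, ∫ x in D, f x * pd i (V i) x := by
      simp only [Finset.mul_sum]
      rw [integral_finsetSum _ fun i _ => hDint _ ((hVt i).1.pd i)]
      refine Finset.sum_congr rfl fun i _ => ?_
      have e2 : Integrable (fun x => f x * pd i (V i) x) (volume.restrict D) :=
        hf.integrable_mul (((hVt i).1.pd i).memLp (p := 2) _)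
      have e3 : ∫ x in D, pd i (V i) x = 0 := by
        rw [← integral_pd (hVt i).1 i]
        exact setIntegral_eq_of_tsupport_subset ((tsupport_pd_subset _ _).trans (hVt i).2)
          fun x hx => hx
      simp only [sub_mul]
      rw [integral_sub e2 ((((hVt i).1.pd i).integrable _).const_mul a), integral_const_mul, e3]
      ring
    have e4 : ∀ i, (∫ x in D, f x * pd i (V i) x) ^ 2 ≤ M * (d * (C * ∫ x, g x ^ 2)) := by
      intro i
      refine (hneg (V i) (hVt i).1 (hVt i).2 i).trans ?_
      gcongr
      rw [integral_finsetSum _ fun k _ => (((hVt i).1.pd k).memLp (p := 2) volume).integrable_sq]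
      refine (Finset.sum_le_sum fun k _ => hVb i k).trans (le_of_eq ?_)
      simp
    rw [e1]
    refine (sq_sum_le_card_mul_sum_sq).trans ?_
    refine (mul_le_mul_of_nonneg_left (Finset.sum_le_sum fun i _ => e4 i) (by positivity)).trans
      (le_of_eq ?_)
    simp [hQ]
    ring
  have hT : IsTest fun x => ∑ i, pd i (V i) x := by
    have : ∀ s : Finset (Fin d), IsTest fun x => ∑ i ∈ s, pd i (V i) x := by
      intro s
      classical
      induction s using Finset.induction_on with
      | empty => simpa using isTest_zero
      | insert i s hi ih => simpa [Finset.sum_insert hi] using ((hVt i).1.pd i).add ih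
    exact this _
  have hG : IsTest fun x => g x - (∫ y, g y) * χ x := hg.sub (hχ.const_mul _)
  have hdiff : |(∫ x in D, (f x - a) * g x) - ∫ x in D, (f x - a) * ∑ i, pd i (V i) x| ≤ t := by
    have e1 : ∫ x in D, (f x - a) * g x = ∫ x in D, (f x - a) * (g x - (∫ y, g y) * χ x) := by
      have : (fun x => (f x - a) * (g x - (∫ y, g y) * χ x)) =
          fun x => (f x - a) * g x - (∫ y, g y) * ((f x - a) * χ x) := by
        ext x; ring
      rw [this, integral_sub (hDint g hg) ((hDint χ hχ).const_mul _), integral_const_mul, hχ0]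
      ring
    rw [e1, ← integral_sub (hDint _ hG) (hDint _ hT)]
    have e2 : ∀ x, ‖(f x - a) * (g x - (∫ y, g y) * χ x) - (f x - a) * ∑ i, pd i (V i) x‖ ≤
        ‖f x - a‖ * (t / (c + 1) * (1 + |∫ y, g y|)) := by
      intro x
      rw [← mul_sub, norm_mul]
      gcongr
      rw [hVd x, Real.norm_eq_abs]
      have h1 := hg1 x
      have h2 := hχ1' x
      have h3 : |(∫ y, g y) * ((∫ z, χ z * η (x - z)) - χ x)| ≤ |∫ y, g y| * (t / (c + 1)) := by
        rw [abs_mul]; gcongr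
      rw [abs_le] at h1 h3 ⊢
      constructor <;> nlinarith
    refine (norm_integral_le_of_norm_le (hf0i.norm.mul_const _)
      (Eventually.of_forall e2)).trans ?_
    rw [integral_mul_const]
    have : L * (t / (c + 1) * (1 + |∫ y, g y|)) = t * (c / (c + 1)) := by
      rw [hc]; field_simp
    rw [this]
    have : c / (c + 1) ≤ 1 := by rw [div_le_one (by positivity)]; linarith
    nlinarith
  have h1 : |∫ x in D, (f x - a) * ∑ i, pd i (V i) x| ≤ √Q := by
    rw [← Real.sqrt_sq_eq_abs]; exact Real.sqrt_le_sqrt hpair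
  have h2 := abs_sub_abs_le_abs_sub (∫ x in D, (f x - a) * g x)
    (∫ x in D, (f x - a) * ∑ i, pd i (V i) x)
  linarith

/-! ### Gluing -/

/-- On an overlap of positive measure the two constants can be compared. -/
theorem OscBound.union {Ω A B : Set (Sp d)} (hΩ : Bornology.IsBounded Ω) (hA : IsOpen A)
    (hB : IsOpen B) (hAΩ : A ⊆ Ω) (hBΩ : B ⊆ Ω) (hne : (A ∩ B).Nonempty)
    (h1 : OscBound Ω A) (h2 : OscBound Ω B) : OscBound Ω (A ∪ B) := by
  obtain ⟨C1, hC1, hb1⟩ := h1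
  obtain ⟨C2, hC2, hb2⟩ := h2
  have hfin : ∀ S ⊆ Ω, volume S ≠ ⊤ := fun S hS => (hΩ.subset hS).measure_lt_top.ne
  set v := volume.real (A ∩ B) with hv
  have hvpos : 0 < v := ENNReal.toReal_pos ((hA.inter hB).measure_pos volume hne).ne'
    (hfin _ (inter_subset_left.trans hAΩ))
  set w := volume.real B with hw
  have hw0 : 0 ≤ w := measureReal_nonneg
  refine ⟨C1 + 2 * C2 + 2 * w * ((2 * C1 + 2 * C2) / v), by positivity, fun f hf M hM hneg => ?_⟩
  obtain ⟨a, ha⟩ := hb1 f hf M hM hneg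
  obtain ⟨b, hb⟩ := hb2 f hf M hM hneg
  refine ⟨a, ?_⟩
  have hint : ∀ S ⊆ Ω, ∀ a : ℝ, IntegrableOn (fun x => (f x - a) ^ 2) S := by
    intro S hS a
    have : IsFiniteMeasure (volume.restrict S) := ⟨by simpa using (hfin S hS).lt_top⟩
    exact ((hf.mono_measure (Measure.restrict_mono hS le_rfl)).sub (memLp_const a)).integrable_sq
  have e1 : (a - b) ^ 2 * v ≤ 2 * (C1 * M) + 2 * (C2 * M) := by
    calc (a - b) ^ 2 * v = ∫ x in A ∩ B, (a - b) ^ 2 := by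
          rw [setIntegral_const, smul_eq_mul, mul_comm]
      _ ≤ ∫ x in A ∩ B, (2 * (f x - a) ^ 2 + 2 * (f x - b) ^ 2) := by
          have hi : IntegrableOn (fun x => 2 * (f x - a) ^ 2 + 2 * (f x - b) ^ 2) (A ∩ B) :=
            ((hint _ (inter_subset_left.trans hAΩ) a).const_mul 2).add
              ((hint _ (inter_subset_left.trans hAΩ) b).const_mul 2)
          refine integral_mono (integrableOn_const (hfin _ (inter_subset_left.trans hAΩ))) hi
            fun x => ?_
          simp only
          nlinarith [sq_nonneg (f x - a + (f x - b))]
      _ = 2 * (∫ x in A ∩ B, (f x - a) ^ 2) + 2 * ∫ x in A ∩ B, (f x - b) ^ 2 := by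
          rw [integral_add ((hint _ (inter_subset_left.trans hAΩ) a).const_mul 2)
            ((hint _ (inter_subset_left.trans hAΩ) b).const_mul 2), integral_const_mul,
            integral_const_mul]
      _ ≤ 2 * (∫ x in A, (f x - a) ^ 2) + 2 * ∫ x in B, (f x - b) ^ 2 := by
          gcongr
          · exact Eventually.of_forall fun x => sq_nonneg _
          · exact hint _ hAΩ a
          · exact inter_subset_left
          · exact Eventually.of_forall fun x => sq_nonneg _
          · exact hint _ hBΩ b
          · exact inter_subset_right
      _ ≤ _ := by gcongr
  have e2 : (a - b) ^ 2 ≤ (2 * C1 + 2 * C2) / v * M := by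
    rw [div_mul_eq_mul_div, le_div_iff₀ hvpos]
    linarith
  have e3 : ∫ x in B, (f x - a) ^ 2 ≤ 2 * (C2 * M) + 2 * (a - b) ^ 2 * w := by
    calc ∫ x in B, (f x - a) ^ 2 ≤ ∫ x in B, (2 * (f x - b) ^ 2 + 2 * (a - b) ^ 2) := by
          have hi : IntegrableOn (fun x => 2 * (f x - b) ^ 2 + 2 * (a - b) ^ 2) B :=
            ((hint _ hBΩ b).const_mul 2).add (integrableOn_const (hfin _ hBΩ))
          refine integral_mono (hint _ hBΩ a) hi fun x => ?_
          simp only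
          nlinarith [sq_nonneg (f x - b + (a - b))]
      _ = 2 * (∫ x in B, (f x - b) ^ 2) + 2 * (a - b) ^ 2 * w := by
          rw [integral_add ((hint _ hBΩ b).const_mul 2) (integrableOn_const (hfin _ hBΩ)),
            integral_const_mul, setIntegral_const, smul_eq_mul]
          ring
      _ ≤ _ := by gcongr
  have e4 : ∫ x in A ∪ B, (f x - a) ^ 2 ≤
      (∫ x in A, (f x - a) ^ 2) + ∫ x in B, (f x - a) ^ 2 := by
    have hAB : A ∪ B = A ∪ (B \ A) := by simp
    rw [hAB, setIntegral_union disjoint_sdiff_right (hB.measurableSet.diff hA.measurableSet)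
      (hint _ hAΩ a) (hint _ (sdiff_subset.trans hBΩ) a)]
    gcongr
    · exact Eventually.of_forall fun x => sq_nonneg _
    · exact hint _ hBΩ a
    · exact sdiff_subset
  calc _ ≤ C1 * M + (2 * (C2 * M) + 2 * (a - b) ^ 2 * w) := by linarith
    _ ≤ C1 * M + (2 * (C2 * M) + 2 * ((2 * C1 + 2 * C2) / v * M) * w) := by gcongr
    _ = _ := by ring

/-- A property of open sets that is inherited by unions of overlapping sets passes from the members
of a finite open cover of a connected set to the whole set. -/
theorem of_finite_cover {X ι : Type*} [TopologicalSpace X] {P : Set X → Prop} {Ω : Set X}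
    (hΩ : IsPreconnected Ω) (hne : Ω.Nonempty) (t : Finset ι) (D : ι → Set X)
    (hopen : ∀ i ∈ t, IsOpen (D i)) (hcover : Ω = ⋃ i ∈ t, D i) (hP : ∀ i ∈ t, P (D i))
    (hunion : ∀ A B, IsOpen A → IsOpen B → A ⊆ Ω → B ⊆ Ω → (A ∩ B).Nonempty → P A → P B →
      P (A ∪ B)) : P Ω := by
  classical
  have hsub : ∀ s ⊆ t, ⋃ i ∈ s, D i ⊆ Ω := fun s hs => by
    rw [hcover]; exact biUnion_subset_biUnion_left hs
  have hop : ∀ s ⊆ t, IsOpen (⋃ i ∈ s, D i) := fun s hs =>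
    isOpen_biUnion fun i hi => hopen i (hs hi)
  obtain ⟨x, hx⟩ := hne
  have hx' := hx
  rw [hcover] at hx'
  obtain ⟨i₀, hi₀, hxi⟩ := mem_iUnion₂.1 hx'
  let T := t.powerset.filter fun s => i₀ ∈ s ∧ P (⋃ i ∈ s, D i)
  have hTne : T.Nonempty := ⟨{i₀}, by simp [T, hi₀, hP]⟩
  obtain ⟨s, hsT, hmax⟩ := T.exists_max_image Finset.card hTne
  simp only [T, Finset.mem_filter, Finset.mem_powerset] at hsT hmax
  obtain ⟨hst, hi₀s, hPs⟩ := hsT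
  have hdisj : Disjoint (⋃ i ∈ s, D i) (⋃ i ∈ t \ s, D i) := by
    rw [Set.disjoint_iff_inter_eq_empty]
    by_contra hcon
    obtain ⟨y, hy1, hy2⟩ := nonempty_iff_ne_empty.2 hcon
    obtain ⟨k, hk, hyk⟩ := mem_iUnion₂.1 hy2
    rw [Finset.mem_sdiff] at hk
    have h1 : ⋃ i ∈ insert k s, D i = (⋃ i ∈ s, D i) ∪ D k := by
      rw [Finset.set_biUnion_insert, union_comm]
    have hins : insert k s ⊆ t := Finset.insert_subset hk.1 hst
    have hDk : D k ⊆ Ω := by rw [hcover]; exact subset_biUnion_of_mem (u := D) hk.1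
    have h2 := hmax (insert k s) ⟨hins, Finset.mem_insert_of_mem hi₀s, by
      rw [h1]
      exact hunion _ _ (hop s hst) (hopen k hk.1) (hsub s hst) hDk ⟨y, hy1, hyk⟩ hPs (hP k hk.1)⟩
    rw [Finset.card_insert_of_notMem hk.2] at h2
    omega
  have hle : Ω ⊆ ⋃ i ∈ s, D i := by
    refine hΩ.subset_left_of_subset_union (hop s hst) (hop _ Finset.sdiff_subset) hdisj ?_
      ⟨x, hx, mem_biUnion (by exact_mod_cast hi₀s) hxi⟩
    conv_lhs => rw [hcover]
    rw [← Finset.set_biUnion_union, Finset.union_sdiff_of_subset hst]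
  rwa [Subset.antisymm (hsub s hst) hle] at hPs

/-! ### Lipschitz graphs -/

/-- The component of `y` orthogonal to the unit vector `e`. -/
def flat (e y : Sp d) : Sp d := y - ⟪e, y⟫ • e

/-- The open cylinder with axis `e` around `x`. -/
def cyl (e x : Sp d) (δ h : ℝ) : Set (Sp d) :=
  {y | ‖flat e (y - x)‖ < δ ∧ |⟪e, y - x⟫| < h}

theorem continuous_flat (e : Sp d) : Continuous (flat e) := by
  unfold flat; fun_prop

theorem flat_sub (e y z : Sp d) : flat e (y - z) = flat e y - flat e z := by
  simp only [flat, inner_sub_right, sub_smul]; abel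

theorem flat_add (e y z : Sp d) : flat e (y + z) = flat e y + flat e z := by
  simp only [flat, inner_add_right, add_smul]; abel

theorem flat_smul (e y : Sp d) (t : ℝ) : flat e (t • y) = t • flat e y := by
  simp only [flat, inner_smul_right, smul_sub, smul_smul]

theorem flat_self {e : Sp d} (he : ‖e‖ = 1) : flat e e = 0 := by
  simp [flat, he]

theorem flat_neg_left (e y : Sp d) : flat (-e) y = flat e y := by
  simp [flat]

theorem isOpen_cyl (e x : Sp d) (δ h : ℝ) : IsOpen (cyl e x δ h) := by
  have := continuous_flat e
  have h1 : Continuous fun y => ‖flat e (y - x)‖ := by fun_prop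
  have h2 : Continuous fun y => |⟪e, y - x⟫| := by fun_prop
  exact (isOpen_lt h1 continuous_const).inter (isOpen_lt h2 continuous_const)

theorem cyl_neg (e x : Sp d) (δ h : ℝ) : cyl (-e) x δ h = cyl e x δ h := by
  simp [cyl, flat_neg_left]

theorem self_mem_cyl {e x : Sp d} {δ h : ℝ} (hδ : 0 < δ) (hh : 0 < h) : x ∈ cyl e x δ h := by
  simp [cyl, flat, hδ, hh]

theorem cyl_subset_ball {e x : Sp d} {δ h r : ℝ} (he : ‖e‖ = 1) (hr : δ + h ≤ r) :
    cyl e x δ h ⊆ Metric.ball x r := by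
  rintro y ⟨h1, h2⟩
  rw [mem_ball_iff_norm]
  have : y - x = flat e (y - x) + ⟪e, y - x⟫ • e := by simp [flat]
  calc ‖y - x‖ ≤ ‖flat e (y - x)‖ + ‖⟪e, y - x⟫ • e‖ := by
        conv_lhs => rw [this]
        exact norm_add_le _ _
    _ < δ + h := by
        rw [norm_smul, he, mul_one, Real.norm_eq_abs]
        linarith
    _ ≤ r := hr

/-- In a thin cylinder around a point of a Lipschitz graph, the part above the graph is star-shaped
with respect to the points in the upper quarter. -/
theorem starShaped_epigraph {e x : Sp d} {K : NNReal} {γ : Sp d → ℝ}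
    (hγ : LipschitzWith K γ) (hx : γ (flat e x) = ⟪e, x⟫) {δ h : ℝ} (hh : 0 < h)
    (hδ : 8 * (K * δ) ≤ h) :
    ∀ y ∈ cyl e x δ h ∩ {y | γ (flat e y) < ⟪e, y⟫},
      ∀ z ∈ cyl e x δ h ∩ {z | h / 2 < ⟪e, z - x⟫},
        segment ℝ y z ⊆ cyl e x δ h ∩ {y | γ (flat e y) < ⟪e, y⟫} := by
  rintro y ⟨⟨hy1, hy2⟩, hy3⟩ z ⟨⟨hz1, hz2⟩, hz3⟩ w ⟨s, t, hs, ht, hst, rfl⟩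
  simp only [mem_ofPred_eq] at hy3 hz3
  have hK : (0 : ℝ) ≤ K := K.2
  have hs' : s = 1 - t := by linarith
  subst hs'
  have ew : (1 - t) • y + t • z - x = (1 - t) • (y - x) + t • (z - x) := by module
  have f1 : ‖flat e ((1 - t) • y + t • z - x)‖ < δ := by
    rw [ew, flat_add, flat_smul, flat_smul]
    calc _ ≤ (1 - t) * ‖flat e (y - x)‖ + t * ‖flat e (z - x)‖ := by
          refine (norm_add_le _ _).trans (le_of_eq ?_)
          rw [norm_smul, norm_smul, Real.norm_of_nonneg hs, Real.norm_of_nonneg ht]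
      _ < δ := by
          rcases ht.eq_or_lt with h0 | h0
          · rw [← h0]; simpa using hy1
          · nlinarith
  have f2 : ⟪e, (1 - t) • y + t • z - x⟫ = (1 - t) * ⟪e, y - x⟫ + t * ⟪e, z - x⟫ := by
    rw [ew, inner_add_right, inner_smul_right, inner_smul_right]
  have f3 : |⟪e, (1 - t) • y + t • z - x⟫| < h := by
    rw [abs_lt] at hy2 hz2 ⊢
    rw [f2]
    rcases ht.eq_or_lt with h0 | h0
    · rw [← h0]; simpa using hy2
    · constructor <;> nlinarith
  refine ⟨⟨f1, f3⟩, ?_⟩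
  simp only [mem_ofPred_eq]
  have hlip : ∀ p q : Sp d, |γ p - γ q| ≤ K * ‖p - q‖ := fun p q => by
    have := hγ.dist_le_mul p q
    rwa [Real.dist_eq, dist_eq_norm] at this
  have ex : ∀ p : Sp d, ⟪e, p - x⟫ = ⟪e, p⟫ - ⟪e, x⟫ := fun p => inner_sub_right _ _ _
  set w := (1 - t) • y + t • z with hw
  rcases le_or_gt (h / 4) ⟪e, y - x⟫ with hcase | hcase
  · have g1 := hlip (flat e w) (flat e x)
    rw [← flat_sub, hx] at g1
    have g2 : K * ‖flat e (w - x)‖ ≤ K * δ := by gcongr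
    have g3 : h / 4 ≤ ⟪e, w - x⟫ := by
      rw [f2]; nlinarith
    rw [ex] at g3
    have := (abs_le.1 g1).2
    linarith
  · have g1 := hlip (flat e w) (flat e y)
    have g2 : flat e w - flat e y = t • (flat e (z - x) - flat e (y - x)) := by
      rw [← flat_sub, ← flat_sub, ← flat_smul]
      congr 1
      rw [hw]; module
    have g3 : ‖flat e w - flat e y‖ ≤ t * (2 * δ) := by
      rw [g2, norm_smul, Real.norm_of_nonneg ht]
      gcongr
      refine (norm_sub_le _ _).trans (by linarith)
    have g4 : K * ‖flat e w - flat e y‖ ≤ K * (t * (2 * δ)) := by gcongr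
    have g5 := (abs_le.1 (g1.trans g4)).2
    have g6 : ⟪e, w⟫ = ⟪e, y⟫ + t * (⟪e, z - x⟫ - ⟪e, y - x⟫) := by
      rw [hw, inner_add_right, inner_smul_right, inner_smul_right, ex, ex]; ring
    rw [g6]
    have : t * (h / 4) ≤ t * (⟪e, z - x⟫ - ⟪e, y - x⟫) := by gcongr; linarith
    nlinarith

/-- The upper quarter of the cylinder lies above the graph, and is not empty. -/
theorem upper_subset_epigraph {e x : Sp d} {K : NNReal} {γ : Sp d → ℝ}
    (hγ : LipschitzWith K γ) (hx : γ (flat e x) = ⟪e, x⟫) {δ h : ℝ} (hh : 0 < h)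
    (hδ : 8 * (K * δ) ≤ h) :
    cyl e x δ h ∩ {z | h / 2 < ⟪e, z - x⟫} ⊆ cyl e x δ h ∩ {y | γ (flat e y) < ⟪e, y⟫} := by
  rintro z ⟨⟨hz1, hz2⟩, hz3⟩
  refine ⟨⟨hz1, hz2⟩, ?_⟩
  simp only [mem_ofPred_eq] at hz3 ⊢
  have hK : (0 : ℝ) ≤ K := K.2
  have := hγ.dist_le_mul (flat e z) (flat e x)
  rw [Real.dist_eq, dist_eq_norm, ← flat_sub, hx] at this
  have g2 : K * ‖flat e (z - x)‖ ≤ K * δ := by gcongr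
  have g3 := (abs_le.1 this).2
  rw [inner_sub_right] at hz3
  linarith

theorem upper_nonempty {e x : Sp d} (he : ‖e‖ = 1) {δ h : ℝ} (hh : 0 < h) (hδ : 0 < δ) :
    (cyl e x δ h ∩ {z | h / 2 < ⟪e, z - x⟫}).Nonempty := by
  refine ⟨x + (3 / 4 * h) • e, ⟨?_, ?_⟩, ?_⟩
  · rw [add_sub_cancel_left, flat_smul, flat_self he]; simpa using hδ
  · rw [add_sub_cancel_left, inner_smul_right, real_inner_self_eq_norm_sq, he,
      abs_of_pos (by positivity)]
    linarith
  · simp only [mem_ofPred_eq]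
    rw [add_sub_cancel_left, inner_smul_right, real_inner_self_eq_norm_sq, he]
    linarith

theorem isOpen_upper (e x : Sp d) (δ h : ℝ) :
    IsOpen (cyl e x δ h ∩ {z | h / 2 < ⟪e, z - x⟫}) :=
  (isOpen_cyl e x δ h).inter (isOpen_lt (by fun_prop) (by fun_prop))

/-- A boundary point of a Lipschitz domain, seen in a thin cylinder. -/
structure GraphChart (Ω : Set (Sp d)) (x : Sp d) (r : ℝ) where
  e : Sp d
  K : NNReal
  γ : Sp d → ℝ
  δ : ℝ
  h : ℝ
  norm_e : ‖e‖ = 1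
  δ_pos : 0 < δ
  h_pos : 0 < h
  thin : 8 * (K * δ) ≤ h
  lip : LipschitzWith K γ
  on_graph : γ (flat e x) = ⟪e, x⟫
  subset_ball : cyl e x δ h ⊆ Metric.ball x r
  mem_iff : ∀ y ∈ cyl e x δ h, y ∈ Ω ↔ γ (flat e y) < ⟪e, y⟫

theorem exists_graphChart {Ω : Set (Sp d)} (hΩ : IsOpen Ω) (hL : HasLipschitzBoundary Ω)
    {x : Sp d} (hx : x ∈ frontier Ω) {r : ℝ} (hr : 0 < r) : Nonempty (GraphChart Ω x r) := by
  obtain ⟨e, r₀, K, γ, he, hr₀, hγ, hmem⟩ := hL x hx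
  have hmem' : ∀ y ∈ Metric.ball x r₀, y ∈ Ω ↔ γ (flat e y) < ⟪e, y⟫ := hmem
  have hcont : Continuous fun y => γ (flat e y) := hγ.continuous.comp (continuous_flat e)
  have hgraph : γ (flat e x) = ⟪e, x⟫ := by
    rw [hΩ.frontier_eq] at hx
    refine le_antisymm ?_ ?_
    · have h1 : x ∈ closure (Metric.ball x r₀ ∩ Ω) :=
        Metric.isOpen_ball.inter_closure ⟨Metric.mem_ball_self hr₀, hx.1⟩
      have h2 : closure (Metric.ball x r₀ ∩ Ω) ⊆ {y | γ (flat e y) ≤ ⟪e, y⟫} :=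
        closure_minimal (fun y hy => ((hmem' y hy.1).1 hy.2).le)
          (isClosed_le hcont (by fun_prop))
      exact h2 h1
    · by_contra hcon
      exact hx.2 ((hmem' x (Metric.mem_ball_self hr₀)).2 (not_le.1 hcon))
  set m := min r r₀ with hm
  have hm0 : 0 < m := lt_min hr hr₀
  have hK : (0 : ℝ) ≤ K := K.2
  have hsub : cyl e x (m / 2 / (8 * (K + 1))) (m / 2) ⊆ Metric.ball x m := by
    refine cyl_subset_ball he ?_
    have : m / 2 / (8 * (K + 1)) ≤ m / 2 := div_le_self (by positivity) (by linarith)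
    linarith
  refine ⟨⟨e, K, γ, m / 2 / (8 * (K + 1)), m / 2, he, by positivity, by positivity, ?_, hγ, hgraph,
    hsub.trans (Metric.ball_subset_ball (min_le_left _ _)), fun y hy => hmem' y
      ((hsub.trans (Metric.ball_subset_ball (min_le_right _ _))) hy)⟩⟩
  have : 8 * (K * (m / 2 / (8 * (K + 1)))) = K / (K + 1) * (m / 2) := by field_simp
  rw [this]
  have : (K : ℝ) / (K + 1) ≤ 1 := by rw [div_le_one (by positivity)]; linarith
  nlinarith

namespace GraphChart

variable {Ω : Set (Sp d)} {x : Sp d} {r : ℝ} (c : GraphChart Ω x r)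

/-- The cylinder of the chart. -/
def O : Set (Sp d) := cyl c.e x c.δ c.h

/-- The part of the cylinder below the graph. -/
def below : Set (Sp d) := c.O ∩ {y | ⟪c.e, y⟫ < c.γ (flat c.e y)}

theorem isOpen_O : IsOpen c.O := isOpen_cyl _ _ _ _

theorem mem_O : x ∈ c.O := self_mem_cyl c.δ_pos c.h_pos

theorem isOpen_below : IsOpen c.below :=
  c.isOpen_O.inter (isOpen_lt (by fun_prop) (c.lip.continuous.comp (continuous_flat _)))

theorem inter_eq : c.O ∩ Ω = c.O ∩ {y | c.γ (flat c.e y) < ⟪c.e, y⟫} := by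
  ext y
  refine ⟨fun h => ⟨h.1, (c.mem_iff y h.1).1 h.2⟩, fun h => ⟨h.1, (c.mem_iff y h.1).2 h.2⟩⟩

/-- Turning the cylinder upside down exchanges the two sides of the graph. -/
theorem below_eq : c.below =
    cyl (-c.e) x c.δ c.h ∩ {y | (-c.γ) (flat (-c.e) y) < ⟪-c.e, y⟫} := by
  rw [cyl_neg]
  ext y
  simp [below, O, flat_neg_left]

theorem lip_neg : LipschitzWith c.K (-c.γ) := c.lip.neg

theorem on_graph_neg : (-c.γ) (flat (-c.e) x) = ⟪-c.e, x⟫ := by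
  simp [flat_neg_left, c.on_graph]

theorem below_nonempty : c.below.Nonempty := by
  rw [c.below_eq]
  exact (upper_nonempty (by simpa using c.norm_e) c.h_pos c.δ_pos).mono
    (upper_subset_epigraph c.lip_neg c.on_graph_neg c.h_pos c.thin)

theorem isPreconnected_below : IsPreconnected c.below := by
  obtain ⟨z, hz⟩ := upper_nonempty (e := -c.e) (x := x) (by simpa using c.norm_e) c.h_pos c.δ_pos
  have hsub := upper_subset_epigraph c.lip_neg c.on_graph_neg c.h_pos c.thin hz
  rw [c.below_eq]
  refine (StarConvex.isPathConnected (a := z) ?_ hsub).isConnected.isPreconnected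
  rw [starConvex_iff_segment_subset]
  intro y hy
  rw [segment_symm]
  exact starShaped_epigraph c.lip_neg c.on_graph_neg c.h_pos c.thin y hy z hz

theorem disjoint_below : Disjoint c.below Ω :=
  Set.disjoint_left.2 fun y hy hyΩ => lt_asymm hy.2 ((c.mem_iff y hy.1).1 hyΩ)

theorem oscBound : OscBound Ω (c.O ∩ Ω) := by
  refine OscBound.mono inter_subset_right ?_
  rw [c.inter_eq]
  have hcont := c.lip.continuous.comp (continuous_flat c.e)
  refine oscBound_of_starShaped (c.isOpen_O.inter (isOpen_lt hcont (by fun_prop)))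
    ((Metric.isBounded_ball (x := x) (r := r)).subset (inter_subset_left.trans c.subset_ball))
    (isOpen_upper c.e x c.δ c.h) (upper_nonempty c.norm_e c.h_pos c.δ_pos)
    (upper_subset_epigraph c.lip c.on_graph c.h_pos c.thin)
    (starShaped_epigraph c.lip c.on_graph c.h_pos c.thin)

end GraphChart

theorem oscBound_ball (x : Sp d) {r : ℝ} (hr : 0 < r) :
    OscBound (Metric.ball x r) (Metric.ball x r) :=
  oscBound_of_starShaped Metric.isOpen_ball Metric.isBounded_ball Metric.isOpen_ball
    (Metric.nonempty_ball.2 hr) Subset.rfl fun _ hy _ hz => (convex_ball x r).segment_subset hy hz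

/-- The Nečas inequality on bounded connected Lipschitz domains. -/
theorem oscBound_of_lipschitz {Ω : Set (Sp d)} (hΩ : IsOpen Ω) (hc : IsConnected Ω)
    (hb : Bornology.IsBounded Ω) (hL : HasLipschitzBoundary Ω) : OscBound Ω Ω := by
  have hloc : ∀ x ∈ closure Ω, ∃ O : Set (Sp d), IsOpen O ∧ x ∈ O ∧ OscBound Ω (O ∩ Ω) := by
    intro x hx
    by_cases hxΩ : x ∈ Ω
    · obtain ⟨r, hr, hball⟩ := Metric.isOpen_iff.1 hΩ x hxΩ
      refine ⟨Metric.ball x r, Metric.isOpen_ball, Metric.mem_ball_self hr, ?_⟩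
      rw [inter_eq_left.2 hball]
      exact (oscBound_ball x hr).mono hball
    · have hxf : x ∈ frontier Ω := by rw [hΩ.frontier_eq]; exact ⟨hx, hxΩ⟩
      obtain ⟨c⟩ := exists_graphChart hΩ hL hxf one_pos
      exact ⟨c.O, c.isOpen_O, c.mem_O, c.oscBound⟩
  choose! O hO hxO hosc using hloc
  obtain ⟨t, ht, hcover⟩ := hb.isCompact_closure.elim_nhds_subcover O
    fun x hx => (hO x hx).mem_nhds (hxO x hx)
  refine of_finite_cover (P := OscBound Ω) hc.isPreconnected hc.nonempty t (fun x => O x ∩ Ω)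
    (fun x hx => (hO x (ht x hx)).inter hΩ) ?_ (fun x hx => hosc x (ht x hx))
    fun A B hA hB hAΩ hBΩ hne h1 h2 => h1.union hb hA hB hAΩ hBΩ hne h2
  ext y
  simp only [mem_iUnion, mem_inter_iff, exists_prop]
  refine ⟨fun hy => ?_, fun ⟨x, _, _, hy⟩ => hy⟩
  obtain ⟨x, hx, hyx⟩ := mem_iUnion₂.1 (hcover (subset_closure hy))
  exact ⟨x, hx, hyx, hy⟩

/-- Near a boundary point of a Lipschitz domain there are test functions that detect the
boundary: otherwise the indicator of `Ω` would be locally constant there. -/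
theorem exists_setIntegral_pd_ne_zero {Ω : Set (Sp d)} (hΩ : IsOpen Ω)
    (hL : HasLipschitzBoundary Ω) {x : Sp d} (hx : x ∈ frontier Ω) {r : ℝ} (hr : 0 < r) :
    ∃ ψ, IsTest ψ ∧ tsupport ψ ⊆ Metric.ball x r ∧ ∃ j, ∫ y in Ω, pd j ψ y ≠ 0 := by
  by_contra! hcon
  obtain ⟨c⟩ := exists_graphChart hΩ hL hx hr
  set U := Metric.ball x r with hU
  have hUo : IsOpen U := Metric.isOpen_ball
  have hfin : IsFiniteMeasure (volume.restrict U) := ⟨by simpa using measure_ball_lt_top⟩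
  obtain ⟨C, hC, hosc⟩ := oscBound_ball x hr
  obtain ⟨a, ha⟩ := hosc (Ω.indicator fun _ => (1 : ℝ))
    (((memLp_const (1 : ℝ)).indicator hΩ.measurableSet)) 0 le_rfl fun φ hφ hsub j => by
      have h1 : ∫ y in U, Ω.indicator (fun _ => (1 : ℝ)) y * pd j φ y = ∫ y in Ω, pd j φ y := by
        rw [setIntegral_eq_of_tsupport_subset ((tsupport_pd_subset φ j).trans hsub)
          fun y hy => by rw [hy, mul_zero], ← integral_indicator hΩ.measurableSet]
        congr 1
        ext y
        by_cases hy : y ∈ Ω <;> simp [hy]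
      rw [h1, hcon φ hφ hsub j]
      simp
  rw [mul_zero] at ha
  have hint : IntegrableOn (fun y => (Ω.indicator (fun _ => (1 : ℝ)) y - a) ^ 2) U :=
    ((((memLp_const (1 : ℝ)).indicator hΩ.measurableSet)).sub (memLp_const a)).integrable_sq
  have hzero : ∀ S : Set (Sp d), IsOpen S → S ⊆ U → S.Nonempty → ∀ b : ℝ,
      (∀ y ∈ S, Ω.indicator (fun _ => (1 : ℝ)) y = b) → a = b := by
    intro S hS hSU hSne b hb
    have hpos : 0 < volume.real S := ENNReal.toReal_pos (hS.measure_pos volume hSne).ne'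
      ((measure_mono hSU).trans_lt measure_ball_lt_top).ne
    have h1 : ∫ y in S, (Ω.indicator (fun _ => (1 : ℝ)) y - a) ^ 2 ≤ 0 := by
      refine le_trans ?_ ha
      exact setIntegral_mono_set hint (Eventually.of_forall fun _ => sq_nonneg _)
        hSU.eventuallyLE
    rw [setIntegral_congr_fun (g := fun _ => (b - a) ^ 2) hS.measurableSet
      fun y hy => by simp only [hb y hy], setIntegral_const, smul_eq_mul] at h1
    have h2 : (b - a) ^ 2 ≤ 0 := by
      by_contra h
      nlinarith [not_le.1 h]
    nlinarith [sq_nonneg (b - a), pow_eq_zero_iff (two_ne_zero) |>.1 (le_antisymm h2 (sq_nonneg _))]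
  have ha1 : a = 1 := hzero (U ∩ Ω) (hUo.inter hΩ) inter_subset_left (by
    obtain ⟨y, hy⟩ := mem_closure_iff_nhds.1 (frontier_subset_closure hx) U
      (Metric.ball_mem_nhds x hr)
    exact ⟨y, hy⟩) 1 fun y hy => by simp [hy.2]
  have ha0 : a = 0 := hzero c.below c.isOpen_below
    ((inter_subset_left).trans c.subset_ball) c.below_nonempty 0 fun y hy => by
      simp [Set.disjoint_left.1 c.disjoint_below hy]
  linarith

/-! ### Polyhedral boundaries -/

theorem hyperplane_subset {n : Sp d} (hn : n ≠ 0) (b : ℝ) :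
    {x : Sp d | ⟪n, x⟫ = b} ⊆ (fun w : (ℝ ∙ n)ᗮ => (b / ‖n‖ ^ 2) • n + (w : Sp d)) '' univ := by
  intro x hx
  have hn' : ‖n‖ ^ 2 ≠ 0 := by positivity
  refine ⟨⟨x - (b / ‖n‖ ^ 2) • n, ?_⟩, mem_univ _, by simp⟩
  rw [Submodule.mem_orthogonal_singleton_iff_inner_right, inner_sub_right, inner_smul_right,
    real_inner_self_eq_norm_sq, show ⟪n, x⟫ = b from hx]
  field_simp
  ring

theorem volume_frontier_eq_zero {Ω : Set (Sp d)} (h : HasPolyhedralBoundary Ω) :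
    volume (frontier Ω) = 0 := by
  obtain ⟨S, hS, hcov⟩ := h
  have hsub : frontier Ω ⊆ ⋃ h ∈ S, {x : Sp d | ⟪h.1, x⟫ = h.2} := fun x hx => by
    obtain ⟨h, hh, hx⟩ := hcov x hx
    exact mem_biUnion (x := h) hh hx
  refine measure_mono_null hsub ((measure_biUnion_null_iff S.countable_toSet).2 fun h hh => ?_)
  set W : Submodule ℝ (Sp d) := (ℝ ∙ h.1)ᗮ with hW
  set p := (h.2 / ‖h.1‖ ^ 2) • h.1
  refine measure_mono_null (t := (AffineSubspace.mk' p W : Set (Sp d))) ?_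
    (Measure.addHaar_affineSubspace volume _ fun htop => ?_)
  · refine (hyperplane_subset (hS h hh) h.2).trans ?_
    rintro _ ⟨w, -, rfl⟩
    simp [p]
  · have h1 := congrArg AffineSubspace.direction htop
    rw [AffineSubspace.direction_mk', AffineSubspace.direction_top] at h1
    have h2 : h.1 ∈ W := h1 ▸ Submodule.mem_top
    rw [hW, Submodule.mem_orthogonal_singleton_iff_inner_right] at h2
    exact hS h hh (inner_self_eq_zero.1 h2)

theorem surf_frontier_lt_top {Ω : Set (Sp d)} (hd : 1 ≤ d) (hb : Bornology.IsBounded Ω)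
    (h : HasPolyhedralBoundary Ω) : surf d (frontier Ω) < ⊤ := by
  obtain ⟨S, hS, hcov⟩ := h
  have hsub : frontier Ω ⊆ ⋃ h ∈ S, ({x : Sp d | ⟪h.1, x⟫ = h.2} ∩ frontier Ω) := fun x hx => by
    obtain ⟨h, hh, hx'⟩ := hcov x hx
    exact mem_biUnion (x := h) hh ⟨hx', hx⟩
  refine (measure_mono hsub).trans_lt (measure_biUnion_lt_top S.finite_toSet fun h hh => ?_)
  have hn := hS h hh
  set f : (ℝ ∙ h.1)ᗮ → Sp d := fun w => (h.2 / ‖h.1‖ ^ 2) • h.1 + (w : Sp d) with hf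
  have hiso : Isometry f := (isometry_add_left _).comp isometry_subtype_coe
  have hbf : Bornology.IsBounded (frontier Ω) := hb.closure.subset frontier_subset_closure
  have hpre : Bornology.IsBounded (f ⁻¹' frontier Ω) := hiso.antilipschitz.isBounded_preimage hbf
  have himg : {x : Sp d | ⟪h.1, x⟫ = h.2} ∩ frontier Ω ⊆ f '' (f ⁻¹' frontier Ω) := by
    rintro x ⟨hx1, hx2⟩
    obtain ⟨w, -, rfl⟩ := hyperplane_subset hn h.2 hx1
    exact ⟨w, hx2, rfl⟩
  refine (measure_mono himg).trans_lt ?_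
  have hfact : Fact (Module.finrank ℝ (Sp d) = (d - 1) + 1) :=
    ⟨by rw [finrank_euclideanSpace_fin]; omega⟩
  have hrank : Module.finrank ℝ (ℝ ∙ h.1)ᗮ = d - 1 :=
    Submodule.finrank_orthogonal_span_singleton hn
  have hvol : (Measure.euclideanHausdorffMeasure (d - 1) : Measure (ℝ ∙ h.1)ᗮ) = volume := by
    rw [← hrank]; exact InnerProductSpace.euclideanHausdorffMeasure_eq_volume
  rw [surf, hiso.euclideanHausdorffMeasure_image, hvol]
  exact hpre.measure_lt_top

/-! ### Inequalities of Korn and Poincaré -/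

theorem setIntegral_sq_le {Ω : Set (Sp d)} {φ : Sp d → ℝ} (hφ : IsTest φ) :
    ∫ x in Ω, φ x ^ 2 ≤ ∫ x, φ x ^ 2 :=
  setIntegral_le_integral (hφ.memLp (p := 2) volume).integrable_sq
    (Eventually.of_forall fun _ => sq_nonneg _)

theorem integral_pd_sq_le_sum {φ : Sp d → ℝ} (hφ : IsTest φ) (j : Fin d) :
    ∫ x, pd j φ x ^ 2 ≤ ∫ x, ∑ k, pd k φ x ^ 2 := by
  have hi := fun k => ((hφ.pd k).memLp (p := 2) volume).integrable_sq
  refine integral_mono (hi j) (integrable_finsetSum _ fun k _ => hi k) fun x => ?_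
  exact Finset.single_le_sum (f := fun k => pd k φ x ^ 2) (fun k _ => sq_nonneg _)
    (Finset.mem_univ j)

/-- The weak form of `∂ⱼ∂ₖuᵢ = ∂ⱼεᵢₖ + ∂ₖεᵢⱼ - ∂ᵢεⱼₖ`. -/
theorem integral_Du_mul_pd {Ω : Set (Sp d)} {u : Sp d → Sp d}
    {Du : Sp d → Matrix (Fin d) (Fin d) ℝ} (h : MemH1 Ω u Du) {φ : Sp d → ℝ} (hφ : IsTest φ)
    (hsub : tsupport φ ⊆ Ω) (i k j : Fin d) :
    ∫ x in Ω, Du x i k * pd j φ x = (∫ x in Ω, strain (Du x) i k * pd j φ x) +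
      (∫ x in Ω, strain (Du x) i j * pd k φ x) - ∫ x in Ω, strain (Du x) j k * pd i φ x := by
  obtain ⟨-, hD, hw⟩ := h
  have hi : ∀ a b c, Integrable (fun x => Du x a b * pd c φ x) (volume.restrict Ω) :=
    fun a b c => (hD a b).integrable_mul ((hφ.pd c).memLp (p := 2) _)
  have hE : ∀ a b c, ∫ x in Ω, strain (Du x) a b * pd c φ x =
      1 / 2 * ((∫ x in Ω, Du x a b * pd c φ x) + ∫ x in Ω, Du x b a * pd c φ x) := by
    intro a b c
    rw [← integral_add (hi a b c) (hi b a c), ← integral_const_mul]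
    congr 1
    ext x
    simp [strain]
    ring
  have hsymm : ∀ a b c, ∫ x in Ω, Du x a b * pd c φ x = ∫ x in Ω, Du x a c * pd b φ x := by
    intro a b c
    have h1 := hw a b (pd c φ) (hφ.pd c) ((tsupport_pd_subset φ c).trans hsub)
    have h2 := hw a c (pd b φ) (hφ.pd b) ((tsupport_pd_subset φ b).trans hsub)
    have h3 : ∫ x in Ω, u x a * pd b (pd c φ) x = ∫ x in Ω, u x a * pd c (pd b φ) x := by
      congr 1
      ext x
      rw [pd_comm hφ.1 b c x]
    linarith
  rw [hE, hE, hE, hsymm i j k, hsymm k i j, hsymm j i k]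
  ring

theorem integral_frob_eq {Ω : Set (Sp d)} {A : Sp d → Matrix (Fin d) (Fin d) ℝ}
    (hA : ∀ i j, MemLp (fun x => A x i j) 2 (volume.restrict Ω)) :
    ∫ x in Ω, frob (A x) (A x) = ∑ i, ∑ j, ∫ x in Ω, A x i j ^ 2 := by
  simp only [frob, ← sq]
  rw [integral_finsetSum _ fun i _ => integrable_finsetSum _ fun j _ => (hA i j).integrable_sq]
  refine Finset.sum_congr rfl fun i _ => ?_
  rw [integral_finsetSum _ fun j _ => (hA i j).integrable_sq]

theorem memLp_strain {Ω : Set (Sp d)} {A : Sp d → Matrix (Fin d) (Fin d) ℝ}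
    (hA : ∀ i j, MemLp (fun x => A x i j) 2 (volume.restrict Ω)) (i j : Fin d) :
    MemLp (fun x => strain (A x) i j) 2 (volume.restrict Ω) := by
  have := ((hA i j).add (hA j i)).const_mul (1 / 2)
  refine this.congr_norm ?_ ?_
  · refine AEStronglyMeasurable.congr this.1 (Eventually.of_forall fun x => ?_)
    simp [strain]
  · exact Eventually.of_forall fun x => by simp [strain]

/-- **Korn's second inequality**: every derivative of the gradient is a combination of derivatives
of the strain, so that the Nečas inequality bounds the gradient by the strain up to constants. -/
theorem korn {Ω : Set (Sp d)} (hosc : OscBound Ω Ω) (hΩ : IsOpen Ω) (hne : Ω.Nonempty)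
    (hb : Bornology.IsBounded Ω) : ∃ C : ℝ, 0 ≤ C ∧ ∀ (u : Sp d → Sp d)
      (Du : Sp d → Matrix (Fin d) (Fin d) ℝ), MemH1 Ω u Du →
      ∫ x in Ω, frob (Du x) (Du x) ≤
        C * ((∫ x in Ω, frob (strain (Du x)) (strain (Du x))) + ∫ x in Ω, ‖u x‖ ^ 2) := by
  obtain ⟨C₀, hC₀, hosc⟩ := hosc
  obtain ⟨χ, hχ, hχΩ, -, hχ1⟩ := exists_isTest_integral_eq_one hΩ hne
  have hfin : IsFiniteMeasure (volume.restrict Ω) := ⟨by simpa using hb.measure_lt_top⟩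
  set X := ∫ x, χ x ^ 2 with hX
  set Y := ∫ x, ∑ k, pd k χ x ^ 2 with hY
  set v := volume.real Ω with hv
  have hX0 : 0 ≤ X := integral_nonneg fun _ => sq_nonneg _
  have hY0 : 0 ≤ Y := integral_nonneg fun _ => Finset.sum_nonneg fun _ _ => sq_nonneg _
  have hv0 : 0 ≤ v := measureReal_nonneg
  refine ⟨d * (d * (2 * (C₀ * 9) + 2 * ((2 * Y + 2 * (C₀ * 9 * X)) * v))), by positivity,
    fun u Du hu => ?_⟩
  have hS := memLp_strain hu.2.1
  set S := ∫ x in Ω, frob (strain (Du x)) (strain (Du x)) with hSdef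
  set U := ∫ x in Ω, ‖u x‖ ^ 2 with hU
  have hScomp : ∀ a b, ∫ x in Ω, strain (Du x) a b ^ 2 ≤ S := by
    intro a b
    rw [hSdef, integral_frob_eq hS]
    have h0 : ∀ i j, 0 ≤ ∫ x in Ω, strain (Du x) i j ^ 2 :=
      fun i j => integral_nonneg fun _ => sq_nonneg _
    calc _ ≤ ∑ j, ∫ x in Ω, strain (Du x) a j ^ 2 :=
          Finset.single_le_sum (f := fun j => ∫ x in Ω, strain (Du x) a j ^ 2)
            (fun j _ => h0 a j) (Finset.mem_univ b)
      _ ≤ _ := Finset.single_le_sum (f := fun i => ∑ j, ∫ x in Ω, strain (Du x) i j ^ 2)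
            (fun i _ => Finset.sum_nonneg fun j _ => h0 i j) (Finset.mem_univ a)
  have hS0 : 0 ≤ S := integral_nonneg fun x =>
    Finset.sum_nonneg fun i _ => Finset.sum_nonneg fun j _ => mul_self_nonneg _
  have hU0 : 0 ≤ U := integral_nonneg fun _ => sq_nonneg _
  have hui : ∀ i, MemLp (fun x => u x i) 2 (volume.restrict Ω) := fun i =>
    hu.1.continuousLinearMap_comp (EuclideanSpace.proj i : Sp d →L[ℝ] ℝ)
  have huU : ∀ i, ∫ x in Ω, u x i ^ 2 ≤ U := by
    intro i
    refine integral_mono (hui i).integrable_sq (hu.1.integrable_norm_pow (by norm_num)) fun x => ?_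
    simp only
    rw [← sq_abs]
    gcongr
    exact PiLp.norm_apply_le (u x) i
  have hneg : ∀ i k, NegBound Ω (fun x => Du x i k) (9 * S) := by
    intro i k φ hφ hsub j
    rw [integral_Du_mul_pd hu hφ hsub]
    set P := ∫ x, ∑ k, pd k φ x ^ 2
    have hE : ∀ a b c, (∫ x in Ω, strain (Du x) a b * pd c φ x) ^ 2 ≤ S * P := by
      intro a b c
      refine (sq_integral_mul_le (hS a b) ((hφ.pd c).memLp _)).trans ?_
      have h1 := (setIntegral_sq_le (Ω := Ω) (hφ.pd c)).trans (integral_pd_sq_le_sum hφ c)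
      exact mul_le_mul (hScomp a b) h1 (integral_nonneg fun _ => sq_nonneg _) hS0
    have h1 := hE i k j
    have h2 := hE i j k
    have h3 := hE j k i
    generalize (∫ x in Ω, strain (Du x) i k * pd j φ x) = e1 at *
    generalize (∫ x in Ω, strain (Du x) i j * pd k φ x) = e2 at *
    generalize (∫ x in Ω, strain (Du x) j k * pd i φ x) = e3 at *
    nlinarith [sq_nonneg (e1 - e2), sq_nonneg (e1 + e3), sq_nonneg (e2 + e3)]
  have hcomp : ∀ i k, ∫ x in Ω, Du x i k ^ 2 ≤
      (2 * (C₀ * 9) + 2 * ((2 * Y + 2 * (C₀ * 9 * X)) * v)) * (S + U) := by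
    intro i k
    have hD := hu.2.1 i k
    obtain ⟨a, ha⟩ := hosc (fun x => Du x i k) hD (9 * S) (by positivity) (hneg i k)
    have hDa : MemLp (fun x => Du x i k - a) 2 (volume.restrict Ω) := hD.sub (memLp_const a)
    have hχL : MemLp χ 2 (volume.restrict Ω) := hχ.memLp _
    have e1 : (∫ x in Ω, Du x i k * χ x) ^ 2 ≤ U * Y := by
      have h1 := hu.2.2 i k χ hχ hχΩ
      have h2 : (∫ x in Ω, Du x i k * χ x) = - ∫ x in Ω, u x i * pd k χ x := by linarith
      rw [h2, neg_sq]
      refine (sq_integral_mul_le (hui i) ((hχ.pd k).memLp _)).trans ?_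
      have h1 := (setIntegral_sq_le (Ω := Ω) (hχ.pd k)).trans (integral_pd_sq_le_sum hχ k)
      exact mul_le_mul (huU i) h1 (integral_nonneg fun _ => sq_nonneg _) hU0
    have e2 : (∫ x in Ω, (Du x i k - a) * χ x) ^ 2 ≤ C₀ * (9 * S) * X := by
      refine (sq_integral_mul_le hDa hχL).trans ?_
      exact mul_le_mul ha (setIntegral_sq_le hχ) (integral_nonneg fun _ => sq_nonneg _)
        (by positivity)
    have e3 : a = (∫ x in Ω, Du x i k * χ x) - ∫ x in Ω, (Du x i k - a) * χ x := by
      have h1 : ∫ x in Ω, χ x = 1 := by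
        rw [← hχ1]; exact setIntegral_eq_of_tsupport_subset hχΩ fun x hx => hx
      have i1 : Integrable (fun x => Du x i k * χ x) (volume.restrict Ω) :=
        hD.integrable_mul hχL
      have i2 : Integrable (fun x => (Du x i k - a) * χ x) (volume.restrict Ω) :=
        hDa.integrable_mul hχL
      have h2 := integral_sub i1 i2
      have h3 : (fun x => Du x i k * χ x - (Du x i k - a) * χ x) = fun x => a * χ x := by
        ext x; ring
      rw [h3, integral_const_mul, h1, mul_one] at h2
      exact h2
    have e4 : a ^ 2 ≤ 2 * (U * Y) + 2 * (C₀ * (9 * S) * X) := by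
      rw [e3]
      generalize (∫ x in Ω, Du x i k * χ x) = t1 at *
      generalize (∫ x in Ω, (Du x i k - a) * χ x) = t2 at *
      nlinarith [sq_nonneg (t1 + t2)]
    have e5 : ∫ x in Ω, Du x i k ^ 2 ≤ 2 * (∫ x in Ω, (Du x i k - a) ^ 2) + 2 * a ^ 2 * v := by
      have h1 : 2 * a ^ 2 * v = ∫ x in Ω, 2 * a ^ 2 := by
        rw [setIntegral_const, smul_eq_mul, mul_comm]
      rw [h1, ← integral_const_mul, ← integral_add (hDa.integrable_sq.const_mul 2)
        (integrable_const _)]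
      refine integral_mono hD.integrable_sq ((hDa.integrable_sq.const_mul 2).add
        (integrable_const _)) fun x => ?_
      simp only
      nlinarith [sq_nonneg (Du x i k - a - a)]
    calc _ ≤ 2 * (C₀ * (9 * S)) + 2 * (2 * (U * Y) + 2 * (C₀ * (9 * S) * X)) * v := by
          refine e5.trans ?_
          gcongr
      _ ≤ 2 * (C₀ * (9 * (S + U))) +
          2 * (2 * ((S + U) * Y) + 2 * (C₀ * (9 * (S + U)) * X)) * v := by
          gcongr <;> linarith
      _ = _ := by ring
  rw [integral_frob_eq hu.2.1]
  calc _ ≤ ∑ i : Fin d, ∑ j : Fin d,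
        (2 * (C₀ * 9) + 2 * ((2 * Y + 2 * (C₀ * 9 * X)) * v)) * (S + U) :=
        Finset.sum_le_sum fun i _ => Finset.sum_le_sum fun j _ => hcomp i j
    _ = _ := by
      simp
      ring

/-- The Poincaré inequality in one direction. -/
theorem poincare {φ : Sp d → ℝ} (hφ : IsTest φ) {R : ℝ}
    (hR : tsupport φ ⊆ Metric.closedBall 0 R) (j : Fin d) :
    ∫ x, φ x ^ 2 ≤ 4 * R ^ 2 * ∫ x, pd j φ x ^ 2 := by
  have hco : ContDiff ℝ ∞ fun z : Sp d => z j := (EuclideanSpace.proj j : Sp d →L[ℝ] ℝ).contDiff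
  have hxφ : IsTest fun x => x j * φ x := .mul_left hco hφ
  have hL := hφ.memLp (p := 2) volume
  have hLx := hxφ.memLp (p := 2) volume
  have hLp := (hφ.pd j).memLp (p := 2) volume
  -- integration of `∂ⱼ(xⱼ φ²)`
  have h1 : ∫ x, φ x ^ 2 = -2 * ∫ x, (x j * φ x) * pd j φ x := by
    have h2 := integral_mul_pd hxφ.1 hφ j
    have h3 : ∫ x, pd j (fun x => x j * φ x) x * φ x =
        (∫ x, (x j * φ x) * pd j φ x) + ∫ x, φ x ^ 2 := by
      have i1 : Integrable (fun x => x j * φ x * pd j φ x) volume := hLx.integrable_mul hLp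
      rw [← integral_add i1 hL.integrable_sq]
      congr 1
      ext x
      rw [pd_mul (hco.differentiable (by simp)) hφ.differentiable, pd_coord]
      simp
      ring
    linarith
  have h4 : ∫ x, (x j * φ x) ^ 2 ≤ R ^ 2 * ∫ x, φ x ^ 2 := by
    rw [← integral_const_mul]
    refine integral_mono hLx.integrable_sq (hL.integrable_sq.const_mul _) fun x => ?_
    simp only [mul_pow]
    by_cases hx : x ∈ tsupport φ
    · have h1 := hR hx
      rw [mem_closedBall_zero_iff] at h1
      have h2 := (PiLp.norm_apply_le x j).trans h1
      rw [Real.norm_eq_abs] at h2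
      gcongr ?_ * _
      exact sq_le_sq' (by linarith [neg_abs_le (x j)]) ((le_abs_self _).trans h2)
    · simp [image_eq_zero_of_notMem_tsupport hx]
  have h5 := sq_integral_mul_le hLx hLp
  have hA : 0 ≤ ∫ x, φ x ^ 2 := integral_nonneg fun _ => sq_nonneg _
  have hB : 0 ≤ ∫ x, pd j φ x ^ 2 := integral_nonneg fun _ => sq_nonneg _
  have h6 : (∫ x, φ x ^ 2) ^ 2 ≤ 4 * R ^ 2 * (∫ x, pd j φ x ^ 2) * ∫ x, φ x ^ 2 := by
    calc (∫ x, φ x ^ 2) ^ 2 = 4 * (∫ x, (x j * φ x) * pd j φ x) ^ 2 := by rw [h1]; ring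
      _ ≤ 4 * ((R ^ 2 * ∫ x, φ x ^ 2) * ∫ x, pd j φ x ^ 2) := by
          gcongr
          exact h5.trans (by gcongr)
      _ = _ := by ring
  rcases hA.eq_or_lt with h0 | h0
  · rw [← h0]; positivity
  · nlinarith

/-! ### The inf-sup condition of the divergence -/

/-- The mean value is the best constant in `L²`. -/
theorem integral_sq_eq_mean {Ω : Set (Sp d)} [IsFiniteMeasure (volume.restrict Ω)]
    (hv : volume.real Ω ≠ 0) {p : Sp d → ℝ} (hp : MemLp p 2 (volume.restrict Ω)) (a : ℝ) :
    ∫ x in Ω, (p x - a) ^ 2 = (∫ x in Ω, (p x - (∫ y in Ω, p y) / volume.real Ω) ^ 2) +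
      ((∫ y in Ω, p y) / volume.real Ω - a) ^ 2 * volume.real Ω := by
  set m := (∫ y in Ω, p y) / volume.real Ω with hm
  have hpm : MemLp (fun x => p x - m) 2 (volume.restrict Ω) := hp.sub (memLp_const m)
  have hpi : Integrable p (volume.restrict Ω) := hp.integrable (by norm_num)
  have hpmi : Integrable (fun x => p x - m) (volume.restrict Ω) := hpm.integrable (by norm_num)
  have h1 : ∫ x in Ω, (p x - m) = 0 := by
    rw [integral_sub hpi (integrable_const _), setIntegral_const, smul_eq_mul, hm]
    field_simp
    ring
  have h2 : (fun x => (p x - a) ^ 2) =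
      fun x => (p x - m) ^ 2 + (2 * (m - a) * (p x - m) + (m - a) ^ 2) := by
    ext x; ring
  have hi : Integrable (fun x => 2 * (m - a) * (p x - m) + (m - a) ^ 2) (volume.restrict Ω) :=
    (hpmi.const_mul _).add (integrable_const _)
  rw [h2, integral_add hpm.integrable_sq hi, integral_add (hpmi.const_mul _) (integrable_const _),
    integral_const_mul, h1, setIntegral_const, smul_eq_mul]
  ring

/-- Test fields with one nonzero component suffice to control `p` up to its mean value `m`. -/
theorem exists_test_of_oscBound {Ω : Set (Sp d)} (hosc : OscBound Ω Ω) (hd : 1 ≤ d)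
    (hΩ : IsOpen Ω) (hne : Ω.Nonempty) (hb : Bornology.IsBounded Ω) :
    ∃ C : ℝ, 0 < C ∧ ∀ p : Sp d → ℝ, MemLp p 2 (volume.restrict Ω) →
      ∃ (φ : Sp d → ℝ) (j : Fin d), IsTest φ ∧ tsupport φ ⊆ Ω ∧
        - (∫ x in Ω, p x * pd j φ x) =
          ∫ x in Ω, (p x - (∫ y in Ω, p y) / volume.real Ω) ^ 2 ∧
        ∫ x, ∑ k, pd k φ x ^ 2 ≤
          C * ∫ x in Ω, (p x - (∫ y in Ω, p y) / volume.real Ω) ^ 2 := by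
  have hfin : IsFiniteMeasure (volume.restrict Ω) := ⟨by simpa using hb.measure_lt_top⟩
  have hv : 0 < volume.real Ω := ENNReal.toReal_pos (hΩ.measure_pos volume hne).ne'
    hb.measure_lt_top.ne
  obtain ⟨C₀, hC₀, hosc⟩ := hosc
  refine ⟨C₀ + 1, by positivity, fun p hp => ?_⟩
  set F := ∫ x in Ω, (p x - (∫ y in Ω, p y) / volume.real Ω) ^ 2 with hF
  have hF0 : 0 ≤ F := integral_nonneg fun _ => sq_nonneg _
  rcases hF0.eq_or_lt with h0 | h0
  · refine ⟨fun _ => 0, ⟨0, hd⟩, isTest_zero, by simp [tsupport], ?_, ?_⟩ <;>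
      simp [pd_zero, ← h0]
  · have hnot : ¬ NegBound Ω p (F / (C₀ + 1)) := by
      intro hneg
      obtain ⟨a, ha⟩ := hosc p hp _ (by positivity) hneg
      rw [integral_sq_eq_mean hv.ne' hp a, ← hF] at ha
      have h1 : C₀ * (F / (C₀ + 1)) < F := by
        rw [mul_div_assoc', div_lt_iff₀ (by positivity)]
        nlinarith
      have h2 : 0 ≤ ((∫ y in Ω, p y) / volume.real Ω - a) ^ 2 * volume.real Ω := by positivity
      linarith
    simp only [NegBound, not_forall, not_le] at hnot
    obtain ⟨φ, hφ, hsub, j, hlt⟩ := hnot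
    set I := ∫ x in Ω, p x * pd j φ x with hI
    set P := ∫ x, ∑ k, pd k φ x ^ 2 with hP
    have hP0 : 0 ≤ P := integral_nonneg fun _ => Finset.sum_nonneg fun _ _ => sq_nonneg _
    have hI2 : 0 < I ^ 2 := lt_of_le_of_lt (by positivity) hlt
    have hI0 : I ≠ 0 := fun h => by simp [h] at hI2
    refine ⟨fun x => (-F / I) * φ x, j, hφ.const_mul _,
      (tsupport_mul_subset_right (f := fun _ => -F / I)).trans hsub, ?_, ?_⟩
    · have : (fun x => p x * pd j (fun x => (-F / I) * φ x) x) =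
          fun x => (-F / I) * (p x * pd j φ x) := by
        ext x; rw [pd_const_mul hφ.differentiable]; ring
      rw [this, integral_const_mul, ← hI]
      field_simp
    · have : (fun x => ∑ k, pd k (fun x => (-F / I) * φ x) x ^ 2) =
          fun x => (-F / I) ^ 2 * ∑ k, pd k φ x ^ 2 := by
        ext x
        rw [Finset.mul_sum]
        refine Finset.sum_congr rfl fun k _ => ?_
        rw [pd_const_mul hφ.differentiable]; ring
      rw [this, integral_const_mul, ← hP]
      rw [div_mul_eq_mul_div, div_lt_iff₀ (by positivity)] at hlt
      have : (-F / I) ^ 2 * P = F * (F * P) / I ^ 2 := by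
        rw [div_pow]; ring
      rw [this, div_le_iff₀ hI2]
      nlinarith

/-- The inf-sup condition for all pressures, including the constants: these are controlled by one
additional field, whose divergence `κ` has a mean value different from zero. -/
theorem exists_div_test {Ω : Set (Sp d)} (hosc : OscBound Ω Ω) (hd : 1 ≤ d)
    (hΩ : IsOpen Ω) (hne : Ω.Nonempty) (hb : Bornology.IsBounded Ω) {κ : Sp d → ℝ}
    (hκ : MemLp κ 2 (volume.restrict Ω)) (hκ0 : ∫ x in Ω, κ x ≠ 0) :
    ∃ C : ℝ, 0 < C ∧ ∀ p : Sp d → ℝ, MemLp p 2 (volume.restrict Ω) →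
      ∃ (φ : Sp d → ℝ) (j : Fin d) (α : ℝ), IsTest φ ∧ tsupport φ ⊆ Ω ∧
        ∫ x in Ω, p x ^ 2 ≤ C * - ((∫ x in Ω, p x * pd j φ x) + α * ∫ x in Ω, p x * κ x) ∧
        ∫ x, ∑ k, pd k φ x ^ 2 ≤ C * ∫ x in Ω, p x ^ 2 ∧ α ^ 2 ≤ C * ∫ x in Ω, p x ^ 2 := by
  have hfin : IsFiniteMeasure (volume.restrict Ω) := ⟨by simpa using hb.measure_lt_top⟩
  obtain ⟨C₀, hC₀, htest⟩ := exists_test_of_oscBound hosc hd hΩ hne hb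
  set v := volume.real Ω with hv
  have hv0 : 0 < v := ENNReal.toReal_pos (hΩ.measure_pos volume hne).ne' hb.measure_lt_top.ne
  set σ := ∫ x in Ω, κ x with hσ
  set X := ∫ x in Ω, κ x ^ 2 with hX
  have hX0 : 0 ≤ X := integral_nonneg fun _ => sq_nonneg _
  have hσ2 : 0 < σ ^ 2 := by positivity
  set c := X / (2 * σ ^ 2) with hc
  have hc0 : 0 ≤ c := by positivity
  refine ⟨(1 + 2 * v) + (c + 1) ^ 2 * C₀ + 1 / (v * σ ^ 2), by positivity, fun p hp => ?_⟩
  obtain ⟨φ, j, hφ, hsub, hpair, hgrad⟩ := htest p hp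
  set m := (∫ y in Ω, p y) / v with hm
  set F := ∫ x in Ω, (p x - m) ^ 2 with hF
  have hF0 : 0 ≤ F := integral_nonneg fun _ => sq_nonneg _
  have hsplit : ∫ x in Ω, p x ^ 2 = F + m ^ 2 * v := by
    have := integral_sq_eq_mean hv0.ne' hp 0
    simpa using this
  have hpm : MemLp (fun x => p x - m) 2 (volume.restrict Ω) := hp.sub (memLp_const m)
  have hκp : ∫ x in Ω, p x * κ x = (∫ x in Ω, (p x - m) * κ x) + m * σ := by
    have i1 : Integrable (fun x => (p x - m) * κ x) (volume.restrict Ω) := hpm.integrable_mul hκ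
    rw [hσ, ← integral_const_mul, ← integral_add i1
      ((hκ.integrable (by norm_num)).const_mul m)]
    congr 1
    ext x; ring
  have hcs : (∫ x in Ω, (p x - m) * κ x) ^ 2 ≤ F * X := sq_integral_mul_le hpm hκ
  set J := ∫ x in Ω, (p x - m) * κ x
  refine ⟨fun x => (c + 1) * φ x, j, -m / σ, hφ.const_mul _,
    (tsupport_mul_subset_right (f := fun _ => c + 1)).trans hsub, ?_, ?_, ?_⟩
  · have h1 : ∫ x in Ω, p x * pd j (fun x => (c + 1) * φ x) x = -((c + 1) * F) := by
      have : (fun x => p x * pd j (fun x => (c + 1) * φ x) x) =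
          fun x => (c + 1) * (p x * pd j φ x) := by
        ext x; rw [pd_const_mul hφ.differentiable]; ring
      rw [this, integral_const_mul, ← hpair]; ring
    have h2 : m ^ 2 / 2 - c * F ≤ -(-m / σ * (J + m * σ)) := by
      have h3 : -(-m / σ * (J + m * σ)) = m ^ 2 + m * (J / σ) := by
        field_simp
        ring
      have h4 : (J / σ) ^ 2 / 2 ≤ c * F := by
        rw [hc, div_pow, div_div, div_mul_eq_mul_div, mul_comm (σ ^ 2) 2]
        gcongr
        linarith
      rw [h3]
      nlinarith [sq_nonneg (m + J / σ)]
    rw [h1, hκp, hsplit]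
    have h5 : m ^ 2 / 2 + F ≤ -(-((c + 1) * F) + -m / σ * (J + m * σ)) := by linarith
    have h6 : 0 ≤ m ^ 2 / 2 + F := by positivity
    calc F + m ^ 2 * v ≤ (1 + 2 * v) * (m ^ 2 / 2 + F) := by nlinarith [sq_nonneg m]
      _ ≤ ((1 + 2 * v) + (c + 1) ^ 2 * C₀ + 1 / (v * σ ^ 2)) *
          -(-((c + 1) * F) + -m / σ * (J + m * σ)) := by
          refine mul_le_mul ?_ h5 h6 (by positivity)
          have : 0 ≤ (c + 1) ^ 2 * C₀ + 1 / (v * σ ^ 2) := by positivity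
          linarith
  · have : (fun x => ∑ k, pd k (fun x => (c + 1) * φ x) x ^ 2) =
        fun x => (c + 1) ^ 2 * ∑ k, pd k φ x ^ 2 := by
      ext x
      rw [Finset.mul_sum]
      refine Finset.sum_congr rfl fun k _ => ?_
      rw [pd_const_mul hφ.differentiable]; ring
    rw [this, integral_const_mul]
    calc _ ≤ (c + 1) ^ 2 * (C₀ * (F + m ^ 2 * v)) := by
          gcongr
          refine hgrad.trans ?_
          gcongr
          have : 0 ≤ m ^ 2 * v := by positivity
          linarith
      _ = (c + 1) ^ 2 * C₀ * (F + m ^ 2 * v) := by ring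
      _ ≤ _ := by
          rw [hsplit]
          gcongr
          have : 0 ≤ 1 / (v * σ ^ 2) := by positivity
          linarith
  · rw [hsplit]
    calc (-m / σ) ^ 2 = 1 / (v * σ ^ 2) * (m ^ 2 * v) := by field_simp
      _ ≤ _ := by
          refine mul_le_mul ?_ (by linarith) (by positivity) (by positivity)
          have : 0 ≤ (1 + 2 * v) + (c + 1) ^ 2 * C₀ := by positivity
          linarith

/-! ### Linear combinations in the energy space -/

theorem memLp_coord {Ω : Set (Sp d)} {v : Sp d → Sp d} (h : MemLp v 2 (volume.restrict Ω))
    (i : Fin d) : MemLp (fun x => v x i) 2 (volume.restrict Ω) :=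
  h.continuousLinearMap_comp (EuclideanSpace.proj i : Sp d →L[ℝ] ℝ)

theorem memLp_trace {Ω : Set (Sp d)} {A : Sp d → Matrix (Fin d) (Fin d) ℝ}
    (hA : ∀ i j, MemLp (fun x => A x i j) 2 (volume.restrict Ω)) :
    MemLp (fun x => (A x).trace) 2 (volume.restrict Ω) :=
  memLp_finsetSum (f := fun i x => A x i i) Finset.univ fun i _ => hA i i

theorem integral_add_smul_mul {μ : Measure (Sp d)} {f g h : Sp d → ℝ} (hf : MemLp f 2 μ)
    (hg : MemLp g 2 μ) (hh : MemLp h 2 μ) (s : ℝ) :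
    ∫ x, (f x + s * g x) * h x ∂μ = (∫ x, f x * h x ∂μ) + s * ∫ x, g x * h x ∂μ := by
  have i1 : Integrable (fun x => f x * h x) μ := hf.integrable_mul hh
  have i2 : Integrable (fun x => g x * h x) μ := hg.integrable_mul hh
  rw [← integral_const_mul, ← integral_add i1 (i2.const_mul s)]
  congr 1
  ext x; ring

theorem MemH1.add_smul {Ω : Set (Sp d)} {v v' : Sp d → Sp d}
    {A A' : Sp d → Matrix (Fin d) (Fin d) ℝ} (h : MemH1 Ω v A) (h' : MemH1 Ω v' A') (s : ℝ) :
    MemH1 Ω (fun x => v x + s • v' x) (fun x => A x + s • A' x) := by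
  refine ⟨h.1.add (h'.1.const_smul s), fun i j => (h.2.1 i j).add ((h'.2.1 i j).const_smul s),
    fun i j φ hφ hsub => ?_⟩
  have h1 := integral_add_smul_mul (memLp_coord h.1 i) (memLp_coord h'.1 i)
    ((hφ.pd j).memLp (p := 2) _) s
  have h2 := integral_add_smul_mul (h.2.1 i j) (h'.2.1 i j) (hφ.memLp (p := 2) _) s
  have e1 := h.2.2 i j φ hφ hsub
  have e2 := h'.2.2 i j φ hφ hsub
  calc _ = _ := h1
    _ = -((∫ x in Ω, A x i j * φ x) + s * ∫ x in Ω, A' x i j * φ x) := by rw [e1, e2]; ring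
    _ = _ := by rw [← h2]; rfl

theorem tendsto_eLpNorm_add_smul {μ : Measure (Sp d)} {f f' : ℕ → Sp d → ℝ}
    (hf : ∀ k, AEStronglyMeasurable (f k) μ) (hf' : ∀ k, AEStronglyMeasurable (f' k) μ)
    (h : Tendsto (fun k => eLpNorm (f k) 2 μ) atTop (𝓝 0))
    (h' : Tendsto (fun k => eLpNorm (f' k) 2 μ) atTop (𝓝 0)) (s : ℝ) :
    Tendsto (fun k => eLpNorm (fun x => f k x + s * f' k x) 2 μ) atTop (𝓝 0) := by
  have h1 : Tendsto (fun k => eLpNorm (f k) 2 μ + ‖s‖ₑ * eLpNorm (f' k) 2 μ) atTop (𝓝 0) := by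
    simpa using h.add (ENNReal.Tendsto.const_mul h' (.inr enorm_ne_top))
  refine tendsto_of_tendsto_of_tendsto_of_le_of_le tendsto_const_nhds h1 (fun _ => zero_le)
    fun k => ?_
  refine (eLpNorm_add_le (hf k) ((hf' k).const_smul s) (by norm_num)).trans ?_
  gcongr
  exact eLpNorm_const_smul_le

theorem IsTrace.add_smul {Ω : Set (Sp d)} {v v' : Sp d → Sp d}
    {A A' : Sp d → Matrix (Fin d) (Fin d) ℝ} {t t' : Sp d → Sp d} (hv : MemH1 Ω v A)
    (hv' : MemH1 Ω v' A') (h : IsTrace Ω v A t) (h' : IsTrace Ω v' A' t') (s : ℝ) :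
    IsTrace Ω (fun x => v x + s • v' x) (fun x => A x + s • A' x) (fun x => t x + s • t' x) := by
  refine ⟨h.1.add (h'.1.const_smul s), fun i => ?_⟩
  obtain ⟨φ, hφ, h1, h2, h3⟩ := h.2 i
  obtain ⟨φ', hφ', h1', h2', h3'⟩ := h'.2 i
  have hdiff : ∀ k, Differentiable ℝ (φ k) := fun k => (hφ k).differentiable (by simp)
  have hdiff' : ∀ k, Differentiable ℝ (φ' k) := fun k => (hφ' k).differentiable (by simp)
  have ht := h.1.continuousLinearMap_comp (EuclideanSpace.proj i : Sp d →L[ℝ] ℝ)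
  have ht' := h'.1.continuousLinearMap_comp (EuclideanSpace.proj i : Sp d →L[ℝ] ℝ)
  refine ⟨fun k x => φ k x + s * φ' k x, fun k => (hφ k).add (contDiff_const.mul (hφ' k)),
    ?_, fun j => ?_, ?_⟩
  · refine (tendsto_eLpNorm_add_smul
      (fun k => (hφ k).continuous.aestronglyMeasurable.sub (memLp_coord hv.1 i).1)
      (fun k => (hφ' k).continuous.aestronglyMeasurable.sub (memLp_coord hv'.1 i).1) h1
      h1' s).congr fun k => congrArg (eLpNorm · 2 _) (funext fun x => ?_)
    simp only [Pi.sub_apply, PiLp.add_apply, PiLp.smul_apply, smul_eq_mul]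
    ring
  · refine (tendsto_eLpNorm_add_smul
      (fun k => (contDiff_pd (hφ k) j).continuous.aestronglyMeasurable.sub (hv.2.1 i j).1)
      (fun k => (contDiff_pd (hφ' k) j).continuous.aestronglyMeasurable.sub (hv'.2.1 i j).1)
      (h2 j) (h2' j) s).congr fun k => congrArg (eLpNorm · 2 _) (funext fun x => ?_)
    rw [pd_add (hdiff k) ((hdiff' k).const_mul s), pd_const_mul (hdiff' k)]
    simp only [Pi.sub_apply, Matrix.add_apply, Matrix.smul_apply, smul_eq_mul]
    ring
  · refine (tendsto_eLpNorm_add_smul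
      (fun k => (hφ k).continuous.aestronglyMeasurable.sub ht.1)
      (fun k => (hφ' k).continuous.aestronglyMeasurable.sub ht'.1) h3
      h3' s).congr fun k => congrArg (eLpNorm · 2 _) (funext fun x => ?_)
    simp only [Pi.sub_apply, PiLp.add_apply, PiLp.smul_apply, smul_eq_mul, PiLp.proj_apply]
    ring

theorem VanishesOn.add_smul {Ω Γ : Set (Sp d)} {v v' : Sp d → Sp d}
    {A A' : Sp d → Matrix (Fin d) (Fin d) ℝ} (hv : MemH1 Ω v A) (hv' : MemH1 Ω v' A')
    (h : VanishesOn Ω Γ v A) (h' : VanishesOn Ω Γ v' A') (s : ℝ) :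
    VanishesOn Ω Γ (fun x => v x + s • v' x) (fun x => A x + s • A' x) := by
  obtain ⟨t, ht, h0⟩ := h
  obtain ⟨t', ht', h0'⟩ := h'
  refine ⟨_, ht.add_smul hv hv' ht' s, ?_⟩
  filter_upwards [h0, h0'] with x hx hx'
  simp [hx, hx']

theorem integrable_normalPairing {Ω : Set (Sp d)} {τ : Sp d → Sp d} {dτ φ : Sp d → ℝ}
    (hτ : MemLp τ 2 (volume.restrict Ω)) (hdτ : MemLp dτ 2 (volume.restrict Ω))
    (hφ : IsTest φ) :
    Integrable (fun x => (∑ j, τ x j * pd j φ x) + dτ x * φ x) (volume.restrict Ω) := by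
  have i1 : ∀ j, Integrable (fun x => τ x j * pd j φ x) (volume.restrict Ω) :=
    fun j => (memLp_coord hτ j).integrable_mul ((hφ.pd j).memLp (p := 2) _)
  exact (integrable_finsetSum _ fun j _ => i1 j).add (hdτ.integrable_mul (hφ.memLp (p := 2) _))

theorem normalPairing_add_smul {Ω : Set (Sp d)} {τ τ' : Sp d → Sp d} {dτ dτ' φ : Sp d → ℝ}
    (hτ : MemLp τ 2 (volume.restrict Ω)) (hdτ : MemLp dτ 2 (volume.restrict Ω))
    (hτ' : MemLp τ' 2 (volume.restrict Ω)) (hdτ' : MemLp dτ' 2 (volume.restrict Ω))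
    (hφ : IsTest φ) (s : ℝ) :
    normalPairing Ω (fun x => τ x + s • τ' x) (fun x => dτ x + s * dτ' x) φ =
      normalPairing Ω τ dτ φ + s * normalPairing Ω τ' dτ' φ := by
  unfold normalPairing
  rw [← integral_const_mul, ← integral_add (integrable_normalPairing hτ hdτ hφ)
    ((integrable_normalPairing hτ' hdτ' hφ).const_mul s)]
  congr 1
  ext x
  simp only [PiLp.add_apply, PiLp.smul_apply, smul_eq_mul, add_mul, Finset.sum_add_distrib,
    mul_add, Finset.mul_sum]
  have : ∀ j, s * (τ' x).ofLp j * pd j φ x = s * ((τ' x).ofLp j * pd j φ x) := fun j => by ring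
  simp only [this]
  ring

theorem MemHdiv.add_smul {Ω : Set (Sp d)} {τ τ' : Sp d → Sp d} {dτ dτ' : Sp d → ℝ}
    (h : MemHdiv Ω τ dτ) (h' : MemHdiv Ω τ' dτ') (s : ℝ) :
    MemHdiv Ω (fun x => τ x + s • τ' x) (fun x => dτ x + s * dτ' x) := by
  refine ⟨h.1.add (h'.1.const_smul s), h.2.1.add (h'.2.1.const_smul s), fun φ hφ hsub => ?_⟩
  -- the weak divergence is characterized by the vanishing of the normal pairing
  have key : ∀ {τ : Sp d → Sp d} {dτ : Sp d → ℝ}, MemLp τ 2 (volume.restrict Ω) →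
      MemLp dτ 2 (volume.restrict Ω) → normalPairing Ω τ dτ φ =
        (∫ x in Ω, ∑ j, τ x j * pd j φ x) + ∫ x in Ω, dτ x * φ x := by
    intro τ dτ hτ hdτ
    have i1 : ∀ j, Integrable (fun x => τ x j * pd j φ x) (volume.restrict Ω) :=
      fun j => (memLp_coord hτ j).integrable_mul ((hφ.pd j).memLp (p := 2) _)
    have i2 : Integrable (fun x => dτ x * φ x) (volume.restrict Ω) :=
      hdτ.integrable_mul (hφ.memLp (p := 2) _)
    exact integral_add (integrable_finsetSum _ fun j _ => i1 j) i2
  have e := normalPairing_add_smul h.1 h.2.1 h'.1 h'.2.1 hφ s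
  rw [key h.1 h.2.1, key h'.1 h'.2.1, h.2.2 φ hφ hsub, h'.2.2 φ hφ hsub,
    key (τ := fun x => τ x + s • τ' x) (dτ := fun x => dτ x + s * dτ' x)
      (h.1.add (h'.1.const_smul s)) (h.2.1.add (h'.2.1.const_smul s))] at e
  linarith

theorem HasNormalTraceL2.add_smul {Ω Γ Γc : Set (Sp d)} {τ τ' : Sp d → Sp d}
    {dτ dτ' t t' : Sp d → ℝ} (hΓ : surf d Γ < ⊤) (hτ : MemHdiv Ω τ dτ) (hτ' : MemHdiv Ω τ' dτ')
    (h : HasNormalTraceL2 Ω Γ Γc τ dτ t) (h' : HasNormalTraceL2 Ω Γ Γc τ' dτ' t') (s : ℝ) :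
    HasNormalTraceL2 Ω Γ Γc (fun x => τ x + s • τ' x) (fun x => dτ x + s * dτ' x)
      (fun x => t x + s * t' x) := by
  have hfin : IsFiniteMeasure ((surf d).restrict Γ) := ⟨by simpa using hΓ⟩
  refine ⟨h.1.add (h'.1.const_smul s), fun φ hφ hsub => ?_⟩
  rw [normalPairing_add_smul hτ.1 hτ.2.1 hτ'.1 hτ'.2.1 hφ s, h.2 φ hφ hsub, h'.2 φ hφ hsub,
    integral_add_smul_mul h.1 h'.1 (hφ.memLp _)]

theorem NormalMatch.add_smul {G : Geometry d} {v v' : Sp d → Sp d}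
    {A A' : Sp d → Matrix (Fin d) (Fin d) ℝ} {τ τ' : Sp d → Sp d} {dτ dτ' : Sp d → ℝ}
    (hv : MemH1 G.Ωs v A) (hv' : MemH1 G.Ωs v' A') (hτ : MemHdiv G.Ωf τ dτ)
    (hτ' : MemHdiv G.Ωf τ' dτ') (h : NormalMatch G v A τ dτ) (h' : NormalMatch G v' A' τ' dτ')
    (s : ℝ) : NormalMatch G (fun x => v x + s • v' x) (fun x => A x + s • A' x)
      (fun x => τ x + s • τ' x) (fun x => dτ x + s * dτ' x) := by
  intro φ hφ hsub
  have e : (fun x => (A x + s • A' x).trace) = fun x => (A x).trace + s * (A' x).trace := by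
    ext x; simp
  rw [e, normalPairing_add_smul hτ.1 hτ.2.1 hτ'.1 hτ'.2.1 hφ s,
    normalPairing_add_smul hv.1 (memLp_trace hv.2.1) hv'.1 (memLp_trace hv'.2.1) hφ s,
    h φ hφ hsub, h' φ hφ hsub]
  ring

theorem surf_Γ0_lt_top (hd : 1 ≤ d) (G : Geometry d) : surf d G.Γ0 < ⊤ :=
  (measure_mono (by rw [G.frontier_fluid]; exact subset_union_right)).trans_lt
    (surf_frontier_lt_top hd G.fluid.isBounded G.fluid.polyhedral)

/-- The element of `H` with displacements `(X.u, X.w) + s (Z.u, Z.w)` and pressure `q`. -/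
def HSpace.addSmul (hd : 1 ≤ d) {G : Geometry d} (X Z : HSpace G) (s : ℝ) (q : Sp d → ℝ)
    (hq : MemLp q 2 (volume.restrict G.Ωs)) : HSpace G where
  u := fun x => X.u x + s • Z.u x
  Du := fun x => X.Du x + s • Z.Du x
  w := fun x => X.w x + s • Z.w x
  dw := fun x => X.dw x + s * Z.dw x
  wn := fun x => X.wn x + s * Z.wn x
  p := q
  u_mem := X.u_mem.add_smul Z.u_mem s
  u_clamped := X.u_clamped.add_smul X.u_mem Z.u_mem Z.u_clamped s
  w_mem := X.w_mem.add_smul Z.w_mem s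
  w_normal := X.w_normal.add_smul (surf_Γ0_lt_top hd G) X.w_mem Z.w_mem Z.w_normal s
  matching := X.matching.add_smul X.u_mem Z.u_mem X.w_mem Z.w_mem Z.matching s
  p_mem := hq

/-! ### Smooth fields -/

/-- The vector field `ψ eⱼ`. -/
def testField (ψ : Sp d → ℝ) (j : Fin d) (x : Sp d) : Sp d := EuclideanSpace.single j (ψ x)

/-- The gradient of the vector field `ψ eⱼ`. -/
def testGrad (ψ : Sp d → ℝ) (j : Fin d) (x : Sp d) : Matrix (Fin d) (Fin d) ℝ :=
  fun i k => if i = j then pd k ψ x else 0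

theorem testField_apply (ψ : Sp d → ℝ) (j i : Fin d) (x : Sp d) :
    testField ψ j x i = if i = j then ψ x else 0 := by
  simp [testField]

theorem norm_testField (ψ : Sp d → ℝ) (j : Fin d) (x : Sp d) : ‖testField ψ j x‖ = |ψ x| := by
  simp [testField]

theorem trace_testGrad (ψ : Sp d → ℝ) (j : Fin d) (x : Sp d) :
    (testGrad ψ j x).trace = pd j ψ x := by
  simp [testGrad, Matrix.trace]

theorem continuous_testField {ψ : Sp d → ℝ} (h : Continuous ψ) (j : Fin d) :
    Continuous (testField ψ j) := by
  refine (PiLp.continuous_toLp 2 _).comp (continuous_pi fun i => ?_)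
  by_cases hi : i = j
  · subst hi; simpa using h
  · simpa [hi] using continuous_const

theorem IsTest.memLp_testField {ψ : Sp d → ℝ} (h : IsTest ψ) (j : Fin d) (μ : Measure (Sp d))
    [IsFiniteMeasureOnCompacts μ] : MemLp (testField ψ j) 2 μ :=
  (h.memLp (p := 2) μ).congr_norm (continuous_testField h.continuous j).aestronglyMeasurable
    (Eventually.of_forall fun x => by rw [norm_testField, Real.norm_eq_abs])

theorem memH1_testField {ψ : Sp d → ℝ} (h : IsTest ψ) (j : Fin d) (Ω : Set (Sp d)) :
    MemH1 Ω (testField ψ j) (testGrad ψ j) := by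
  refine ⟨h.memLp_testField j _, fun i k => ?_, fun i k φ hφ hsub => ?_⟩
  · by_cases hi : i = j
    · simpa [testGrad, hi] using (h.pd k).memLp _
    · simp [testGrad, hi]
  · simp only [testField_apply, testGrad]
    by_cases hi : i = j
    · simp only [hi, if_true]
      rw [setIntegral_eq_of_tsupport_subset ((tsupport_pd_subset φ k).trans hsub)
          fun x hx => by simp [hx],
        setIntegral_eq_of_tsupport_subset hsub fun x hx => by simp [hx],
        integral_mul_pd h.1 hφ]
    · simp [hi]

theorem isTrace_testField {Ω : Set (Sp d)} (hfin : surf d (frontier Ω) < ⊤) {ψ : Sp d → ℝ}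
    (h : IsTest ψ) (j : Fin d) : IsTrace Ω (testField ψ j) (testGrad ψ j) (testField ψ j) := by
  have : IsFiniteMeasure ((surf d).restrict (frontier Ω)) := ⟨by simpa using hfin⟩
  refine ⟨h.memLp_testField j _, fun i => ?_⟩
  by_cases hi : i = j
  · refine ⟨fun _ => ψ, fun _ => h.1, ?_, fun k => ?_, ?_⟩ <;>
      simp [testField_apply, testGrad, hi]
  · refine ⟨fun _ _ => 0, fun _ => contDiff_const, ?_, fun k => ?_, ?_⟩ <;>
      simp [testField_apply, testGrad, hi, pd_zero]

theorem vanishesOn_testField {Ω Γ : Set (Sp d)} (hfin : surf d (frontier Ω) < ⊤) {ψ : Sp d → ℝ}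
    (h : IsTest ψ) (j : Fin d) (hΓ : IsClosed Γ) (hψ : Disjoint (tsupport ψ) Γ) :
    VanishesOn Ω Γ (testField ψ j) (testGrad ψ j) := by
  refine ⟨_, isTrace_testField hfin h j, ?_⟩
  filter_upwards [self_mem_ae_restrict hΓ.measurableSet] with x hx
  simp [testField, image_eq_zero_of_notMem_tsupport fun hx' => hψ.le_bot ⟨hx', hx⟩]

/-- The normal pairing of `ψ eⱼ` with `φ` is the flux of `ψ φ eⱼ`. -/
theorem normalPairing_testField {Ω : Set (Sp d)} {ψ φ : Sp d → ℝ} (h : IsTest ψ) (hφ : IsTest φ)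
    (j : Fin d) : normalPairing Ω (testField ψ j) (pd j ψ) φ =
      ∫ x in Ω, pd j (fun x => ψ x * φ x) x := by
  unfold normalPairing
  congr 1
  ext x
  rw [pd_mul h.differentiable hφ.differentiable]
  simp [testField_apply]

theorem memHdiv_testField {ψ : Sp d → ℝ} (h : IsTest ψ) (j : Fin d) (Ω : Set (Sp d)) :
    MemHdiv Ω (testField ψ j) (pd j ψ) := by
  refine ⟨h.memLp_testField j _, (h.pd j).memLp _, fun φ hφ hsub => ?_⟩
  have := (memH1_testField h j Ω).2.2 j j φ hφ hsub
  simpa [testField_apply, testGrad] using this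

theorem normalPairing_zero (Ω : Set (Sp d)) (φ : Sp d → ℝ) :
    normalPairing Ω (fun _ => 0) (fun _ => 0) φ = 0 := by
  simp [normalPairing]

theorem tsupport_mul_subset_inter (ψ φ : Sp d → ℝ) :
    tsupport (fun x => ψ x * φ x) ⊆ tsupport ψ ∩ tsupport φ :=
  subset_inter (tsupport_mul_subset_left (f := ψ) (g := φ))
    (tsupport_mul_subset_right (f := ψ) (g := φ))

theorem surf_frontier_solid_lt_top (hd : 1 ≤ d) (G : Geometry d) :
    surf d (frontier G.Ωs) < ⊤ :=
  surf_frontier_lt_top hd G.solid.isBounded G.solid.polyhedral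

/-- The field `ψ eⱼ` in the solid and the rest in the fluid, for `ψ` that vanishes near the
interface and near the clamped part. -/
def solidField (hd : 1 ≤ d) (G : Geometry d) {ψ : Sp d → ℝ} (h : IsTest ψ) (j : Fin d)
    (hψ : Disjoint (tsupport ψ) (G.Sig ∪ G.ΓD)) : HSpace G where
  u := testField ψ j
  Du := testGrad ψ j
  w := fun _ => 0
  dw := fun _ => 0
  wn := fun _ => 0
  p := fun _ => 0
  u_mem := memH1_testField h j _
  u_clamped := vanishesOn_testField (surf_frontier_solid_lt_top hd G) h j G.closed_ΓD
    (hψ.mono_right subset_union_right)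
  w_mem := ⟨MemLp.zero', MemLp.zero', fun φ _ _ => by simp⟩
  w_normal := ⟨MemLp.zero', fun φ _ _ => by simp [normalPairing_zero]⟩
  matching := fun φ hφ hsub => by
    simp only [trace_testGrad]
    rw [normalPairing_zero, normalPairing_testField h hφ,
      setIntegral_pd_eq_zero G.solid.isOpen (h.mul hφ), neg_zero]
    rw [G.frontier_solid]
    refine Disjoint.mono_left (tsupport_mul_subset_inter ψ φ) ?_
    refine disjoint_union_right.2 ⟨hψ.mono_left inter_subset_left, ?_⟩
    exact (hsub.mono_left inter_subset_right).mono_right subset_union_right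
  p_mem := MemLp.zero'

/-- The field `ψ eⱼ` in the solid and in the fluid, for `ψ` with support near an inner point of
the interface: the normal components match since the field is smooth across the interface. -/
def interfaceField (hd : 1 ≤ d) (G : Geometry d) {ψ : Sp d → ℝ} (h : IsTest ψ) (j : Fin d)
    (hψ : Disjoint (tsupport ψ) (G.Γ0 ∪ G.ΓD))
    (hnull : volume (tsupport ψ \ (G.Ωf ∪ G.Ωs)) = 0) : HSpace G where
  u := testField ψ j
  Du := testGrad ψ j
  w := testField ψ j
  dw := pd j ψ
  wn := fun _ => 0
  p := fun _ => 0
  u_mem := memH1_testField h j _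
  u_clamped := vanishesOn_testField (surf_frontier_solid_lt_top hd G) h j G.closed_ΓD
    (hψ.mono_right subset_union_right)
  w_mem := memHdiv_testField h j _
  w_normal := ⟨MemLp.zero', fun φ hφ hsub => by
    rw [normalPairing_testField h hφ, setIntegral_pd_eq_zero G.fluid.isOpen (h.mul hφ)]
    · simp
    rw [G.frontier_fluid]
    refine Disjoint.mono_left (tsupport_mul_subset_inter ψ φ) ?_
    exact disjoint_union_right.2 ⟨hsub.mono_left inter_subset_right,
      (hψ.mono_left inter_subset_left).mono_right subset_union_left⟩⟩
  matching := fun φ hφ _ => by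
    simp only [trace_testGrad]
    rw [normalPairing_testField h hφ, normalPairing_testField h hφ, eq_neg_iff_add_eq_zero,
      ← setIntegral_union G.disjoint G.solid.isOpen.measurableSet
        (((h.mul hφ).pd j).integrable _).integrableOn (((h.mul hφ).pd j).integrable _).integrableOn]
    rw [← integral_pd (h.mul hφ) j]
    refine setIntegral_eq_integral_of_ae_compl_eq_zero ?_
    have h0 : ∀ᵐ x, x ∉ tsupport ψ \ (G.Ωf ∪ G.Ωs) := measure_eq_zero_iff_ae_notMem.1 hnull
    filter_upwards [h0] with x hx hxΩ
    exact pd_eq_zero_of_notMem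
      (fun hx' => hx ⟨(tsupport_mul_subset_inter ψ φ hx').1, hxΩ⟩) j
  p_mem := MemLp.zero'

/-! ### Fields with a flux through the boundary of the solid -/

theorem exists_mem_notMem_of_null {Γ A : Set (Sp d)} (hpos : 0 < surf d Γ)
    (hnull : surf d (Γ ∩ A) = 0) : ∃ x ∈ Γ, x ∉ A := by
  by_contra! hcon
  rw [inter_eq_left.2 hcon] at hnull
  exact hpos.ne' hnull

theorem exists_ball_disjoint {A : Set (Sp d)} (hA : IsClosed A) {x : Sp d} (hx : x ∉ A) :
    ∃ r > 0, Disjoint (Metric.ball x r) A := by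
  obtain ⟨r, hr, h⟩ := Metric.isOpen_iff.1 hA.isOpen_compl x hx
  exact ⟨r, hr, disjoint_left.2 fun y hy => h hy⟩

/-- If the traction-free part is not negligible, a field in the solid alone, supported near one of
its points, has a flux through it. -/
theorem exists_solidField_flux (hd : 1 ≤ d) (G : Geometry d) (hN : 0 < surf d G.ΓN) :
    ∃ Ψ : HSpace G, (∀ x, Ψ.w x = 0) ∧ (∀ x, Ψ.dw x = 0) ∧ (∀ x, Ψ.wn x = 0) ∧
      ∫ x in G.Ωs, (Ψ.Du x).trace ≠ 0 := by
  obtain ⟨x, hxN, hx⟩ := exists_mem_notMem_of_null (A := G.Sig ∪ G.ΓD) hN (by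
    rw [inter_union_distrib_left]
    exact measure_union_null (by rw [inter_comm]; exact G.null_Sig_ΓN)
      (by rw [inter_comm]; exact G.null_ΓD_ΓN))
  obtain ⟨r, hr, hball⟩ := exists_ball_disjoint (G.closed_Sig.union G.closed_ΓD) hx
  have hxf : x ∈ frontier G.Ωs := by rw [G.frontier_solid]; exact .inr hxN
  obtain ⟨ψ, hψ, hsub, j, hj⟩ :=
    exists_setIntegral_pd_ne_zero G.solid.isOpen G.solid.lipschitz hxf hr
  refine ⟨solidField hd G hψ j (hball.mono_left hsub), fun _ => rfl, fun _ => rfl, fun _ => rfl, ?_⟩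
  simpa [solidField, trace_testGrad] using hj

/-- Near a point of the interface that is away from the other boundary parts, the fluid lies on
the other side of the boundary of the solid. -/
theorem GraphChart.below_subset_fluid {G : Geometry d} {x : Sp d} {r : ℝ}
    (c : GraphChart G.Ωs x r) (hx : x ∈ G.Sig)
    (hball : Disjoint (Metric.ball x r) (G.Γ0 ∪ (G.ΓD ∪ G.ΓN))) : c.below ⊆ G.Ωf := by
  have hO : ∀ y ∈ c.O, y ∈ frontier G.Ωf → y ∈ frontier G.Ωs := by
    intro y hy hyf
    rw [G.frontier_fluid] at hyf
    rw [G.frontier_solid]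
    rcases hyf with h | h
    · exact .inl (.inl h)
    · exact absurd (.inl h) (disjoint_left.1 hball (c.subset_ball hy))
  have hbelow : ∀ y ∈ c.below, y ∉ frontier G.Ωs := fun y hy hyf =>
    (c.disjoint_below.closure_right c.isOpen_below).le_bot ⟨hy, frontier_subset_closure hyf⟩
  -- the connected set `below` does not meet `∂Ωf`, so that it suffices to meet `Ωf`
  refine c.isPreconnected_below.subset_left_of_subset_union G.fluid.isOpen
    (isClosed_closure (s := G.Ωf)).isOpen_compl
    (disjoint_left.2 fun y hy hy' => hy' (subset_closure hy)) (fun y hy => ?_) ?_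
  · by_cases hyc : y ∈ closure G.Ωf
    · left
      by_contra hyf
      refine hbelow y hy (hO y hy.1 ?_)
      rw [frontier, G.fluid.isOpen.interior_eq]
      exact ⟨hyc, hyf⟩
    · exact .inr hyc
  · have hxf : x ∈ closure G.Ωf :=
      frontier_subset_closure (by rw [G.frontier_fluid]; exact .inl hx)
    obtain ⟨y, hyO, hyf⟩ := mem_closure_iff.1 hxf c.O c.isOpen_O c.mem_O
    -- the open set `Ωf` contains points strictly below the graph
    by_contra hne
    rw [not_nonempty_iff_eq_empty, ← disjoint_iff_inter_eq_empty] at hne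
    have hsub : c.O ∩ G.Ωf ⊆ {z | ⟪c.e, z⟫ = c.γ (flat c.e z)} := by
      rintro z ⟨hzO, hzf⟩
      refine le_antisymm ?_ ?_
      · by_contra! h
        exact G.disjoint.le_bot ⟨hzf, (c.mem_iff z hzO).2 h⟩
      · by_contra! h
        exact hne.le_bot ⟨⟨hzO, h⟩, hzf⟩
    obtain ⟨ε, hε, hball'⟩ := Metric.isOpen_iff.1 (c.isOpen_O.inter G.fluid.isOpen) y ⟨hyO, hyf⟩
    have h1 : ⟪c.e, y⟫ = c.γ (flat c.e y) := hsub ⟨hyO, hyf⟩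
    have h2 : ⟪c.e, y + (ε / 2) • c.e⟫ = c.γ (flat c.e (y + (ε / 2) • c.e)) := by
      refine hsub (hball' ?_)
      rw [mem_ball_iff_norm, add_sub_cancel_left, norm_smul, c.norm_e, mul_one, Real.norm_eq_abs,
        abs_of_pos (by positivity)]
      linarith
    rw [flat_add, flat_smul, flat_self c.norm_e, smul_zero, add_zero, inner_add_right,
      inner_smul_right, real_inner_self_eq_norm_sq, c.norm_e, h1] at h2
    linarith

/-- A field that flows across the interface. -/
theorem exists_field_flux (hd : 1 ≤ d) (G : Geometry d) :
    ∃ Ψ : HSpace G, (∀ x, Ψ.wn x = 0) ∧ ∫ x in G.Ωs, (Ψ.Du x).trace ≠ 0 := by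
  obtain ⟨x, hxS, hx⟩ := exists_mem_notMem_of_null (A := G.Γ0 ∪ (G.ΓD ∪ G.ΓN)) G.interface_pos (by
    rw [inter_union_distrib_left, inter_union_distrib_left]
    exact measure_union_null G.null_Sig_Γ0 (measure_union_null G.null_Sig_ΓD G.null_Sig_ΓN))
  obtain ⟨r, hr, hball⟩ :=
    exists_ball_disjoint (G.closed_Γ0.union (G.closed_ΓD.union G.closed_ΓN)) hx
  have hxf : x ∈ frontier G.Ωs := by rw [G.frontier_solid]; exact .inl (.inl hxS)
  obtain ⟨c⟩ := exists_graphChart G.solid.isOpen G.solid.lipschitz hxf hr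
  obtain ⟨r', hr', hr'O⟩ := Metric.isOpen_iff.1 c.isOpen_O x c.mem_O
  obtain ⟨ψ, hψ, hsub, j, hj⟩ :=
    exists_setIntegral_pd_ne_zero G.solid.isOpen G.solid.lipschitz hxf hr'
  have hsubO : tsupport ψ ⊆ c.O := hsub.trans hr'O
  have hdis := hball.mono_left (hsubO.trans c.subset_ball)
  have hnull : volume (tsupport ψ \ (G.Ωf ∪ G.Ωs)) = 0 := by
    refine measure_mono_null ?_ (volume_frontier_eq_zero G.solid.polyhedral)
    rintro y ⟨hy, hyn⟩
    have hyO := hsubO hy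
    have hys : y ∉ G.Ωs := fun h => hyn (.inr h)
    rw [frontier, G.solid.isOpen.interior_eq]
    refine ⟨?_, hys⟩
    -- `y` is on the graph, hence a limit of points above it
    have hle : ⟪c.e, y⟫ = c.γ (flat c.e y) := by
      refine le_antisymm ?_ ?_
      · by_contra! h
        exact hys ((c.mem_iff y hyO).2 h)
      · by_contra! h
        exact hyn (.inl (c.below_subset_fluid hxS hball ⟨hyO, h⟩))
    rw [Metric.mem_closure_iff]
    intro ε hε
    obtain ⟨ρ, hρ, hρO⟩ := Metric.isOpen_iff.1 c.isOpen_O y hyO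
    have hm : 0 < min ε ρ := lt_min hε hρ
    have hnorm : ‖(min ε ρ / 2) • c.e‖ = min ε ρ / 2 := by
      rw [norm_smul, c.norm_e, mul_one, Real.norm_eq_abs, abs_of_pos (by positivity)]
    refine ⟨y + (min ε ρ / 2) • c.e, (c.mem_iff _ (hρO ?_)).2 ?_, ?_⟩
    · rw [mem_ball_iff_norm, add_sub_cancel_left, hnorm]
      linarith [min_le_right ε ρ]
    · rw [flat_add, flat_smul, flat_self c.norm_e, smul_zero, add_zero, inner_add_right,
        inner_smul_right, real_inner_self_eq_norm_sq, c.norm_e, hle]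
      linarith
    · rw [dist_eq_norm, sub_add_cancel_left, norm_neg, hnorm]
      linarith [min_le_left ε ρ]
  refine ⟨interfaceField hd G hψ j
    (hdis.mono_right (union_subset_union_right _ subset_union_left)) hnull, fun _ => rfl, ?_⟩
  simpa [interfaceField, trace_testGrad] using hj

/-! ### Pointwise algebra of the energies -/

theorem frob_add_smul (M A B : Matrix (Fin d) (Fin d) ℝ) (s : ℝ) :
    frob M (A + s • B) = frob M A + s * frob M B := by
  simp only [frob, Matrix.add_apply, Matrix.smul_apply, smul_eq_mul, mul_add,
    Finset.sum_add_distrib, Finset.mul_sum]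
  congr 1
  exact Finset.sum_congr rfl fun i _ => Finset.sum_congr rfl fun j _ => by ring

theorem frob_comm (A B : Matrix (Fin d) (Fin d) ℝ) : frob A B = frob B A := by
  simp only [frob, mul_comm]

theorem frob_self_nonneg (A : Matrix (Fin d) (Fin d) ℝ) : 0 ≤ frob A A :=
  Finset.sum_nonneg fun _ _ => Finset.sum_nonneg fun _ _ => mul_self_nonneg _

theorem frob_add_smul_self (A B : Matrix (Fin d) (Fin d) ℝ) (s : ℝ) :
    frob (A + s • B) (A + s • B) = frob A A + 2 * s * frob A B + s ^ 2 * frob B B := by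
  rw [frob_add_smul, frob_comm _ A, frob_comm _ B, frob_add_smul, frob_add_smul, frob_comm B A]
  ring

theorem frob_cross_ge (A B : Matrix (Fin d) (Fin d) ℝ) (s : ℝ) :
    1 / 2 * frob A A + -(s ^ 2 / 2) * frob B B ≤ frob A (A + s • B) := by
  have h1 := frob_self_nonneg (A + s • B)
  rw [frob_add_smul_self] at h1
  rw [frob_add_smul]
  linarith

theorem frob_add_smul_le (A B : Matrix (Fin d) (Fin d) ℝ) (s : ℝ) :
    frob (A + s • B) (A + s • B) ≤ 2 * frob A A + 2 * s ^ 2 * frob B B := by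
  have h1 := frob_self_nonneg (A + (-s) • B)
  rw [frob_add_smul_self] at h1 ⊢
  nlinarith

theorem strain_add_smul (A B : Matrix (Fin d) (Fin d) ℝ) (s : ℝ) :
    strain (A + s • B) = strain A + s • strain B := by
  ext i j
  simp [strain]
  ring

theorem frob_strain_le (A : Matrix (Fin d) (Fin d) ℝ) :
    frob (strain A) (strain A) ≤ frob A A := by
  have h1 : frob A.transpose A.transpose = frob A A := by
    simp only [frob, Matrix.transpose_apply]
    exact Finset.sum_comm
  have h2 : frob (strain A) (strain A) =
      1 / 4 * frob (A + (1 : ℝ) • A.transpose) (A + (1 : ℝ) • A.transpose) := by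
    simp only [frob, strain, Finset.mul_sum, Matrix.smul_apply, smul_eq_mul, one_smul]
    exact Finset.sum_congr rfl fun i _ => Finset.sum_congr rfl fun j _ => by ring
  have h3 := frob_add_smul_le A A.transpose 1
  rw [h1] at h3
  rw [h2]
  linarith

theorem inner_cross_ge (u v : Sp d) (s : ℝ) :
    1 / 2 * ‖u‖ ^ 2 + -(s ^ 2 / 2) * ‖v‖ ^ 2 ≤ ⟪u, u + s • v⟫ := by
  have h1 : 0 ≤ ‖u + s • v‖ ^ 2 := sq_nonneg _
  rw [norm_add_sq_real, norm_smul, inner_smul_right, mul_pow, Real.norm_eq_abs, sq_abs] at h1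
  rw [inner_add_right, inner_smul_right, real_inner_self_eq_norm_sq]
  linarith

theorem norm_add_smul_sq_le (u v : Sp d) (s : ℝ) :
    ‖u + s • v‖ ^ 2 ≤ 2 * ‖u‖ ^ 2 + 2 * s ^ 2 * ‖v‖ ^ 2 := by
  have h1 : 0 ≤ ‖u - s • v‖ ^ 2 := sq_nonneg _
  rw [norm_sub_sq_real, norm_smul, mul_pow, Real.norm_eq_abs, sq_abs] at h1
  rw [norm_add_sq_real, norm_smul, mul_pow, Real.norm_eq_abs, sq_abs]
  linarith

theorem combination_le_integral {μ : Measure (Sp d)} {P Q R : Sp d → ℝ} (hP : Integrable P μ)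
    (hQ : Integrable Q μ) (hR : Integrable R μ) {a b : ℝ}
    (h : ∀ᵐ x ∂μ, a * Q x + b * R x ≤ P x) :
    a * (∫ x, Q x ∂μ) + b * ∫ x, R x ∂μ ≤ ∫ x, P x ∂μ := by
  rw [← integral_const_mul, ← integral_const_mul, ← integral_add (hQ.const_mul a) (hR.const_mul b)]
  exact integral_mono_ae ((hQ.const_mul a).add (hR.const_mul b)) hP h

theorem integral_le_combination {μ : Measure (Sp d)} {P Q R : Sp d → ℝ} (hP : Integrable P μ)
    (hQ : Integrable Q μ) (hR : Integrable R μ) {a b : ℝ}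
    (h : ∀ᵐ x ∂μ, P x ≤ a * Q x + b * R x) :
    ∫ x, P x ∂μ ≤ a * (∫ x, Q x ∂μ) + b * ∫ x, R x ∂μ := by
  rw [← integral_const_mul, ← integral_const_mul, ← integral_add (hQ.const_mul a) (hR.const_mul b)]
  exact integral_mono_ae hP ((hQ.const_mul a).add (hR.const_mul b)) h

theorem integrable_frob {Ω : Set (Sp d)} {A B : Sp d → Matrix (Fin d) (Fin d) ℝ}
    (hA : ∀ i j, MemLp (fun x => A x i j) 2 (volume.restrict Ω))
    (hB : ∀ i j, MemLp (fun x => B x i j) 2 (volume.restrict Ω)) :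
    Integrable (fun x => frob (A x) (B x)) (volume.restrict Ω) :=
  integrable_finsetSum _ fun i _ => integrable_finsetSum _ fun j _ =>
    (hA i j).integrable_mul (hB i j)

theorem integrable_inner {Ω : Set (Sp d)} {u v : Sp d → Sp d} (hu : MemLp u 2 (volume.restrict Ω))
    (hv : MemLp v 2 (volume.restrict Ω)) :
    Integrable (fun x => ⟪u x, v x⟫) (volume.restrict Ω) := by
  simp only [PiLp.inner_apply]
  exact integrable_finsetSum _ fun i _ => (memLp_coord hv i).integrable_mul (memLp_coord hu i)

theorem integrable_norm_sq {Ω : Set (Sp d)} {u : Sp d → Sp d}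
    (hu : MemLp u 2 (volume.restrict Ω)) :
    Integrable (fun x => ‖u x‖ ^ 2) (volume.restrict Ω) :=
  hu.integrable_norm_pow (by norm_num)

/-! ### The coefficients -/

section Moduli
variable {Ω : Set (Sp d)} {E₀ E₁ : ℝ} {E ν : Sp d → ℝ}

theorem AdmissibleModuli.lameMu_bounds (h : AdmissibleModuli Ω E₀ E₁ E ν) (hE₀ : 0 < E₀) :
    ∀ᵐ x ∂(volume.restrict Ω), E₀ / 3 ≤ lameMu E ν x ∧ lameMu E ν x ≤ E₁ / 2 := by
  obtain ⟨ν₀, hν₀, hν⟩ := h.bounds_ν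
  filter_upwards [h.bounds_E, hν] with x ⟨h1, h2⟩ ⟨h3, h4⟩
  have h5 : 0 < 2 * (1 + ν x) := by linarith
  unfold lameMu
  constructor
  · rw [le_div_iff₀ h5]; nlinarith
  · rw [div_le_iff₀ h5]; nlinarith

theorem AdmissibleModuli.invLambda_nonneg (h : AdmissibleModuli Ω E₀ E₁ E ν) (hE₀ : 0 < E₀) :
    ∀ᵐ x ∂(volume.restrict Ω), 0 ≤ invLambda E ν x := by
  obtain ⟨ν₀, hν₀, hν⟩ := h.bounds_ν
  filter_upwards [h.bounds_E, hν] with x ⟨h1, h2⟩ ⟨h3, h4⟩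
  have h5 : 0 < ν x := by linarith
  have h6 : 0 < E x := by linarith
  exact div_nonneg (mul_nonneg (by linarith) (by linarith)) (by positivity)

theorem AdmissibleModuli.aemeasurable_lameMu (h : AdmissibleModuli Ω E₀ E₁ E ν) :
    AEMeasurable (lameMu E ν) (volume.restrict Ω) :=
  h.measurable_E.div ((h.measurable_ν.const_add 1).const_mul 2)

theorem AdmissibleModuli.integrable_lameMu_mul (h : AdmissibleModuli Ω E₀ E₁ E ν) (hE₀ : 0 < E₀)
    {f : Sp d → ℝ} (hf : Integrable f (volume.restrict Ω)) :
    Integrable (fun x => lameMu E ν x * f x) (volume.restrict Ω) := by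
  refine hf.bdd_mul (c := E₁ / 2) h.aemeasurable_lameMu.aestronglyMeasurable ?_
  filter_upwards [h.lameMu_bounds hE₀] with x ⟨h1, h2⟩
  rwa [Real.norm_eq_abs, abs_of_nonneg (by linarith)]

theorem AdmissibleModuli.integrable_inv_lameMu_mul (h : AdmissibleModuli Ω E₀ E₁ E ν)
    (hE₀ : 0 < E₀) {f : Sp d → ℝ} (hf : Integrable f (volume.restrict Ω)) :
    Integrable (fun x => (lameMu E ν x)⁻¹ * f x) (volume.restrict Ω) := by
  refine hf.bdd_mul (c := (E₀ / 3)⁻¹) h.aemeasurable_lameMu.inv.aestronglyMeasurable ?_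
  filter_upwards [h.lameMu_bounds hE₀] with x ⟨h1, h2⟩
  have h3 : 0 < lameMu E ν x := by linarith
  rw [Real.norm_eq_abs, abs_of_pos (by positivity)]
  gcongr

end Moduli

/-! ### Energies -/

section Energy
variable (G : Geometry d) (ρs ρf c g : ℝ) (E ν : Sp d → ℝ)

/-- The part of `|||·|||²` that belongs to the fluid. -/
def fluidSq (X : HSpace G) : ℝ :=
  (∫ x in G.Ωf, c ^ 2 * ρf * X.dw x ^ 2) + (∫ x in G.Ωf, ρf * ‖X.w x‖ ^ 2)
  + (∫ x in G.Γ0, g * ρf * X.wn x ^ 2 ∂(surf d))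

/-- The part of `|||·|||²` that belongs to the displacement of the solid. -/
def solidSq (X : HSpace G) : ℝ :=
  (∫ x in G.Ωs, lameMu E ν x * frob (X.Du x) (X.Du x)) + ∫ x in G.Ωs, ρs * ‖X.u x‖ ^ 2

/-- The diagonal of the elastic and inertial part of `A` in the solid: `∫ 2μ |ε(u)|² + ρs |u|²`. -/
def strainSq (X : HSpace G) : ℝ :=
  (∫ x in G.Ωs, 2 * lameMu E ν x * frob (strain (X.Du x)) (strain (X.Du x)))
    + ∫ x in G.Ωs, ρs * ‖X.u x‖ ^ 2

/-- The part of `|||·|||²` that belongs to the pressure. -/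
def pressureSq (X : HSpace G) : ℝ :=
  (∫ x in G.Ωs, (lameMu E ν x)⁻¹ * X.p x ^ 2) + ∫ x in G.Ωs, invLambda E ν x * X.p x ^ 2

theorem normHSq_eq (X : HSpace G) : normHSq G ρs ρf c g E ν X =
    solidSq G ρs E ν X + pressureSq G E ν X + fluidSq G ρf c g X := by
  unfold normHSq solidSq pressureSq fluidSq
  ring

end Energy

section Estimates
variable {G : Geometry d} {ρs ρf c g : ℝ} {E₀ E₁ : ℝ} {E ν : Sp d → ℝ}

theorem fluidSq_nonneg (hρf : 0 < ρf) (hg : 0 < g) (X : HSpace G) : 0 ≤ fluidSq G ρf c g X := by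
  unfold fluidSq
  have h1 : 0 ≤ ∫ x in G.Ωf, c ^ 2 * ρf * X.dw x ^ 2 := integral_nonneg fun _ => by positivity
  have h2 : 0 ≤ ∫ x in G.Ωf, ρf * ‖X.w x‖ ^ 2 := integral_nonneg fun _ => by positivity
  have h3 : 0 ≤ ∫ x in G.Γ0, g * ρf * X.wn x ^ 2 ∂(surf d) :=
    integral_nonneg fun _ => by positivity
  positivity

theorem solidSq_nonneg (hadm : AdmissibleModuli G.Ωs E₀ E₁ E ν) (hE₀ : 0 < E₀) (hρs : 0 < ρs)
    (X : HSpace G) : 0 ≤ solidSq G ρs E ν X := by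
  have h1 : 0 ≤ ∫ x in G.Ωs, lameMu E ν x * frob (X.Du x) (X.Du x) := by
    refine integral_nonneg_of_ae ?_
    filter_upwards [hadm.lameMu_bounds hE₀] with x ⟨h1, _⟩
    exact mul_nonneg (by linarith) (frob_self_nonneg _)
  have h2 : 0 ≤ ∫ x in G.Ωs, ρs * ‖X.u x‖ ^ 2 := integral_nonneg fun _ => by positivity
  exact add_nonneg h1 h2

theorem integral_invLambda_sq_nonneg (hadm : AdmissibleModuli G.Ωs E₀ E₁ E ν) (hE₀ : 0 < E₀)
    (X : HSpace G) : 0 ≤ ∫ x in G.Ωs, invLambda E ν x * X.p x ^ 2 := by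
  refine integral_nonneg_of_ae ?_
  filter_upwards [hadm.invLambda_nonneg hE₀] with x h1
  exact mul_nonneg h1 (sq_nonneg _)

theorem fluidSq_addSmul_le (hd : 1 ≤ d) (hρf : 0 < ρf) (hg : 0 < g) (X Z : HSpace G) (s : ℝ)
    (q : Sp d → ℝ) (hq : MemLp q 2 (volume.restrict G.Ωs)) :
    fluidSq G ρf c g (X.addSmul hd Z s q hq) ≤
      2 * fluidSq G ρf c g X + 2 * s ^ 2 * fluidSq G ρf c g Z := by
  have hsq : ∀ {k : ℝ}, 0 ≤ k → ∀ a b : ℝ,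
      k * (a + s * b) ^ 2 ≤ 2 * (k * a ^ 2) + 2 * s ^ 2 * (k * b ^ 2) := by
    intro k hk a b
    have := mul_nonneg hk (sq_nonneg (a - s * b))
    linarith
  set Y := X.addSmul hd Z s q hq with hY
  have h1 := integral_le_combination (a := 2) (b := 2 * s ^ 2)
    (Y.w_mem.2.1.integrable_sq.const_mul (c ^ 2 * ρf))
    (X.w_mem.2.1.integrable_sq.const_mul (c ^ 2 * ρf))
    (Z.w_mem.2.1.integrable_sq.const_mul (c ^ 2 * ρf))
    (Eventually.of_forall fun x => hsq (by positivity) (X.dw x) (Z.dw x))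
  have h2 := integral_le_combination (a := 2) (b := 2 * s ^ 2)
    ((integrable_norm_sq Y.w_mem.1).const_mul ρf) ((integrable_norm_sq X.w_mem.1).const_mul ρf)
    ((integrable_norm_sq Z.w_mem.1).const_mul ρf)
    (Eventually.of_forall fun x => by
      have := mul_le_mul_of_nonneg_left (norm_add_smul_sq_le (X.w x) (Z.w x) s) hρf.le
      simp only [hY, HSpace.addSmul]
      linarith)
  have h3 := integral_le_combination (a := 2) (b := 2 * s ^ 2)
    (Y.w_normal.1.integrable_sq.const_mul (g * ρf))
    (X.w_normal.1.integrable_sq.const_mul (g * ρf))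
    (Z.w_normal.1.integrable_sq.const_mul (g * ρf))
    (Eventually.of_forall fun x => hsq (by positivity) (X.wn x) (Z.wn x))
  unfold fluidSq
  linarith

theorem solidSq_addSmul_le (hd : 1 ≤ d) (hadm : AdmissibleModuli G.Ωs E₀ E₁ E ν) (hE₀ : 0 < E₀)
    (hρs : 0 < ρs) (X Z : HSpace G) (s : ℝ) (q : Sp d → ℝ)
    (hq : MemLp q 2 (volume.restrict G.Ωs)) :
    solidSq G ρs E ν (X.addSmul hd Z s q hq) ≤
      2 * solidSq G ρs E ν X + 2 * s ^ 2 * solidSq G ρs E ν Z := by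
  set Y := X.addSmul hd Z s q hq with hY
  have hI : ∀ W : HSpace G, Integrable (fun x => lameMu E ν x * frob (W.Du x) (W.Du x))
      (volume.restrict G.Ωs) := fun W =>
    hadm.integrable_lameMu_mul hE₀ (integrable_frob W.u_mem.2.1 W.u_mem.2.1)
  have h1 := integral_le_combination (a := 2) (b := 2 * s ^ 2) (hI Y) (hI X) (hI Z) (by
    filter_upwards [hadm.lameMu_bounds hE₀] with x ⟨hx, _⟩
    have hx0 : 0 ≤ lameMu E ν x := by linarith
    have := mul_le_mul_of_nonneg_left (frob_add_smul_le (X.Du x) (Z.Du x) s) hx0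
    simp only [hY, HSpace.addSmul]
    linarith)
  have h2 := integral_le_combination (a := 2) (b := 2 * s ^ 2)
    ((integrable_norm_sq Y.u_mem.1).const_mul ρs) ((integrable_norm_sq X.u_mem.1).const_mul ρs)
    ((integrable_norm_sq Z.u_mem.1).const_mul ρs)
    (Eventually.of_forall fun x => by
      have := mul_le_mul_of_nonneg_left (norm_add_smul_sq_le (X.u x) (Z.u x) s) hρs.le
      simp only [hY, HSpace.addSmul]
      linarith)
  unfold solidSq
  linarith

/-- With the test function `X + s Z` with pressure `-p`, the mixed terms of `A` cancel up to the
pairing of `p` with the divergence of `Z`. -/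
theorem formA_addSmul_ge (hd : 1 ≤ d) (hadm : AdmissibleModuli G.Ωs E₀ E₁ E ν) (hE₀ : 0 < E₀)
    (hρs : 0 < ρs) (hρf : 0 < ρf) (hg : 0 < g) (X Z : HSpace G) (s : ℝ) :
    (strainSq G ρs E ν X + fluidSq G ρf c g X) / 2
      - s ^ 2 * (solidSq G ρs E ν Z + fluidSq G ρf c g Z)
      + s * - (∫ x in G.Ωs, X.p x * (Z.Du x).trace)
      + (∫ x in G.Ωs, invLambda E ν x * X.p x ^ 2) ≤
      formA G ρs ρf c g E ν X (X.addSmul hd Z s (fun x => -X.p x) X.p_mem.neg) := by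
  set Y := X.addSmul hd Z s (fun x => -X.p x) X.p_mem.neg with hY
  have hcross : ∀ {k : ℝ}, 0 ≤ k → ∀ a b : ℝ,
      1 / 2 * (k * a ^ 2) + -(s ^ 2 / 2) * (k * b ^ 2) ≤ k * (a * (a + s * b)) := by
    intro k hk a b
    have := mul_nonneg hk (sq_nonneg (a + s * b))
    linarith
  have hstr : ∀ W : HSpace G, ∀ i j,
      MemLp (fun x => strain (W.Du x) i j) 2 (volume.restrict G.Ωs) :=
    fun W => memLp_strain W.u_mem.2.1
  have hI : ∀ V W : HSpace G, Integrable
      (fun x => 2 * lameMu E ν x * frob (strain (V.Du x)) (strain (W.Du x)))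
      (volume.restrict G.Ωs) := fun V W => by
    simpa only [mul_assoc] using
      (hadm.integrable_lameMu_mul hE₀ (integrable_frob (hstr V) (hstr W))).const_mul 2
  have h1 := combination_le_integral (a := 1 / 2) (b := -(s ^ 2 / 2)) (hI X Y) (hI X X) (hI Z Z) (by
    filter_upwards [hadm.lameMu_bounds hE₀] with x ⟨hx, _⟩
    have hx0 : 0 ≤ 2 * lameMu E ν x := by linarith
    have := mul_le_mul_of_nonneg_left (frob_cross_ge (strain (X.Du x)) (strain (Z.Du x)) s) hx0
    simp only [hY, HSpace.addSmul, strain_add_smul]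
    linarith)
  have h1' : ∫ x in G.Ωs, 2 * lameMu E ν x * frob (strain (Z.Du x)) (strain (Z.Du x)) ≤
      2 * ∫ x in G.Ωs, lameMu E ν x * frob (Z.Du x) (Z.Du x) := by
    rw [← integral_const_mul]
    refine integral_mono_ae (hI Z Z) ((hadm.integrable_lameMu_mul hE₀
      (integrable_frob Z.u_mem.2.1 Z.u_mem.2.1)).const_mul 2) ?_
    filter_upwards [hadm.lameMu_bounds hE₀] with x ⟨hx, _⟩
    have hx0 : 0 ≤ 2 * lameMu E ν x := by linarith
    have := mul_le_mul_of_nonneg_left (frob_strain_le (Z.Du x)) hx0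
    linarith
  have h2 := combination_le_integral (a := 1 / 2) (b := -(s ^ 2 / 2))
    ((X.w_mem.2.1.integrable_mul Y.w_mem.2.1).const_mul (c ^ 2 * ρf))
    (X.w_mem.2.1.integrable_sq.const_mul (c ^ 2 * ρf))
    (Z.w_mem.2.1.integrable_sq.const_mul (c ^ 2 * ρf))
    (Eventually.of_forall fun x => hcross (by positivity) (X.dw x) (Z.dw x))
  have h3 := combination_le_integral (a := 1 / 2) (b := -(s ^ 2 / 2))
    ((X.w_normal.1.integrable_mul Y.w_normal.1).const_mul (g * ρf))
    (X.w_normal.1.integrable_sq.const_mul (g * ρf))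
    (Z.w_normal.1.integrable_sq.const_mul (g * ρf))
    (Eventually.of_forall fun x => hcross (by positivity) (X.wn x) (Z.wn x))
  have h4 := combination_le_integral (a := 1 / 2) (b := -(s ^ 2 / 2))
    ((integrable_inner X.u_mem.1 Y.u_mem.1).const_mul ρs)
    ((integrable_norm_sq X.u_mem.1).const_mul ρs) ((integrable_norm_sq Z.u_mem.1).const_mul ρs)
    (Eventually.of_forall fun x => by
      have := mul_le_mul_of_nonneg_left (inner_cross_ge (X.u x) (Z.u x) s) hρs.le
      simp only [hY, HSpace.addSmul]
      linarith)
  have h5 := combination_le_integral (a := 1 / 2) (b := -(s ^ 2 / 2))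
    ((integrable_inner X.w_mem.1 Y.w_mem.1).const_mul ρf)
    ((integrable_norm_sq X.w_mem.1).const_mul ρf) ((integrable_norm_sq Z.w_mem.1).const_mul ρf)
    (Eventually.of_forall fun x => by
      have := mul_le_mul_of_nonneg_left (inner_cross_ge (X.w x) (Z.w x) s) hρf.le
      simp only [hY, HSpace.addSmul]
      linarith)
  have h6 : ∫ x in G.Ωs, X.p x * (Y.Du x).trace =
      (∫ x in G.Ωs, X.p x * (X.Du x).trace) + s * ∫ x in G.Ωs, X.p x * (Z.Du x).trace := by
    have := integral_add_smul_mul (memLp_trace X.u_mem.2.1) (memLp_trace Z.u_mem.2.1) X.p_mem s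
    simp only [mul_comm (X.p _)]
    rw [← this]
    congr 1
    ext x
    simp [hY, HSpace.addSmul]
  have h7 : ∫ x in G.Ωs, Y.p x * (X.Du x).trace = -∫ x in G.Ωs, X.p x * (X.Du x).trace := by
    rw [← integral_neg]
    congr 1
    ext x
    simp [hY, HSpace.addSmul]
  have h8 : ∫ x in G.Ωs, invLambda E ν x * (X.p x * Y.p x) =
      -∫ x in G.Ωs, invLambda E ν x * X.p x ^ 2 := by
    rw [← integral_neg]
    congr 1
    ext x
    simp only [hY, HSpace.addSmul]
    ring
  have h9 : 0 ≤ ∫ x in G.Ωs, ρs * ‖Z.u x‖ ^ 2 := integral_nonneg fun _ => by positivity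
  have h10 := fluidSq_nonneg (c := c) hρf hg Z
  have h11 := mul_le_mul_of_nonneg_left h1' (by positivity : 0 ≤ s ^ 2 / 2)
  have h12 := mul_nonneg (by positivity : 0 ≤ s ^ 2 / 2) h9
  have h13 := mul_nonneg (by positivity : 0 ≤ s ^ 2 / 2) h10
  simp only [Pi.mul_apply] at h2 h3
  unfold formA formB strainSq solidSq
  unfold fluidSq at h13 ⊢
  rw [h6, h7, h8]
  linarith

/-- Korn's inequality bounds the gradient term of the norm by the strain energy. -/
theorem solidSq_le (hadm : AdmissibleModuli G.Ωs E₀ E₁ E ν) (hE₀ : 0 < E₀) (hE₁ : E₀ ≤ E₁)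
    (hρs : 0 < ρs) {K : ℝ} (hK : 0 ≤ K) (X : HSpace G)
    (hkorn : ∫ x in G.Ωs, frob (X.Du x) (X.Du x) ≤
      K * ((∫ x in G.Ωs, frob (strain (X.Du x)) (strain (X.Du x))) + ∫ x in G.Ωs, ‖X.u x‖ ^ 2)) :
    solidSq G ρs E ν X ≤ (E₁ / 2 * K * (3 / (2 * E₀) + 1 / ρs) + 1) * strainSq G ρs E ν X := by
  have hstr := memLp_strain X.u_mem.2.1
  have hE₁0 : 0 < E₁ := hE₀.trans_le hE₁
  have h1 : ∫ x in G.Ωs, lameMu E ν x * frob (X.Du x) (X.Du x) ≤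
      E₁ / 2 * ∫ x in G.Ωs, frob (X.Du x) (X.Du x) := by
    rw [← integral_const_mul]
    have hi := integrable_frob X.u_mem.2.1 X.u_mem.2.1
    refine integral_mono_ae (hadm.integrable_lameMu_mul hE₀ hi) (hi.const_mul _) ?_
    filter_upwards [hadm.lameMu_bounds hE₀] with x ⟨_, hx⟩
    exact mul_le_mul_of_nonneg_right hx (frob_self_nonneg _)
  have h2 : ∫ x in G.Ωs, frob (strain (X.Du x)) (strain (X.Du x)) ≤ 3 / (2 * E₀) *
      ∫ x in G.Ωs, 2 * lameMu E ν x * frob (strain (X.Du x)) (strain (X.Du x)) := by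
    rw [← integral_const_mul]
    have hi := integrable_frob hstr hstr
    refine integral_mono_ae hi (Integrable.const_mul ?_ _) ?_
    · simpa only [mul_assoc] using (hadm.integrable_lameMu_mul hE₀ hi).const_mul 2
    filter_upwards [hadm.lameMu_bounds hE₀] with x ⟨hx, _⟩
    have h3 : 1 ≤ 3 / (2 * E₀) * (2 * lameMu E ν x) := by
      rw [div_mul_eq_mul_div, le_div_iff₀ (by positivity)]
      linarith
    rw [← mul_assoc]
    exact le_mul_of_one_le_left (frob_self_nonneg _) h3
  have h3 : ∫ x in G.Ωs, ‖X.u x‖ ^ 2 = 1 / ρs * ∫ x in G.Ωs, ρs * ‖X.u x‖ ^ 2 := by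
    rw [integral_const_mul]; field_simp
  have h4 : 0 ≤ ∫ x in G.Ωs, 2 * lameMu E ν x * frob (strain (X.Du x)) (strain (X.Du x)) := by
    refine integral_nonneg_of_ae ?_
    filter_upwards [hadm.lameMu_bounds hE₀] with x ⟨hx, _⟩
    exact mul_nonneg (by linarith) (frob_self_nonneg _)
  have h5 : 0 ≤ ∫ x in G.Ωs, ρs * ‖X.u x‖ ^ 2 := integral_nonneg fun _ => by positivity
  rw [h3] at hkorn
  unfold solidSq strainSq
  set S := ∫ x in G.Ωs, 2 * lameMu E ν x * frob (strain (X.Du x)) (strain (X.Du x))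
  set U := ∫ x in G.Ωs, ρs * ‖X.u x‖ ^ 2
  calc _ ≤ E₁ / 2 * (K * (3 / (2 * E₀) * S + 1 / ρs * U)) + U := by
        gcongr
        exact h1.trans (by gcongr; exact hkorn.trans (by gcongr))
    _ ≤ E₁ / 2 * (K * (3 / (2 * E₀) * (S + U) + 1 / ρs * (S + U))) + (S + U) := by
        gcongr <;> linarith
    _ = _ := by ring

theorem integral_inv_lameMu_sq_le (hadm : AdmissibleModuli G.Ωs E₀ E₁ E ν) (hE₀ : 0 < E₀)
    (X : HSpace G) : ∫ x in G.Ωs, (lameMu E ν x)⁻¹ * X.p x ^ 2 ≤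
      3 / E₀ * ∫ x in G.Ωs, X.p x ^ 2 := by
  rw [← integral_const_mul]
  refine integral_mono_ae (hadm.integrable_inv_lameMu_mul hE₀ X.p_mem.integrable_sq)
    (X.p_mem.integrable_sq.const_mul _) ?_
  filter_upwards [hadm.lameMu_bounds hE₀] with x ⟨hx, _⟩
  refine mul_le_mul_of_nonneg_right ?_ (sq_nonneg _)
  rw [← inv_div]
  exact inv_anti₀ (by positivity) hx

theorem integral_sq_le_normHSq (hadm : AdmissibleModuli G.Ωs E₀ E₁ E ν) (hE₀ : 0 < E₀)
    (hE₁ : E₀ ≤ E₁) (hρs : 0 < ρs) (hρf : 0 < ρf) (hg : 0 < g) (X : HSpace G) :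
    ∫ x in G.Ωs, X.p x ^ 2 ≤ E₁ / 2 * normHSq G ρs ρf c g E ν X := by
  have hE₁0 : 0 < E₁ := hE₀.trans_le hE₁
  have h1 : ∫ x in G.Ωs, X.p x ^ 2 ≤ E₁ / 2 * ∫ x in G.Ωs, (lameMu E ν x)⁻¹ * X.p x ^ 2 := by
    rw [← integral_const_mul]
    refine integral_mono_ae X.p_mem.integrable_sq
      ((hadm.integrable_inv_lameMu_mul hE₀ X.p_mem.integrable_sq).const_mul _) ?_
    filter_upwards [hadm.lameMu_bounds hE₀] with x ⟨hx, hx'⟩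
    have h0 : 0 < lameMu E ν x := by linarith
    rw [← mul_assoc]
    refine le_mul_of_one_le_left (sq_nonneg _) ?_
    rw [← div_eq_mul_inv, le_div_iff₀ h0]
    linarith
  refine h1.trans ?_
  rw [normHSq_eq]
  gcongr
  unfold pressureSq
  linarith [solidSq_nonneg hadm hE₀ hρs X, fluidSq_nonneg (c := c) hρf hg X,
    integral_invLambda_sq_nonneg hadm hE₀ X]

end Estimates

/-! ### The inf-sup condition -/

theorem frob_testGrad (ψ : Sp d → ℝ) (j : Fin d) (x : Sp d) :
    frob (testGrad ψ j x) (testGrad ψ j x) = ∑ k, pd k ψ x ^ 2 := by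
  unfold frob
  rw [Finset.sum_eq_single j (fun i _ hi => by simp [testGrad, hi]) (by simp)]
  simp [testGrad, sq]

theorem solidSq_solidField_le (hd : 1 ≤ d) {G : Geometry d} {E₀ E₁ ρs : ℝ} {E ν : Sp d → ℝ}
    (hadm : AdmissibleModuli G.Ωs E₀ E₁ E ν) (hE₀ : 0 < E₀) (hE₁ : E₀ ≤ E₁) (hρs : 0 < ρs)
    {R : ℝ} {ψ : Sp d → ℝ} (h : IsTest ψ) (hR : tsupport ψ ⊆ Metric.closedBall 0 R) (j : Fin d)
    (hψ : Disjoint (tsupport ψ) (G.Sig ∪ G.ΓD)) :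
    solidSq G ρs E ν (solidField hd G h j hψ) ≤
      (E₁ / 2 + ρs * (4 * R ^ 2)) * ∫ x, ∑ k, pd k ψ x ^ 2 := by
  have hE₁0 : 0 < E₁ := hE₀.trans_le hE₁
  have hi : Integrable (fun x => ∑ k, pd k ψ x ^ 2) volume :=
    integrable_finsetSum _ fun k _ => ((h.pd k).memLp (p := 2) _).integrable_sq
  have h1 : ∫ x in G.Ωs, lameMu E ν x * frob (testGrad ψ j x) (testGrad ψ j x) ≤
      E₁ / 2 * ∫ x, ∑ k, pd k ψ x ^ 2 := by
    simp only [frob_testGrad]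
    calc _ ≤ ∫ x in G.Ωs, E₁ / 2 * ∑ k, pd k ψ x ^ 2 := by
          refine integral_mono_ae (hadm.integrable_lameMu_mul hE₀ hi.integrableOn)
            (hi.integrableOn.const_mul _) ?_
          filter_upwards [hadm.lameMu_bounds hE₀] with x ⟨_, hx⟩
          exact mul_le_mul_of_nonneg_right hx (Finset.sum_nonneg fun _ _ => sq_nonneg _)
      _ ≤ _ := by
          rw [integral_const_mul]
          refine mul_le_mul_of_nonneg_left (setIntegral_le_integral hi
            (Eventually.of_forall fun x => Finset.sum_nonneg fun _ _ => sq_nonneg _)) ?_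
          positivity
  have h2 : ∫ x in G.Ωs, ρs * ‖testField ψ j x‖ ^ 2 ≤
      ρs * (4 * R ^ 2 * ∫ x, ∑ k, pd k ψ x ^ 2) := by
    simp only [norm_testField, sq_abs]
    rw [integral_const_mul]
    refine mul_le_mul_of_nonneg_left ?_ hρs.le
    refine (setIntegral_sq_le h).trans ((poincare h hR j).trans ?_)
    exact mul_le_mul_of_nonneg_left (integral_pd_sq_le_sum h j) (by positivity)
  unfold solidSq
  simp only [solidField]
  linarith

/-- Every pressure has a test displacement, with energy bounded by the pressure, against whose
divergence it is coercive. Besides fields with compact support in the solid only multiples of the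
given field `Ψ` occur, so that in the fluid nothing but the energy of `Ψ` enters. -/
theorem exists_pressure_test (hd : 1 ≤ d) (G : Geometry d) {E₀ E₁ ρs : ℝ} (hE₀ : 0 < E₀)
    (hE₁ : E₀ ≤ E₁) (hρs : 0 < ρs) (Ψ : HSpace G) (hΨ : ∫ x in G.Ωs, (Ψ.Du x).trace ≠ 0)
    (M : ℝ) :
    ∃ β C₁ : ℝ, 0 < β ∧ 0 < C₁ ∧ ∀ ρf c g : ℝ, 0 < ρf → 0 < g → fluidSq G ρf c g Ψ ≤ M →
      ∀ E ν : Sp d → ℝ, AdmissibleModuli G.Ωs E₀ E₁ E ν → ∀ X : HSpace G, ∃ Z : HSpace G,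
        β * (∫ x in G.Ωs, X.p x ^ 2) ≤ - (∫ x in G.Ωs, X.p x * (Z.Du x).trace) ∧
        solidSq G ρs E ν Z + fluidSq G ρf c g Z ≤ C₁ * ∫ x in G.Ωs, X.p x ^ 2 := by
  have hE₁0 : 0 < E₁ := hE₀.trans_le hE₁
  have hosc := oscBound_of_lipschitz G.solid.isOpen G.solid.isConnected G.solid.isBounded
    G.solid.lipschitz
  obtain ⟨R, hR⟩ := G.solid.isBounded.subset_closedBall 0
  obtain ⟨C, hC, htest⟩ := exists_div_test hosc hd G.solid.isOpen G.solid.isConnected.nonempty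
    G.solid.isBounded (memLp_trace Ψ.u_mem.2.1) hΨ
  set D := E₁ / 2 * (∫ x in G.Ωs, frob (Ψ.Du x) (Ψ.Du x)) + ∫ x in G.Ωs, ρs * ‖Ψ.u x‖ ^ 2 with hD
  have hD0 : 0 ≤ D := by
    have h1 : 0 ≤ ∫ x in G.Ωs, frob (Ψ.Du x) (Ψ.Du x) := integral_nonneg fun _ => frob_self_nonneg _
    have h2 : 0 ≤ ∫ x in G.Ωs, ρs * ‖Ψ.u x‖ ^ 2 := integral_nonneg fun _ => by positivity
    positivity
  refine ⟨1 / C, 2 * ((E₁ / 2 + ρs * (4 * R ^ 2)) * C) + 2 * C * (D + |M|), by positivity,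
    by positivity, fun ρf c g hρf hg hM E ν hadm X => ?_⟩
  obtain ⟨φ, j, α, hφ, hsub, hpair, hgrad, hα⟩ := htest X.p X.p_mem
  set P := ∫ x in G.Ωs, X.p x ^ 2 with hP
  have hP0 : 0 ≤ P := integral_nonneg fun _ => sq_nonneg _
  have hdis : Disjoint (tsupport φ) (G.Sig ∪ G.ΓD) := by
    have h1 : Disjoint G.Ωs (frontier G.Ωs) := by
      rw [frontier, G.solid.isOpen.interior_eq]
      exact disjoint_sdiff_right
    rw [G.frontier_solid] at h1
    exact (h1.mono_right subset_union_left).mono_left hsub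
  set Y := solidField hd G hφ j hdis with hY
  refine ⟨Y.addSmul hd Ψ α (fun _ => 0) MemLp.zero', ?_, ?_⟩
  · have h1 : ∫ x in G.Ωs, X.p x * ((Y.addSmul hd Ψ α (fun _ => 0) MemLp.zero').Du x).trace =
        (∫ x in G.Ωs, X.p x * pd j φ x) + α * ∫ x in G.Ωs, X.p x * (Ψ.Du x).trace := by
      have := integral_add_smul_mul ((hφ.pd j).memLp (p := 2) (volume.restrict G.Ωs))
        (memLp_trace Ψ.u_mem.2.1) X.p_mem α
      simp only [mul_comm (X.p _)]
      rw [← this]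
      congr 1
      ext x
      simp [hY, HSpace.addSmul, solidField, trace_testGrad]
    rw [h1, one_div, inv_mul_le_iff₀ hC]
    exact hpair
  · have hYs := solidSq_solidField_le hd hadm hE₀ hE₁ hρs hφ (hsub.trans hR) j hdis
    have hYf : fluidSq G ρf c g Y = 0 := by simp [fluidSq, hY, solidField]
    have hΨs : solidSq G ρs E ν Ψ ≤ D := by
      rw [hD, ← integral_const_mul]
      unfold solidSq
      gcongr ?_ + _
      have hi := integrable_frob Ψ.u_mem.2.1 Ψ.u_mem.2.1
      refine integral_mono_ae (hadm.integrable_lameMu_mul hE₀ hi) (hi.const_mul _) ?_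
      filter_upwards [hadm.lameMu_bounds hE₀] with x ⟨_, hx⟩
      exact mul_le_mul_of_nonneg_right hx (frob_self_nonneg _)
    have h1 := solidSq_addSmul_le hd hadm hE₀ hρs Y Ψ α (fun _ => 0) MemLp.zero'
    have h2 := fluidSq_addSmul_le (c := c) hd hρf hg Y Ψ α (fun _ => 0) MemLp.zero'
    rw [hYf] at h2
    calc _ ≤ 2 * ((E₁ / 2 + ρs * (4 * R ^ 2)) * ∫ x, ∑ k, pd k φ x ^ 2)
          + 2 * α ^ 2 * (solidSq G ρs E ν Ψ + fluidSq G ρf c g Ψ) := by linarith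
      _ ≤ 2 * ((E₁ / 2 + ρs * (4 * R ^ 2)) * (C * P)) + 2 * (C * P) * (D + |M|) := by
          have h3 : solidSq G ρs E ν Ψ + fluidSq G ρf c g Ψ ≤ D + |M| :=
            add_le_add hΨs (hM.trans (le_abs_self M))
          have h4 : 0 ≤ solidSq G ρs E ν Ψ + fluidSq G ρf c g Ψ :=
            add_nonneg (solidSq_nonneg hadm hE₀ hρs Ψ) (fluidSq_nonneg hρf hg Ψ)
          gcongr
      _ = _ := by ring

theorem absorb_le {L N H T V I F : ℝ} (hL : 0 ≤ L) (hN : 1 ≤ N) (hH : 0 ≤ H) (hT : 0 ≤ T)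
    (hV : 0 ≤ V) (hI : 0 ≤ I) (h : T / 2 + V + I ≤ F) :
    L * T + H * V + I ≤ (N + 2 * L + H) * F := by
  have h1 := mul_le_mul_of_nonneg_left h (by linarith : 0 ≤ N + 2 * L + H)
  have h2 := mul_nonneg (by linarith : 0 ≤ N + H) hT
  have h3 := mul_nonneg (by linarith : 0 ≤ N + 2 * L) hV
  have h4 := mul_nonneg (by linarith : 0 ≤ N - 1 + 2 * L + H) hI
  linarith

/-- Stability with a constant that depends on the fluid only through a bound for the energy of
the given field `Ψ` in the fluid. -/
theorem exists_infSupStable (hd : 1 ≤ d) (G : Geometry d) {E₀ E₁ ρs : ℝ} (hE₀ : 0 < E₀)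
    (hE₁ : E₀ ≤ E₁) (hρs : 0 < ρs) (Ψ : HSpace G) (hΨ : ∫ x in G.Ωs, (Ψ.Du x).trace ≠ 0)
    (M : ℝ) :
    ∃ C : ℝ, 0 < C ∧ ∀ ρf c g : ℝ, 0 < ρf → 0 < g → fluidSq G ρf c g Ψ ≤ M →
      ∀ E ν : Sp d → ℝ, AdmissibleModuli G.Ωs E₀ E₁ E ν → InfSupStable G ρs ρf c g E ν C := by
  have hE₁0 : 0 < E₁ := hE₀.trans_le hE₁
  obtain ⟨K, hK, hkorn⟩ := korn (oscBound_of_lipschitz G.solid.isOpen G.solid.isConnected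
    G.solid.isBounded G.solid.lipschitz) G.solid.isOpen G.solid.isConnected.nonempty
    G.solid.isBounded
  obtain ⟨β, C₁, hβ, hC₁, htest⟩ := exists_pressure_test hd G hE₀ hE₁ hρs Ψ hΨ M
  set L := E₁ / 2 * K * (3 / (2 * E₀) + 1 / ρs) + 1 with hL
  have hL1 : 1 ≤ L := by
    have : 0 ≤ E₁ / 2 * K * (3 / (2 * E₀) + 1 / ρs) := by positivity
    linarith
  -- the weight of the test displacement is balanced so that its energy is absorbed
  set δ := β / (2 * C₁) with hδ
  have hδ0 : 0 < δ := by positivity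
  set N := 2 + δ ^ 2 * C₁ * E₁ with hN
  have hN1 : 1 ≤ N := by
    have : 0 ≤ δ ^ 2 * C₁ * E₁ := by positivity
    linarith
  refine ⟨N + 2 * L + 3 / E₀ * (4 * C₁ / β ^ 2), by positivity,
    fun ρf c g hρf hg hM E ν hadm X => ?_⟩
  obtain ⟨Z, hpair, hbound⟩ := htest ρf c g hρf hg hM E ν hadm X
  have hX0 : ∀ W : HSpace G, 0 ≤ normHSq G ρs ρf c g E ν W := by
    intro W
    have h1 : 0 ≤ ∫ x in G.Ωs, W.p x ^ 2 := integral_nonneg fun _ => sq_nonneg _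
    have h2 := h1.trans (integral_sq_le_normHSq (c := c) hadm hE₀ hE₁ hρs hρf hg W)
    exact nonneg_of_mul_nonneg_right h2 (by positivity)
  have hPX := integral_sq_le_normHSq (c := c) hadm hE₀ hE₁ hρs hρf hg X
  have hA := formA_addSmul_ge (c := c) hd hadm hE₀ hρs hρf hg X Z δ
  have hsX := solidSq_le hadm hE₀ hE₁ hρs hK X (hkorn _ _ X.u_mem)
  have hpX := integral_inv_lameMu_sq_le hadm hE₀ X
  have hI0 := integral_invLambda_sq_nonneg hadm hE₀ X
  have hF0 := fluidSq_nonneg (c := c) hρf hg X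
  have hS0 : 0 ≤ strainSq G ρs E ν X :=
    nonneg_of_mul_nonneg_right ((solidSq_nonneg hadm hE₀ hρs X).trans hsX) (by linarith)
  set P := ∫ x in G.Ωs, X.p x ^ 2 with hP
  have hP0 : 0 ≤ P := integral_nonneg fun _ => sq_nonneg _
  set W := X.addSmul hd Z δ (fun x => -X.p x) X.p_mem.neg with hW
  have hWsq : normHSq G ρs ρf c g E ν W ≤ N * normHSq G ρs ρf c g E ν X := by
    have h1 := solidSq_addSmul_le hd hadm hE₀ hρs X Z δ (fun x => -X.p x) X.p_mem.neg
    have h2 := fluidSq_addSmul_le (c := c) hd hρf hg X Z δ (fun x => -X.p x) X.p_mem.neg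
    have h3 : pressureSq G E ν W = pressureSq G E ν X := by
      simp [pressureSq, hW, HSpace.addSmul]
    have h4 : 0 ≤ pressureSq G E ν X := by
      refine add_nonneg (integral_nonneg_of_ae ?_) hI0
      filter_upwards [hadm.lameMu_bounds hE₀] with x ⟨hx, _⟩
      have : 0 < lameMu E ν x := by linarith
      simp only [Pi.zero_apply]
      positivity
    have h5 : 2 * δ ^ 2 * (solidSq G ρs E ν Z + fluidSq G ρf c g Z) ≤
        2 * δ ^ 2 * (C₁ * (E₁ / 2 * normHSq G ρs ρf c g E ν X)) := by
      gcongr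
      exact hbound.trans (by gcongr)
    rw [normHSq_eq] at h5
    rw [hN, normHSq_eq, normHSq_eq, h3]
    linarith
  refine ⟨W, ?_, ?_⟩
  · unfold normH
    rw [Real.sqrt_le_left (by positivity), mul_pow, Real.sq_sqrt (hX0 X)]
    refine hWsq.trans ?_
    gcongr
    · exact hX0 X
    have h1 : N ≤ N + 2 * L + 3 / E₀ * (4 * C₁ / β ^ 2) := by
      have : 0 ≤ 2 * L + 3 / E₀ * (4 * C₁ / β ^ 2) := by positivity
      linarith
    nlinarith
  · unfold normH
    rw [Real.sq_sqrt (hX0 X)]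
    have h1 : β ^ 2 / (4 * C₁) * P ≤
        δ * -(∫ x in G.Ωs, X.p x * (Z.Du x).trace) -
          δ ^ 2 * (solidSq G ρs E ν Z + fluidSq G ρf c g Z) := by
      have h2 := mul_le_mul_of_nonneg_left hpair hδ0.le
      have h3 := mul_le_mul_of_nonneg_left hbound (sq_nonneg δ)
      have h4 : β ^ 2 / (4 * C₁) * P = δ * (β * P) - δ ^ 2 * (C₁ * P) := by
        rw [hδ]; field_simp; ring
      linarith
    set I := ∫ x in G.Ωs, invLambda E ν x * X.p x ^ 2
    set T := strainSq G ρs E ν X + fluidSq G ρf c g X with hT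
    have hT0 : 0 ≤ T := add_nonneg hS0 hF0
    have h2 : T / 2 + β ^ 2 / (4 * C₁) * P + I ≤ formA G ρs ρf c g E ν X W := by linarith
    have h3 : normHSq G ρs ρf c g E ν X ≤ L * T + 3 / E₀ * P + I := by
      rw [normHSq_eq, pressureSq, hT]
      nlinarith
    have h4 : 0 ≤ β ^ 2 / (4 * C₁) * P := by positivity
    have h5 : 3 / E₀ * P = 3 / E₀ * (4 * C₁ / β ^ 2) * (β ^ 2 / (4 * C₁) * P) := by
      field_simp
    have h6 : 0 ≤ 3 / E₀ * (4 * C₁ / β ^ 2) := by positivity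
    rw [h5] at h3
    exact h3.trans (absorb_le (by linarith) hN1 h6 hT0 h4 hI0 h2)

end Elastoacoustic

end

theorem lemma5p1 {d : ℕ} (hd : d = 2 ∨ d = 3) (G : Elastoacoustic.Geometry d)
    (E₀ E₁ ρs : ℝ) (hE₀ : 0 < E₀) (hE₁ : E₀ ≤ E₁) (hρs : 0 < ρs) :
    (∀ ρf c g : ℝ, 0 < ρf → 0 < c → 0 < g →
      ∃ C : ℝ, 0 < C ∧ ∀ E ν : Elastoacoustic.Sp d → ℝ,
        Elastoacoustic.AdmissibleModuli G.Ωs E₀ E₁ E ν →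
          Elastoacoustic.InfSupStable G ρs ρf c g E ν C) ∧
    (0 < Elastoacoustic.surf d G.ΓN →
      ∃ C : ℝ, 0 < C ∧ ∀ ρf c g : ℝ, 0 < ρf → 0 < c → 0 < g →
        ∀ E ν : Elastoacoustic.Sp d → ℝ,
          Elastoacoustic.AdmissibleModuli G.Ωs E₀ E₁ E ν →
            Elastoacoustic.InfSupStable G ρs ρf c g E ν C) := by
  have hd1 : 1 ≤ d := by omega
  constructor
  · intro ρf c g hρf _ hg
    obtain ⟨Ψ, _, hΨ⟩ := Elastoacoustic.exists_field_flux hd1 G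
    obtain ⟨C, hC, h⟩ := Elastoacoustic.exists_infSupStable hd1 G hE₀ hE₁ hρs Ψ hΨ
      (Elastoacoustic.fluidSq G ρf c g Ψ)
    exact ⟨C, hC, h ρf c g hρf hg le_rfl⟩
  · intro hN
    obtain ⟨Ψ, hw, hdw, hwn, hΨ⟩ := Elastoacoustic.exists_solidField_flux hd1 G hN
    obtain ⟨C, hC, h⟩ := Elastoacoustic.exists_infSupStable hd1 G hE₀ hE₁ hρs Ψ hΨ 0
    refine ⟨C, hC, fun ρf c g hρf _ hg => h ρf c g hρf hg ?_⟩
    simp [Elastoacoustic.fluidSq, hw, hdw, hwn]
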